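/- Let $k$ be an algebraically closed field, let $N$ be a free abelian group of finite rank with dual lattice $M=\mathrm{Hom}(N,\mathbf{Z})$, and let $\Delta$ be a (finite, nonempty) fan of strongly convex rational polyhedral cones in $N_{\mathbf{R}}=N\otimes_{\mathbf Z}\mathbf{R}$. Let $X=X(\Delta)$ be the corresponding toric variety over $k$, obtained by gluing the affine toric varieties $U_\sigma=\mathrm{Spec}\,k[\sigma^\vee\cap M]$, $\sigma\in\Delta$, with the action of the torus $T_N=\mathrm{Spec}\,k[M]$. Suppose that $X$ is quasi-projective over $k$ and that the support $|\Delta|=\bigcup_{\sigma\in\Delta}\sigma$ is convex and spans $N_{\mathbf R}$. Then there are an integer $r\ge 0$ and torus-invariant open subsets $$\emptyset=U_0\subseteq U_1\subseteq\cdots\subseteq U_r=X$$ such that for every $i$ with $1\le i\le r$, the set $U_i\smallsetminus U_{i-1}$ is a closed subset of $U_\sigma$ for some maximal cone $\sigma$ of $\Delta$. Moreover, the $U_i$ can be chosen such that, with the reduced induced scheme structure on each $U_i\smallsetminus U_{i-1}$, the following hold: 1. if $X$ is smooth over $k$, then every $U_i\smallsetminus U_{i-1}$ is isomorphic over $k$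 to an affine space $\mathbf{A}^n_k$ (with $n$ depending on $i$); 2. if $X$ is simplicial (that is, every cone of $\Delta$ is generated by linearly independent vectors), then every $U_i\smallsetminus U_{i-1}$ is isomorphic over $k$ to the quotient of an affine space $\mathbf{A}^n_k$ by the action of a finite group scheme over $k$, and, if $\mathrm{char}(k)=0$ (in particular, if $k=\mathbf{C}$), to the quotient of an affine space by the action of a finite group. -/

import Mathlib

open CategoryTheory CategoryTheory.Limits AlgebraicGeometry
open scoped TensorProduct

universe u

noncomputable section

namespace Toric

section Cones

variable {N : Type u} [AddCommGroup N]

/-- The real vector space `N_ℝ` of a lattice `N`. -/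
abbrev RealSpace (N : Type u) [AddCommGroup N] : Type u := ℝ ⊗[ℤ] N

/-- The dual lattice `M = Hom(N, ℤ)`. -/
abbrev DualLattice (N : Type u) [AddCommGroup N] : Type u := Module.Dual ℤ N

/-- The linear form `⟨u, ·⟩` on `N_ℝ` given by an element `u` of the dual lattice. -/
def pairing (u : DualLattice N) : RealSpace N →ₗ[ℝ] ℝ :=
  Module.Dual.baseChange ℝ u

@[simp]
lemma pairing_tmul (u : DualLattice N) (a : ℝ) (v : N) :
    pairing u (a ⊗ₜ[ℤ] v) = (u v : ℝ) * a := by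
  simp [pairing]

@[simp]
lemma pairing_zero : pairing (0 : DualLattice N) = 0 := by
  ext; simp

@[simp]
lemma pairing_add (u w : DualLattice N) : pairing (u + w) = pairing u + pairing w := by
  ext; simp

@[simp]
lemma pairing_nsmul (n : ℕ) (u : DualLattice N) : pairing (n • u) = n • pairing u := by
  ext; simp

/-- A cone in `N_ℝ` is rational polyhedral if it is generated by finitely many lattice vectors. -/
def IsRationalPolyhedral (σ : PointedCone ℝ (RealSpace N)) : Prop :=
  ∃ S : Set N, S.Finite ∧ σ = PointedCone.hull ℝ ((fun v : N ↦ (1 : ℝ) ⊗ₜ[ℤ] v) '' S)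

/-- A cone is strongly convex if it contains no line through the origin. -/
def IsStronglyConvex (σ : PointedCone ℝ (RealSpace N)) : Prop :=
  ∀ x, x ∈ σ → -x ∈ σ → x = 0

/-- `τ` is a face of the rational polyhedral cone `σ`: it is the intersection of `σ` with `u^⊥`,
for some lattice element `u` of the dual cone of `σ`. -/
def IsFace (τ σ : PointedCone ℝ (RealSpace N)) : Prop :=
  ∃ u : DualLattice N, (∀ x ∈ σ, 0 ≤ pairing u x) ∧ ∀ x, x ∈ τ ↔ x ∈ σ ∧ pairing u x = 0

/-- The semigroup `σ^∨ ∩ M`. -/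
def dualMonoid (σ : PointedCone ℝ (RealSpace N)) : AddSubmonoid (DualLattice N) where
  carrier := {u | ∀ x ∈ σ, 0 ≤ pairing u x}
  zero_mem' := by simp
  add_mem' ha hb x hx := by
    simpa using add_nonneg (ha x hx) (hb x hx)

lemma mem_dualMonoid {σ : PointedCone ℝ (RealSpace N)} {u : DualLattice N} :
    u ∈ dualMonoid σ ↔ ∀ x ∈ σ, 0 ≤ pairing u x := Iff.rfl

lemma dualMonoid_anti {τ σ : PointedCone ℝ (RealSpace N)} (h : τ ≤ σ) :
    dualMonoid σ ≤ dualMonoid τ := fun _ hu x hx ↦ hu x (h hx)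

lemma exists_add_nsmul_mem {σ τ : PointedCone ℝ (RealSpace N)} (hσ : IsRationalPolyhedral σ)
    {u : DualLattice N} (hu : ∀ x ∈ σ, 0 ≤ pairing u x)
    (hτ : ∀ x, x ∈ τ ↔ x ∈ σ ∧ pairing u x = 0)
    {w : DualLattice N} (hw : w ∈ dualMonoid τ) :
    ∃ p : ℕ, ∀ q, p ≤ q → w + q • u ∈ dualMonoid σ := by
  obtain ⟨S, hS, rfl⟩ := hσ
  have key : ∀ v ∈ S, ∃ p : ℕ, ∀ q, p ≤ q → 0 ≤ w v + q * u v := by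
    intro v hv
    have hmem : (1 : ℝ) ⊗ₜ[ℤ] v ∈
        PointedCone.hull ℝ ((fun v : N ↦ (1 : ℝ) ⊗ₜ[ℤ] v) '' S) :=
      PointedCone.subset_hull ⟨v, hv, rfl⟩
    have h0 : 0 ≤ u v := by simpa using hu _ hmem
    rcases h0.eq_or_lt with h | h
    · refine ⟨0, fun q _ ↦ ?_⟩
      have : 0 ≤ w v := by
        simpa using hw _ ((hτ _).2 ⟨hmem, by simp [← h]⟩)
      simpa [← h] using this
    · refine ⟨(w v).natAbs, fun q hq ↦ ?_⟩
      have h1 : ((w v).natAbs : ℤ) ≤ q := by exact_mod_cast hq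
      have h2 : -(w v) ≤ ((w v).natAbs : ℤ) := by omega
      nlinarith
  choose! p hp using key
  refine ⟨∑ v ∈ hS.toFinset, p v, fun q hq x hx ↦ ?_⟩
  induction hx using Submodule.span_induction with
  | mem x hx =>
    obtain ⟨v, hv, rfl⟩ := hx
    have := hp v hv q (le_trans (Finset.single_le_sum (f := p) (fun _ _ ↦ Nat.zero_le _)
      (hS.mem_toFinset.2 hv)) hq)
    simp only [pairing_add, pairing_nsmul, LinearMap.add_apply, LinearMap.smul_apply,
      pairing_tmul, mul_one, nsmul_eq_mul]
    exact_mod_cast this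
  | zero => simp
  | add x y _ _ hx hy => rw [map_add]; exact add_nonneg hx hy
  | smul a x _ hx =>
    rw [show a • x = (a : ℝ) • x from rfl, map_smul]
    exact mul_nonneg a.2 hx

end Cones

/-- A fan in `N_ℝ`: a finite nonempty collection of strongly convex rational polyhedral cones,
closed under taking faces, any two of which meet in a common face. -/
structure Fan (N : Type u) [AddCommGroup N] where
  cones : Set (PointedCone ℝ (RealSpace N))
  finite : cones.Finite
  nonempty : cones.Nonempty
  rational : ∀ σ ∈ cones, IsRationalPolyhedral σ
  stronglyConvex : ∀ σ ∈ cones, IsStronglyConvex σ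
  face_mem : ∀ σ ∈ cones, ∀ τ, IsFace τ σ → τ ∈ cones
  inter_face : ∀ σ ∈ cones, ∀ τ ∈ cones, IsFace (σ ⊓ τ) σ ∧ IsFace (σ ⊓ τ) τ

section Charts

variable (k : Type u) [Field k] {N : Type u} [AddCommGroup N]

/-- The coordinate ring `k[σ^∨ ∩ M]` of the affine toric variety `U_σ`. -/
abbrev ChartRing (σ : PointedCone ℝ (RealSpace N)) : Type u :=
  AddMonoidAlgebra k (dualMonoid σ)

/-- The inclusion `k[σ^∨ ∩ M] → k[τ^∨ ∩ M]` for `τ ⊆ σ`. -/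
def chartMap {τ σ : PointedCone ℝ (RealSpace N)} (h : τ ≤ σ) :
    ChartRing k σ →ₐ[k] ChartRing k τ :=
  AddMonoidAlgebra.mapDomainAlgHom k k (AddSubmonoid.inclusion (dualMonoid_anti h))

@[simp]
lemma chartMap_single {τ σ : PointedCone ℝ (RealSpace N)} (h : τ ≤ σ)
    (s : dualMonoid σ) (a : k) :
    chartMap k h (.single s a) = .single (AddSubmonoid.inclusion (dualMonoid_anti h) s) a := by
  simp [chartMap]

lemma chartMap_injective {τ σ : PointedCone ℝ (RealSpace N)} (h : τ ≤ σ) :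
    Function.Injective (chartMap k h) :=
  AddMonoidAlgebra.mapDomain_injective (AddSubmonoid.inclusion_injective (dualMonoid_anti h))

/-- For a face `τ = σ ∩ u^⊥`, the ring of `U_τ` is the localization of that of `U_σ` at `χ^u`. -/
lemma isLocalization_chartMap {τ σ : PointedCone ℝ (RealSpace N)} (hσ : IsRationalPolyhedral σ)
    (h : τ ≤ σ) {u : DualLattice N} (hu : u ∈ dualMonoid σ)
    (hτ : ∀ x, x ∈ τ ↔ x ∈ σ ∧ pairing u x = 0) :
    let := (chartMap k h).toRingHom.toAlgebra
    IsLocalization.Away (AddMonoidAlgebra.single (⟨u, hu⟩ : dualMonoid σ) (1 : k))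
      (ChartRing k τ) := by
  let := (chartMap k h).toRingHom.toAlgebra
  have hmap : ∀ x, algebraMap (ChartRing k σ) (ChartRing k τ) x = chartMap k h x := fun _ ↦ rfl
  have hneg : -u ∈ dualMonoid τ := fun x hx ↦ by
    have h1 : pairing (-u) x = - pairing u x := by
      rw [eq_neg_iff_add_eq_zero, ← LinearMap.add_apply, ← pairing_add]; simp
    rw [h1, ((hτ x).1 hx).2, neg_zero]
  have hpow : ∀ q : ℕ, (AddMonoidAlgebra.single (⟨u, hu⟩ : dualMonoid σ) (1 : k)) ^ q =
      AddMonoidAlgebra.single (q • (⟨u, hu⟩ : dualMonoid σ)) 1 := fun q ↦ by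
    rw [AddMonoidAlgebra.single_pow, one_pow]
  refine IsLocalization.Away.mk _ ?_ ?_ ?_
  · rw [hmap, chartMap_single]
    refine IsUnit.of_mul_eq_one (AddMonoidAlgebra.single ⟨-u, hneg⟩ 1) ?_
    rw [AddMonoidAlgebra.single_mul_single, AddMonoidAlgebra.one_def, mul_one]
    congr 1
    ext1
    simp
  · intro f
    suffices H : ∃ p : ℕ, ∀ q, p ≤ q → ∃ a, f * chartMap k h
        (.single (⟨u, hu⟩ : dualMonoid σ) (1 : k)) ^ q = chartMap k h a by
      obtain ⟨p, hp⟩ := H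
      obtain ⟨a, ha⟩ := hp p le_rfl
      exact ⟨p, a, ha⟩
    induction f using AddMonoidAlgebra.induction_linear with
    | zero => exact ⟨0, fun q _ ↦ ⟨0, by simp⟩⟩
    | add f g hf hg =>
      obtain ⟨p, hp⟩ := hf
      obtain ⟨p', hp'⟩ := hg
      refine ⟨max p p', fun q hq ↦ ?_⟩
      obtain ⟨a, ha⟩ := hp q (le_trans (le_max_left _ _) hq)
      obtain ⟨b, hb⟩ := hp' q (le_trans (le_max_right _ _) hq)
      exact ⟨a + b, by rw [add_mul, ha, hb, map_add]⟩
    | single w c =>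
      obtain ⟨p, hp⟩ := exists_add_nsmul_mem hσ hu hτ w.2
      refine ⟨p, fun q hq ↦ ⟨.single ⟨_, hp q hq⟩ c, ?_⟩⟩
      rw [← map_pow, hpow, chartMap_single, chartMap_single,
        AddMonoidAlgebra.single_mul_single, mul_one]
      congr 1
  · intro a b hab
    have hab' : a = b := chartMap_injective k h hab
    exact ⟨0, by rw [hab']⟩

end Charts

namespace Fan

variable {N : Type u} [AddCommGroup N] (Δ : Fan N)

lemma isFace_of_le {τ σ : PointedCone ℝ (RealSpace N)} (hτ : τ ∈ Δ.cones) (hσ : σ ∈ Δ.cones)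
    (h : τ ≤ σ) : IsFace τ σ := by
  have := (Δ.inter_face σ hσ τ hτ).1
  rwa [inf_eq_right.2 h] at this

/-- The support `|Δ|` of a fan: the union of its cones. -/
def support : Set (RealSpace N) := ⋃ σ ∈ Δ.cones, (σ : Set (RealSpace N))

/-- A fan has convex, full-dimensional support if `|Δ|` is convex and spans `N_ℝ`. -/
structure HasConvexFullDimensionalSupport : Prop where
  convex : Convex ℝ Δ.support
  span_eq_top : Submodule.span ℝ Δ.support = ⊤

/-- A fan is simplicial if each of its cones is generated by linearly independent vectors. -/
def IsSimplicial : Prop := ∀ σ ∈ Δ.cones, PointedCone.IsSimplicial σ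

/-- `σ` is a maximal cone of the fan, with respect to inclusion. -/
def IsMaximalCone (σ : Δ.cones) : Prop := IsMax σ

variable (k : Type u) [Field k]

/-- The diagram of the affine toric varieties `U_σ = Spec k[σ^∨ ∩ M]`, for `σ` in the fan, with
the maps `U_τ → U_σ` for `τ ⊆ σ`. -/
def diagram : Δ.cones ⥤ Scheme.{u} where
  obj σ := Spec (.of (ChartRing k σ.1))
  map f := Spec.map (CommRingCat.ofHom (chartMap k (leOfHom f)).toRingHom)
  map_id σ := by
    rw [← Spec.map_id]
    congr 1
    refine CommRingCat.hom_ext (RingHom.ext fun x ↦ ?_)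
    change chartMap k le_rfl x = x
    induction x using AddMonoidAlgebra.induction_linear with
    | zero => simp
    | add f g hf hg => rw [map_add, hf, hg]
    | single s a => rw [chartMap_single]; rfl
  map_comp f g := by
    rw [← Spec.map_comp]
    congr 1
    refine CommRingCat.hom_ext (RingHom.ext fun x ↦ ?_)
    change chartMap k (leOfHom (f ≫ g)) x = chartMap k (leOfHom f) (chartMap k (leOfHom g) x)
    induction x using AddMonoidAlgebra.induction_linear with
    | zero => simp
    | add f g hf hg => simp only [map_add, hf, hg]
    | single s a => simp only [chartMap_single]; rfl

instance isOpenImmersion_diagram_map {τ σ : Δ.cones} (f : τ ⟶ σ) :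
    IsOpenImmersion ((Δ.diagram k).map f) := by
  obtain ⟨u, hu, hτ⟩ := Δ.isFace_of_le τ.2 σ.2 (leOfHom f)
  let := (chartMap k (leOfHom f)).toRingHom.toAlgebra
  have := isLocalization_chartMap k (Δ.rational _ σ.2) (leOfHom f) hu hτ
  exact IsOpenImmersion.of_isLocalization (S := ChartRing k τ.1)
    (AddMonoidAlgebra.single (⟨u, hu⟩ : dualMonoid σ.1) (1 : k))

lemma range_diagram_map {τ σ : Δ.cones} (f : τ ⟶ σ) {u : DualLattice N}
    (hu : u ∈ dualMonoid σ.1) (hτ : ∀ x, x ∈ τ.1 ↔ x ∈ σ.1 ∧ pairing u x = 0) :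
    Set.range ((Δ.diagram k).map f) =
      (PrimeSpectrum.basicOpen (AddMonoidAlgebra.single (⟨u, hu⟩ : dualMonoid σ.1) (1 : k)) :
        Set (PrimeSpectrum (ChartRing k σ.1))) := by
  let := (chartMap k (leOfHom f)).toRingHom.toAlgebra
  have := isLocalization_chartMap k (Δ.rational _ σ.2) (leOfHom f) hu hτ
  exact PrimeSpectrum.localization_away_comap_range (ChartRing k τ.1)
    (AddMonoidAlgebra.single (⟨u, hu⟩ : dualMonoid σ.1) (1 : k))

instance isLocallyDirected_diagram : (Δ.diagram k ⋙ Scheme.forget).IsLocallyDirected := by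
  constructor
  intro i j l fi fj xi xj hx
  change (Δ.diagram k).map fi xi = (Δ.diagram k).map fj xj at hx
  obtain ⟨u, hu, hiu⟩ := Δ.isFace_of_le i.2 l.2 (leOfHom fi)
  obtain ⟨w, hw, hjw⟩ := Δ.isFace_of_le j.2 l.2 (leOfHom fj)
  have hm : i.1 ⊓ j.1 ∈ Δ.cones := Δ.face_mem _ i.2 _ (Δ.inter_face _ i.2 _ j.2).1
  let m : Δ.cones := ⟨i.1 ⊓ j.1, hm⟩
  let mi : m ⟶ i := homOfLE (show i.1 ⊓ j.1 ≤ i.1 from inf_le_left)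
  let mj : m ⟶ j := homOfLE (show i.1 ⊓ j.1 ≤ j.1 from inf_le_right)
  have hmuw : ∀ x, x ∈ m.1 ↔ x ∈ l.1 ∧ pairing (u + w) x = 0 := by
    intro x
    change x ∈ i.1 ⊓ j.1 ↔ _
    rw [Submodule.mem_inf, hiu, hjw, pairing_add, LinearMap.add_apply]
    constructor
    · rintro ⟨⟨h, h1⟩, _, h2⟩
      exact ⟨h, by rw [h1, h2, add_zero]⟩
    · rintro ⟨h, h1⟩
      have h2 := hu x h
      have h3 := hw x h
      exact ⟨⟨h, by linarith⟩, h, by linarith⟩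
  have huw : u + w ∈ dualMonoid l.1 := add_mem hu hw
  have hmem : (Δ.diagram k).map fi xi ∈ Set.range ((Δ.diagram k).map (mi ≫ fi)) := by
    rw [Δ.range_diagram_map k (mi ≫ fi) huw hmuw]
    have h1 : (Δ.diagram k).map fi xi ∈ Set.range ((Δ.diagram k).map fi) := ⟨_, rfl⟩
    have h2 : (Δ.diagram k).map fi xi ∈ Set.range ((Δ.diagram k).map fj) := ⟨xj, hx.symm⟩
    rw [Δ.range_diagram_map k fi hu hiu] at h1
    rw [Δ.range_diagram_map k fj hw hjw] at h2
    have h3 : (AddMonoidAlgebra.single (⟨u + w, huw⟩ : dualMonoid l.1) (1 : k)) =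
        AddMonoidAlgebra.single (⟨u, hu⟩ : dualMonoid l.1) (1 : k) *
          AddMonoidAlgebra.single (⟨w, hw⟩ : dualMonoid l.1) (1 : k) := by
      rw [AddMonoidAlgebra.single_mul_single, mul_one]
      rfl
    rw [h3, PrimeSpectrum.basicOpen_mul]
    exact ⟨h1, h2⟩
  obtain ⟨y, hy⟩ := hmem
  have e1 : (Δ.diagram k).map mi y = xi := by
    apply ((Δ.diagram k).map fi).isOpenEmbedding.injective
    rw [← hy, Functor.map_comp, Scheme.Hom.comp_apply]
  have e2 : (Δ.diagram k).map mj y = xj := by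
    apply ((Δ.diagram k).map fj).isOpenEmbedding.injective
    rw [← hx, ← hy, ← Scheme.Hom.comp_apply, ← Functor.map_comp]
    rfl
  exact ⟨m, mi, mj, y, e1, e2⟩

/-- The toric variety `X(Δ)` over `k`: the gluing of the affine schemes `U_σ`, for `σ` in the fan,
where `U_σ` and `U_τ` are glued along `U_{σ ∩ τ}`. -/
def variety : Scheme.{u} := colimit (Δ.diagram k)

/-- The inclusion of `U_σ` into the toric variety. -/
def chartι (σ : Δ.cones) : Spec (.of (ChartRing k σ.1)) ⟶ Δ.variety k :=
  colimit.ι (Δ.diagram k) σ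

instance (σ : Δ.cones) : IsOpenImmersion (Δ.chartι k σ) :=
  inferInstanceAs (IsOpenImmersion (colimit.ι (Δ.diagram k) σ))

/-- The affine open subset `U_σ` of the toric variety. -/
def chart (σ : Δ.cones) : (Δ.variety k).Opens := (Δ.chartι k σ).opensRange

/-- The structure morphism of the toric variety to `Spec k`. -/
def structureMorphism : Δ.variety k ⟶ Spec (.of k) :=
  colimit.desc (Δ.diagram k)
    { pt := Spec (.of k)
      ι :=
        { app := fun σ ↦ Spec.map (CommRingCat.ofHom (algebraMap k (ChartRing k σ.1)))
          naturality := fun τ σ f ↦ by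
            dsimp [diagram]
            rw [← Spec.map_comp, Category.comp_id]
            congr 1
            exact CommRingCat.hom_ext (RingHom.ext (chartMap k (leOfHom f)).commutes) } }

lemma chartι_structureMorphism (σ : Δ.cones) : Δ.chartι k σ ≫ Δ.structureMorphism k =
    Spec.map (CommRingCat.ofHom (algebraMap k (ChartRing k σ.1))) :=
  colimit.ι_desc _ _

/-- The `k`-points of the torus `T_N = Spec k[M]`, that is, the group `Hom(M, kˣ)`. -/
abbrev TorusPoint (N : Type u) [AddCommGroup N] (k : Type u) [Field k] : Type u :=
  Multiplicative (DualLattice N) →* kˣ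

/-- The action of a point `t` of the torus on the coordinate ring of `U_σ`:
`χ^u ↦ t(u) χ^u`. -/
def chartAction (t : TorusPoint N k) (σ : PointedCone ℝ (RealSpace N)) :
    ChartRing k σ →ₐ[k] ChartRing k σ :=
  AddMonoidAlgebra.lift k (ChartRing k σ) (dualMonoid σ)
    { toFun := fun s ↦ .single s.toAdd (t (.ofAdd (s.toAdd : DualLattice N)) : k)
      map_one' := by
        simp [AddMonoidAlgebra.one_def]
      map_mul' := fun a b ↦ by
        simp [AddMonoidAlgebra.single_mul_single] }

/-- The automorphism of the toric variety given by the action of a point of the torus. -/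
def torusAction (t : TorusPoint N k) : Δ.variety k ⟶ Δ.variety k :=
  colimMap (F := Δ.diagram k) (G := Δ.diagram k)
    { app := fun σ ↦ Spec.map (CommRingCat.ofHom (chartAction k t σ.1).toRingHom)
      naturality := fun τ σ f ↦ by
        dsimp [diagram]
        rw [← Spec.map_comp, ← Spec.map_comp]
        congr 1
        ext x
        · simp [chartAction, chartMap]
        · simp [chartAction] }

lemma chartι_torusAction (t : TorusPoint N k) (σ : Δ.cones) :
    Δ.chartι k σ ≫ Δ.torusAction k t =
      Spec.map (CommRingCat.ofHom (chartAction k t σ.1).toRingHom) ≫ Δ.chartι k σ :=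
  ι_colimMap _ _

variable {k} in
/-- An open subset of the toric variety is torus-invariant if it is preserved by all the points
of the torus (over an algebraically closed field, this is invariance under the torus). -/
def IsTorusInvariant (U : (Δ.variety k).Opens) : Prop :=
  ∀ t : TorusPoint N k, Δ.torusAction k t ⁻¹ᵁ U = U

end Fan

section Schemes

attribute [local instance] MvPolynomial.gradedAlgebra

variable {k : Type u} [Field k]

/-- The projective space `ℙⁿ` over `k`. -/
def projectiveSpace (n : ℕ) (k : Type u) [Field k] : Scheme.{u} :=
  Proj (MvPolynomial.homogeneousSubmodule (Fin (n + 1)) k)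

/-- The structure morphism `ℙⁿ → Spec k`. -/
def projectiveSpaceStructure (n : ℕ) (k : Type u) [Field k] :
    projectiveSpace n k ⟶ Spec (.of k) :=
  Proj.toSpecZero (MvPolynomial.homogeneousSubmodule (Fin (n + 1)) k) ≫
    Spec.map (CommRingCat.ofHom
      (algebraMap k (MvPolynomial.homogeneousSubmodule (Fin (n + 1)) k 0)))

/-- A scheme over `k` is quasi-projective if it admits an immersion over `k` into some `ℙⁿ`. -/
def IsQuasiProjective {X : Scheme.{u}} (f : X ⟶ Spec (.of k)) : Prop :=
  ∃ (n : ℕ) (i : X ⟶ projectiveSpace n k),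
    IsImmersion i ∧ i ≫ projectiveSpaceStructure n k = f

/-- Two schemes over `k` are isomorphic over `k`. -/
def IsoOver {X Y : Scheme.{u}} (f : X ⟶ Spec (.of k)) (g : Y ⟶ Spec (.of k)) : Prop :=
  ∃ e : X ≅ Y, e.hom ≫ g = f

/-- A scheme over `k` is an affine space: it is isomorphic over `k` to some `𝔸ⁿ`. -/
def IsAffineSpace {X : Scheme.{u}} (f : X ⟶ Spec (.of k)) : Prop :=
  ∃ n : ℕ, IsoOver f (𝔸(ULift.{u} (Fin n); Spec (.of k)) ↘ Spec (.of k))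

/-- A scheme over `k` is the quotient of an affine space by a finite group: for some finite group
`G` acting on `k[x₁, …, xₙ]` by `k`-algebra automorphisms, it is isomorphic over `k` to
`𝔸ⁿ/G`, the spectrum of the ring of invariants. -/
def IsFiniteQuotientOfAffineSpace {X : Scheme.{u}} (f : X ⟶ Spec (.of k)) : Prop :=
  ∃ (n : ℕ) (G : Type) (_ : Group G) (_ : Finite G)
    (_ : MulSemiringAction G (MvPolynomial (Fin n) k))
    (_ : SMulCommClass G k (MvPolynomial (Fin n) k)),
    IsoOver f (Spec.map (CommRingCat.ofHom
      (algebraMap k (FixedPoints.subalgebra k (MvPolynomial (Fin n) k) G))))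

/-- A coaction of a Hopf algebra `H` on a `k`-algebra `A`, that is, an action of the affine group
scheme `Spec H` on `Spec A`. -/
structure IsCoaction {A H : Type u} [CommRing A] [Algebra k A] [CommRing H] [HopfAlgebra k H]
    (ρ : A →ₐ[k] A ⊗[k] H) : Prop where
  coassoc : ((Algebra.TensorProduct.assoc k k k A H H).toAlgHom.comp
      (Algebra.TensorProduct.map ρ (AlgHom.id k H))).comp ρ =
    (Algebra.TensorProduct.map (AlgHom.id k A) (Bialgebra.comulAlgHom k H)).comp ρ
  counit : ((Algebra.TensorProduct.rid k k A).toAlgHom.comp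
      (Algebra.TensorProduct.map (AlgHom.id k A) (Bialgebra.counitAlgHom k H))).comp ρ =
    AlgHom.id k A

/-- A scheme over `k` is the quotient of an affine space by a finite group scheme: for some
finite group scheme `G = Spec H` over `k` acting on `𝔸ⁿ`, it is isomorphic over `k` to `𝔸ⁿ/G`,
the spectrum of the ring of invariants. -/
def IsFiniteGroupSchemeQuotientOfAffineSpace {X : Scheme.{u}} (f : X ⟶ Spec (.of k)) : Prop :=
  ∃ (n : ℕ) (H : Type u) (_ : CommRing H) (_ : HopfAlgebra k H) (_ : Module.Finite k H)
    (ρ : MvPolynomial (Fin n) k →ₐ[k] MvPolynomial (Fin n) k ⊗[k] H),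
    IsCoaction ρ ∧ IsoOver f (Spec.map (CommRingCat.ofHom (algebraMap k
      (AlgHom.equalizer ρ Algebra.TensorProduct.includeLeft))))

/-- The locally closed subset `V ∖ U`, for `U` and `V` open in `X`, as a closed subset of `V`. -/
def closedDiff {X : Scheme.{u}} (V U : X.Opens) : TopologicalSpace.Closeds V.toScheme :=
  (V.ι ⁻¹ᵁ U).compl

/-- The locally closed subset `V ∖ U` of `X` with its reduced induced scheme structure. -/
def diffScheme {X : Scheme.{u}} (V U : X.Opens) : Scheme.{u} :=
  (Scheme.IdealSheafData.vanishingIdeal (closedDiff V U)).subscheme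

/-- The inclusion of `V ∖ U` in `X`. -/
def diffSchemeι {X : Scheme.{u}} (V U : X.Opens) : diffScheme V U ⟶ X :=
  (Scheme.IdealSheafData.vanishingIdeal (closedDiff V U)).subschemeι ≫ V.ι

end Schemes

end Toric

end

/-! The strata are Białynicki-Birula-type cells for the one-parameter subgroup of a lattice vector
`v`, chosen in the support and outside the span of every cone that is not full-dimensional. For each
cone τ there is exactly one maximal cone σ ⊇ τ with `v ∈ σ + ℝτ` (`exists_inCell`, `inCell_unique`):
moving from `v` in the direction of a relative interior point of τ, one stays in the convex support
and finally remains in σ. The cell of σ is the union of the orbits of these τ. Inside `U_σ` it is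
the closed set where all `χ^u` with `u ∈ σ^∨` and `u(v) < 0` vanish (`mem_image_cellSet_iff`),
because by Farkas such a `u` vanishing on τ exists exactly when `v ∉ σ + ℝτ`.

The cells must be ordered so that initial unions are open. For this a strictly convex support
function is needed, given by linear forms `m_σ` on the maximal cones: if τ ⊆ τ' lie in the cells of
distinct σ, σ', then `m_σ(v) < m_σ'(v)` (`IsVertexFamily.eq_or_lt`), so sorting by `m_σ(v)` works.
The forms come from an immersion in `ℙⁿ`, without any equivariance (`exists_isVertexFamily`). At the
generic point of the torus the immersion is given by a primitive vector `(f_l)` of Laurent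
polynomials, as `k[M]` is factorial. Near the distinguished point of σ it is given by regular
functions, one of them nonzero there. Comparing lowest terms, all exponents of the `f_l` lie in `m_σ
+ σ^∨` for an exponent `m_σ` that occurs (`exists_vertex`). The coefficients at `m_σ` are the
coordinates of the image of the distinguished point, so `m_σ = m_σ'` forces σ = σ' by injectivity of
the immersion.

For simplicial σ with vectors `w_i` on its rays and a dual family `d_i` up to a scalar `c`, the
reduced cell has as coordinate ring the span of the characters in the face `u(w_i) = 0` for all `i`
with `d_i(v) < 0`. Sending `u` to its values on the other `w_i` identifies it with the span of the
monomials whose exponents lie in a lattice `L ⊇ cℤⁿ`. This is the ring of invariants of the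
diagonalizable group scheme dual to `ℤⁿ/L`, and in characteristic 0 of a finite group. If the chart
is smooth, an infinitesimal lifting argument shows that the irreducible elements of `σ^∨ ∩ M` form a
basis of `M` (`injective_of_formallySmooth`). Then `c = 1` and `L = ℤⁿ`, and the cell is an affine
space. -/

namespace Toric

/-! ### Farkas lemma, over an ordered field and for lattice vectors. -/

section Farkas

/-- **Farkas lemma** over a linearly ordered field. -/
theorem exists_nonneg_sum_or_exists_separating {K V : Type*} [Field K] [LinearOrder K]
    [IsStrictOrderedRing K] [AddCommGroup V] [Module K V] (n : ℕ) (w : Fin n → V) (v : V) :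
    (∃ c : Fin n → K, (∀ i, 0 ≤ c i) ∧ v = ∑ i, c i • w i) ∨
      ∃ f : V →ₗ[K] K, (∀ i, 0 ≤ f (w i)) ∧ f v < 0 := by
  induction n generalizing v with
  | zero =>
    by_cases hv : v = 0
    · exact .inl ⟨0, fun i ↦ le_rfl, by simp [hv]⟩
    · obtain ⟨f, hf⟩ := not_forall.1 (mt (Module.forall_dual_apply_eq_zero_iff K v).1 hv)
      rcases lt_or_gt_of_ne hf with h | h
      · exact .inr ⟨f, fun i ↦ i.elim0, h⟩
      · exact .inr ⟨-f, fun i ↦ i.elim0, by simpa using h⟩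
  | succ n ih =>
    rcases ih (fun i ↦ w i.castSucc) v with ⟨c, hc, hv⟩ | ⟨f, hf, hfv⟩
    · refine .inl ⟨Fin.snoc c 0, fun i ↦ ?_, ?_⟩
      · refine Fin.lastCases ?_ (fun i ↦ ?_) i <;> simp [hc]
      · simp [Fin.sum_univ_castSucc, hv]
    rcases le_or_gt 0 (f (w (Fin.last n))) with h | h
    · exact .inr ⟨f, fun i ↦ Fin.lastCases h hf i, hfv⟩
    set w₀ := w (Fin.last n) with hw₀
    -- Here `f` separates `v` from the first `n` vectors but is negative on `w₀`. Project along `w₀`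
    -- onto the kernel of `f` and induct once more: a solution lifts, the coefficient of `w₀` being
    -- nonnegative by the signs of `f`, and a separating form pulls back to one vanishing on `w₀`.
    let π : V →ₗ[K] V := LinearMap.id - (f.smulRight ((f w₀)⁻¹ • w₀))
    have hπ : ∀ x, π x = x - (f x * (f w₀)⁻¹) • w₀ := fun x ↦ by simp [π, smul_smul]
    rcases ih (fun i ↦ π (w i.castSucc)) (π v) with ⟨c, hc, hv⟩ | ⟨g, hg, hgv⟩
    · refine .inl ⟨Fin.snoc c (f v * (f w₀)⁻¹ - ∑ i, c i * (f (w i.castSucc) * (f w₀)⁻¹)),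
        fun i ↦ ?_, ?_⟩
      · refine Fin.lastCases ?_ (fun i ↦ ?_) i
        · rw [Fin.snoc_last, sub_nonneg]
          refine le_trans (Finset.sum_nonpos fun i _ ↦ ?_)
            (mul_nonneg_of_nonpos_of_nonpos hfv.le (inv_nonpos.2 h.le))
          exact mul_nonpos_of_nonneg_of_nonpos (hc i)
            (mul_nonpos_of_nonneg_of_nonpos (hf i) (inv_nonpos.2 h.le))
        · simp [hc]
      · simp only [hπ, smul_sub, Finset.sum_sub_distrib, smul_smul, ← Finset.sum_smul] at hv
        rw [Fin.sum_univ_castSucc]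
        simp only [Fin.snoc_castSucc, Fin.snoc_last, ← hw₀, sub_smul]
        rw [sub_eq_iff_eq_add] at hv
        refine hv.trans ?_
        abel
    · refine .inr ⟨g ∘ₗ π, fun i ↦ Fin.lastCases ?_ hg i, hgv⟩
      simp [hπ, ← hw₀, mul_inv_cancel₀ h.ne]

variable {N : Type u} [AddCommGroup N] [Module.Free ℤ N] [Module.Finite ℤ N]

/-- The class in `N_ℝ` of a lattice vector. -/
abbrev latticeVec (v : N) : RealSpace N := (1 : ℝ) ⊗ₜ[ℤ] v

/-- **Farkas lemma** for lattice vectors. -/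
theorem latticeVec_mem_hull {S : Set N} (hS : S.Finite) {v : N}
    (h : ∀ u : DualLattice N, (∀ w ∈ S, 0 ≤ u w) → 0 ≤ u v) :
    latticeVec v ∈ PointedCone.hull ℝ (latticeVec '' S) := by
  classical
  let b := Module.Free.chooseBasis ℤ N
  let e : N → (Module.Free.ChooseBasisIndex ℤ N → ℚ) := fun x i ↦ (b.repr x i : ℚ)
  obtain ⟨n, w, -, rfl⟩ := hS.fin_param
  -- Over ℚ, rather than ℝ, a separating form becomes an element of the dual lattice after clearing
  -- denominators.
  rcases exists_nonneg_sum_or_exists_separating (K := ℚ) n (fun i ↦ e (w i)) (e v) with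
    ⟨c, hc, hv⟩ | ⟨f, hf, hfv⟩
  · have key : latticeVec v = ∑ i, (c i : ℝ) • latticeVec (w i) := by
      apply (b.baseChange ℝ).repr.injective
      ext j
      have := congrFun hv j
      simp only [e, Finset.sum_apply, Pi.smul_apply, smul_eq_mul] at this
      have h2 : ((b.repr v j : ℚ) : ℝ) = ((∑ i, c i * (b.repr (w i) j : ℚ) : ℚ) : ℝ) := by
        rw [this]
      simpa using h2
    rw [key]
    refine Submodule.sum_mem _ fun i _ ↦ ?_
    exact Submodule.smul_mem _ (⟨(c i : ℝ), by exact_mod_cast hc i⟩ : {r : ℝ // 0 ≤ r})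
      (Submodule.subset_span ⟨w i, ⟨i, rfl⟩, rfl⟩)
  · exfalso
    obtain ⟨D, hD⟩ := IsLocalization.exist_integer_multiples_of_finite (nonZeroDivisors ℤ)
      (fun i ↦ f (Pi.single i 1))
    have hD0 : ((D : ℤ) : ℚ) ≠ 0 := by exact_mod_cast nonZeroDivisors.ne_zero D.2
    choose z hz using hD
    have hz' : ∀ i, (z i : ℚ) = D * f (Pi.single i 1) := fun i ↦ by
      have := hz i
      simpa [Algebra.smul_def] using this
    -- The second factor `D` makes the total scalar `D ^ 2`, which is positive whatever the sign of
    -- `D`.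
    let u : DualLattice N := (D : ℤ) • ∑ i, z i • b.coord i
    have hu : ∀ x, (u x : ℚ) = (D : ℚ) ^ 2 * f (e x) := by
      intro x
      have : f (e x) = ∑ i, e x i * f (Pi.single i 1) := by
        conv_lhs => rw [← LinearMap.sum_single_apply (fun _ ↦ ℚ) (e x), map_sum]
        refine Finset.sum_congr rfl fun i _ ↦ ?_
        rw [show Pi.single i (e x i) = e x i • (Pi.single i (1 : ℚ) : _ → ℚ) by
          rw [← Pi.single_smul, smul_eq_mul, mul_one], map_smul, smul_eq_mul]
      rw [this]
      simp only [u, LinearMap.smul_apply, LinearMap.sum_apply, smul_eq_mul, Int.cast_mul,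
        Int.cast_sum, hz', Module.Basis.coord_apply, e, Finset.mul_sum]
      exact Finset.sum_congr rfl fun i _ ↦ by ring
    have hpos : 0 < (D : ℚ) ^ 2 := by positivity
    have h1 : 0 ≤ u v := h u fun x hx ↦ by
      obtain ⟨i, rfl⟩ := hx
      have : (0 : ℚ) ≤ u (w i) := by rw [hu]; exact mul_nonneg hpos.le (hf i)
      exact_mod_cast this
    have h2 : (u v : ℚ) < 0 := by rw [hu]; exact mul_neg_of_pos_of_neg hpos hfv
    have h3 : (0 : ℚ) ≤ u v := by exact_mod_cast h1
    linarith

end Farkas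

end Toric

namespace Toric

/-! ### Rational polyhedral cones and their dual semigroups. -/

section ConeLemmas

variable {N : Type u} [AddCommGroup N]

@[simp]
lemma pairing_neg (u : DualLattice N) : pairing (-u) = -pairing u := by
  ext; simp

@[simp]
lemma pairing_sub (u w : DualLattice N) : pairing (u - w) = pairing u - pairing w := by
  ext; simp

lemma pairing_latticeVec (u : DualLattice N) (v : N) : pairing u (latticeVec v) = u v := by
  simp

lemma pairing_injective : Function.Injective (pairing (N := N)) := fun u w h ↦ by
  ext v
  have := LinearMap.congr_fun h (latticeVec v)
  simpa using this

@[simp]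
lemma latticeVec_add (v w : N) : latticeVec (v + w) = latticeVec v + latticeVec w :=
  TensorProduct.tmul_add _ _ _

lemma latticeVec_nsmul (n : ℕ) (w : N) : latticeVec (n • w) = (n : ℝ) • latticeVec w := by
  rw [Nat.cast_smul_eq_nsmul, latticeVec, TensorProduct.tmul_smul]

lemma cone_smul_mem {E : Type*} [AddCommGroup E] [Module ℝ E] {σ : PointedCone ℝ E} {x : E}
    (hx : x ∈ σ) {r : ℝ} (hr : 0 ≤ r) : r • x ∈ σ :=
  Submodule.smul_mem σ (⟨r, hr⟩ : {r : ℝ // 0 ≤ r}) hx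

lemma mem_dualMonoid_hull {S : Set N} {u : DualLattice N} :
    u ∈ dualMonoid (PointedCone.hull ℝ (latticeVec '' S)) ↔ ∀ w ∈ S, 0 ≤ u w := by
  constructor
  · intro h w hw
    have := h _ (Submodule.subset_span ⟨w, hw, rfl⟩)
    simpa using this
  · intro h x hx
    induction hx using Submodule.span_induction with
    | mem x hx =>
      obtain ⟨v, hv, rfl⟩ := hx
      simpa using h v hv
    | zero => simp
    | add x y _ _ hx hy => rw [map_add]; exact add_nonneg hx hy
    | smul a x _ hx =>
      rw [show a • x = (a : ℝ) • x from rfl, map_smul]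
      exact mul_nonneg a.2 hx

/-- A rational polyhedral cone has a lattice point in its relative interior. -/
lemma IsRationalPolyhedral.exists_interior {τ : PointedCone ℝ (RealSpace N)}
    (hτ : IsRationalPolyhedral τ) : ∃ x : N, latticeVec x ∈ τ ∧
      ∀ u ∈ dualMonoid τ, u x = 0 → ∀ y ∈ τ, pairing u y = 0 := by
  obtain ⟨S, hS, rfl⟩ := hτ
  -- An element of the dual semigroup is nonnegative on each generator, so it vanishes on their sum
  -- only if it vanishes on all of them.
  refine ⟨∑ w ∈ hS.toFinset, w, ?_, fun u hu h y hy ↦ ?_⟩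
  · rw [latticeVec, TensorProduct.tmul_sum]
    exact Submodule.sum_mem _ fun w hw ↦ Submodule.subset_span ⟨w, hS.mem_toFinset.1 hw, rfl⟩
  · rw [map_sum, Finset.sum_eq_zero_iff_of_nonneg
      (fun w hw ↦ mem_dualMonoid_hull.1 hu w (hS.mem_toFinset.1 hw))] at h
    have hneg : -u ∈ dualMonoid (PointedCone.hull ℝ (latticeVec '' S)) :=
      mem_dualMonoid_hull.2 fun w hw ↦ by simp [h w (hS.mem_toFinset.2 hw)]
    have h1 := hu y hy
    have h2 := hneg y hy
    rw [pairing_neg, LinearMap.neg_apply] at h2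
    linarith

lemma IsRationalPolyhedral.span_latticeVec {τ : PointedCone ℝ (RealSpace N)}
    (hτ : IsRationalPolyhedral τ) :
    Submodule.span ℝ (τ : Set (RealSpace N)) ≤
      Submodule.span ℝ {x | x ∈ τ ∧ ∃ w : N, latticeVec w = x} := by
  obtain ⟨S, hS, rfl⟩ := hτ
  refine Submodule.span_le.2 fun x hx ↦ ?_
  induction hx using Submodule.span_induction with
  | mem x hx =>
    obtain ⟨v, hv, rfl⟩ := hx
    exact Submodule.subset_span ⟨Submodule.subset_span ⟨v, hv, rfl⟩, v, rfl⟩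
  | zero => exact zero_mem _
  | add x y _ _ hx hy => exact add_mem hx hy
  | smul a x _ hx => exact Submodule.smul_mem _ (a : ℝ) hx

variable [Module.Free ℤ N] [Module.Finite ℤ N]

/-- Rational polyhedral cones are determined by their dual semigroups. -/
lemma IsRationalPolyhedral.latticeVec_mem {σ : PointedCone ℝ (RealSpace N)}
    (hσ : IsRationalPolyhedral σ) {v : N} (h : ∀ u ∈ dualMonoid σ, 0 ≤ u v) :
    latticeVec v ∈ σ := by
  obtain ⟨S, hS, rfl⟩ := hσ
  exact latticeVec_mem_hull hS fun u hu ↦ h u (mem_dualMonoid_hull.2 hu)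

/-- If the lattice vector `v` is not in `σ + ℝ τ`, this is detected by an element of the dual
semigroup of `σ` vanishing on `τ`. -/
lemma IsRationalPolyhedral.exists_separating {σ τ : PointedCone ℝ (RealSpace N)}
    (hσ : IsRationalPolyhedral σ) (hτ : IsRationalPolyhedral τ) (hle : τ ≤ σ) {v : N}
    (h : ∀ x ∈ τ, latticeVec v + x ∉ σ) :
    ∃ u ∈ dualMonoid σ, (∀ x ∈ τ, pairing u x = 0) ∧ u v < 0 := by
  obtain ⟨x, hx, hinter⟩ := hτ.exists_interior
  obtain ⟨S, hS, rfl⟩ := hσ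
  by_contra! hu
  -- An element of the dual semigroup that is nonnegative on `-x` vanishes at `x`, hence on τ. So if
  -- no element separates, Farkas puts `v` in σ + ℝ≥0(-x).
  have key : latticeVec v ∈ PointedCone.hull ℝ (latticeVec '' (S ∪ {-x})) := by
    refine latticeVec_mem_hull (hS.union (Set.finite_singleton _)) fun u hu' ↦ ?_
    have huS : u ∈ dualMonoid (PointedCone.hull ℝ (latticeVec '' S)) :=
      mem_dualMonoid_hull.2 fun w hw ↦ hu' w (.inl hw)
    refine hu u huS (hinter u (dualMonoid_anti hle huS) ?_)
    have h1 : 0 ≤ u (-x) := hu' _ (.inr rfl)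
    have h2 := huS _ (hle hx)
    rw [pairing_latticeVec] at h2
    rw [map_neg] at h1
    have : 0 ≤ u x := by exact_mod_cast h2
    linarith
  rw [Set.image_union, PointedCone.hull, Submodule.span_union, Submodule.mem_sup] at key
  obtain ⟨y, hy, z, hz, hyz⟩ := key
  rw [Set.image_singleton, Submodule.mem_span_singleton] at hz
  obtain ⟨a, rfl⟩ := hz
  refine h ((a : ℝ) • latticeVec x) (cone_smul_mem hx a.2) ?_
  rw [← hyz, show a • latticeVec (-x) = (a : ℝ) • latticeVec (-x) from rfl, latticeVec,
    TensorProduct.tmul_neg, smul_neg, add_assoc, neg_add_cancel, add_zero]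
  exact hy

/-- The dual semigroup of a strongly convex cone has an element which is positive on
the nonzero vectors of the cone. -/
lemma exists_forall_pos {σ : PointedCone ℝ (RealSpace N)} (hσ : IsRationalPolyhedral σ)
    (hσ' : IsStronglyConvex σ) : ∃ u ∈ dualMonoid σ, ∀ x ∈ σ, pairing u x = 0 → x = 0 := by
  classical
  have hσ₀ := hσ
  obtain ⟨S, hS, hσS⟩ := hσ
  have hmem : ∀ w ∈ S, latticeVec w ∈ σ := fun w hw ↦ by
    rw [hσS]; exact Submodule.subset_span ⟨w, hw, rfl⟩
  -- Strong convexity keeps `-w` out of σ for a nonzero generator, so some element of the dual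
  -- semigroup is positive on `w`. The sum of these elements is positive on all nonzero generators.
  have : ∀ w ∈ S, ∃ u ∈ dualMonoid σ, u w = 0 → latticeVec w = 0 := by
    intro w hw
    by_cases h : latticeVec w = 0
    · exact ⟨0, zero_mem _, fun _ ↦ h⟩
    · have : latticeVec (-w) ∉ σ := fun hw' ↦ h (hσ' _ (hmem w hw)
        (by rwa [latticeVec, TensorProduct.tmul_neg] at hw'))
      obtain ⟨u, hu, huw⟩ : ∃ u ∈ dualMonoid σ, u (-w) < 0 := by
        by_contra! hc
        exact this (hσ₀.latticeVec_mem hc)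
      refine ⟨u, hu, fun h0 ↦ ?_⟩
      rw [map_neg, h0] at huw
      exact absurd huw (by simp)
  choose! f hf hf0 using this
  have hsum : ∑ w ∈ hS.toFinset, f w ∈ dualMonoid σ :=
    sum_mem fun w hw ↦ hf w (hS.mem_toFinset.1 hw)
  refine ⟨_, hsum, fun x hx ↦ ?_⟩
  have hpos : ∀ w ∈ S, (∑ w ∈ hS.toFinset, f w) w = 0 → latticeVec w = 0 := by
    intro w hw h0
    rw [LinearMap.sum_apply, Finset.sum_eq_zero_iff_of_nonneg] at h0
    · exact hf0 w hw (h0 w (hS.mem_toFinset.2 hw))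
    · intro w' hw'
      have := hf w' (hS.mem_toFinset.1 hw') _ (hmem w hw)
      rw [pairing_latticeVec] at this
      exact_mod_cast this
  generalize ∑ w ∈ hS.toFinset, f w = u at *
  rw [hσS] at hx
  induction hx using Submodule.span_induction with
  | mem x hx =>
    obtain ⟨v, hv, rfl⟩ := hx
    intro h
    exact hpos v hv (by simpa using h)
  | zero => simp
  | add x y hx hy hx' hy' =>
    intro h
    rw [map_add] at h
    have h1 := hsum x (by rw [hσS]; exact hx)
    have h2 := hsum y (by rw [hσS]; exact hy)
    rw [hx' (by linarith), hy' (by linarith), add_zero]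
  | smul a x _ hx =>
    rw [show a • x = (a : ℝ) • x from rfl, map_smul, smul_eq_mul, mul_eq_zero]
    rintro (h | h)
    · rw [h, zero_smul]
    · rw [hx h, smul_zero]

end ConeLemmas

/-! ### Generic vectors and the cell of a cone. -/

namespace Fan

variable {N : Type u} [AddCommGroup N] (Δ : Fan N)

lemma inf_mem {σ τ : PointedCone ℝ (RealSpace N)} (hσ : σ ∈ Δ.cones) (hτ : τ ∈ Δ.cones) :
    σ ⊓ τ ∈ Δ.cones :=
  Δ.face_mem _ hσ _ (Δ.inter_face _ hσ _ hτ).1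

lemma bot_mem [Module.Free ℤ N] [Module.Finite ℤ N] :
    (⊥ : PointedCone ℝ (RealSpace N)) ∈ Δ.cones := by
  obtain ⟨σ, hσ⟩ := Δ.nonempty
  obtain ⟨u, hu, h⟩ := exists_forall_pos (Δ.rational _ hσ) (Δ.stronglyConvex _ hσ)
  refine Δ.face_mem _ hσ _ ⟨u, hu, fun x ↦ ⟨?_, fun hx ↦ (Submodule.mem_bot _).2 (h x hx.1 hx.2)⟩⟩
  rintro h0
  rw [(Submodule.mem_bot _).1 h0]
  exact ⟨zero_mem _, map_zero _⟩

lemma exists_le_maximal (τ : Δ.cones) : ∃ σ : Δ.cones, Δ.IsMaximalCone σ ∧ τ ≤ σ := by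
  have := Δ.finite.to_subtype
  obtain ⟨σ, h1, h2⟩ := (Set.toFinite {σ : Δ.cones | τ ≤ σ}).exists_le_maximal (le_refl τ)
  exact ⟨σ, fun ρ hρ ↦ h2.2 (h2.1.trans hρ) hρ, h1⟩

/-- A lattice vector in the support of a fan is generic if it does not lie in the span of any cone
that is not full-dimensional. -/
structure IsGeneric (v : N) : Prop where
  mem_support : latticeVec v ∈ Δ.support
  span_eq_top : ∀ σ ∈ Δ.cones, latticeVec v ∈ Submodule.span ℝ (σ : Set (RealSpace N)) →
    Submodule.span ℝ (σ : Set (RealSpace N)) = ⊤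

/-- The cone `τ` belongs to the cell of the cone `σ` with respect to `v`: it is contained in `σ`,
and `v` is in `σ + ℝ τ`. -/
def InCell (v : N) (τ σ : PointedCone ℝ (RealSpace N)) : Prop :=
  τ ≤ σ ∧ ∃ x ∈ τ, latticeVec v + x ∈ σ

variable {Δ}

/-- The support of a fan with convex support, as a cone. -/
def supportCone (h : Convex ℝ Δ.support) : PointedCone ℝ (RealSpace N) where
  carrier := Δ.support
  zero_mem' := by
    obtain ⟨σ, hσ⟩ := Δ.nonempty
    exact Set.mem_biUnion hσ (zero_mem σ)
  smul_mem' := by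
    rintro a x hx
    obtain ⟨σ, hσ, hx⟩ := Set.mem_iUnion₂.1 hx
    exact Set.mem_biUnion hσ (Submodule.smul_mem σ a hx)
  add_mem' := by
    rintro x y hx hy
    have := h hx hy (a := 1 / 2) (b := 1 / 2) (by norm_num) (by norm_num) (by norm_num)
    obtain ⟨σ, hσ, hz⟩ := Set.mem_iUnion₂.1 this
    refine Set.mem_biUnion hσ ?_
    have h2 := cone_smul_mem (σ := σ) hz (r := 2) (by norm_num)
    rw [← smul_add, smul_smul] at h2
    simpa using h2

lemma mem_supportCone {h : Convex ℝ Δ.support} {x : RealSpace N} :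
    x ∈ supportCone h ↔ x ∈ Δ.support := Iff.rfl

/-- On the progression `v + t • e` each form vanishes for at most one `t`: either it is nonzero on
`e`, or it is constant and already nonzero at `v`. Hence some `t` avoids the zeros of all of them.
-/
lemma exists_forall_ne_zero {L : AddSubmonoid N} (F : Finset (N →+ ℝ))
    (hF : ∀ φ ∈ F, ∃ e ∈ L, φ e ≠ 0) : ∃ v ∈ L, ∀ φ ∈ F, φ v ≠ 0 := by
  classical
  induction F using Finset.induction_on with
  | empty => exact ⟨0, zero_mem _, by simp⟩
  | insert ψ F hψ ih =>
    obtain ⟨v, hv, hvF⟩ := ih fun φ hφ ↦ hF φ (Finset.mem_insert_of_mem hφ)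
    obtain ⟨e, he, heψ⟩ := hF ψ (Finset.mem_insert_self _ _)
    have hfin : (⋃ φ ∈ insert ψ F, {t : ℕ | φ v + t * φ e = 0 }).Finite := by
      refine Set.Finite.biUnion (Finset.finite_toSet _) fun φ hφ ↦ ?_
      refine Set.Subsingleton.finite fun t ht s hs ↦ ?_
      simp only [Set.mem_ofPred_eq] at ht hs
      by_cases h0 : φ e = 0
      · rw [h0, mul_zero, add_zero] at ht
        rcases Finset.mem_insert.1 hφ with rfl | h
        · exact absurd h0 heψ
        · exact absurd ht (hvF φ h)
      · have : (t : ℝ) * φ e = s * φ e := by linarith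
        exact_mod_cast mul_right_cancel₀ h0 this
    obtain ⟨t, ht⟩ := hfin.infinite_compl.nonempty
    refine ⟨v + t • e, add_mem hv (nsmul_mem he t), fun φ hφ h0 ↦ ht ?_⟩
    refine Set.mem_biUnion hφ ?_
    simpa using h0

lemma exists_isGeneric (h : Δ.HasConvexFullDimensionalSupport) : ∃ v, Δ.IsGeneric v := by
  classical
  let L : AddSubmonoid N :=
    { carrier := {v | latticeVec v ∈ Δ.support}
      zero_mem' := by
        have := mem_supportCone.1 (zero_mem (supportCone h.convex))
        rwa [← TensorProduct.tmul_zero (M := ℝ) N (1 : ℝ)] at this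
      add_mem' := fun {a b} ha hb ↦ by
        have := mem_supportCone.1 (add_mem (S := PointedCone ℝ (RealSpace N))
          (s := supportCone h.convex) ha hb)
        rwa [← latticeVec_add] at this }
  have hspan : Submodule.span ℝ (latticeVec '' (L : Set N)) = ⊤ := by
    rw [eq_top_iff, ← h.span_eq_top, Submodule.span_le]
    intro x hx
    obtain ⟨σ, hσ, hx⟩ := Set.mem_iUnion₂.1 hx
    refine Submodule.span_mono ?_ ((Δ.rational σ hσ).span_latticeVec (Submodule.subset_span hx))
    rintro _ ⟨hw, w, rfl⟩
    exact ⟨w, Set.mem_biUnion hσ hw, rfl⟩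
  have key : ∀ σ ∈ {σ ∈ Δ.cones | Submodule.span ℝ (σ : Set (RealSpace N)) ≠ ⊤},
      ∃ φ : N →+ ℝ, (∀ v, latticeVec v ∈ Submodule.span ℝ (σ : Set (RealSpace N)) → φ v = 0) ∧
        ∃ e ∈ L, φ e ≠ 0 := by
    rintro σ ⟨hσ, hne⟩
    obtain ⟨f, hf0, hf⟩ := Submodule.exists_le_ker_of_lt_top _ (lt_top_iff_ne_top.2 hne)
    refine ⟨(f.toAddMonoidHom).comp
      (AddMonoidHom.mk' latticeVec latticeVec_add), fun v hv ↦ hf hv, ?_⟩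
    by_contra! hc
    refine hf0 (LinearMap.ext_on hspan ?_)
    rintro _ ⟨e, he, rfl⟩
    exact hc e he
  choose! φ hφ hφL using key
  have hfin : {σ ∈ Δ.cones | Submodule.span ℝ (σ : Set (RealSpace N)) ≠ ⊤}.Finite :=
    Δ.finite.subset fun _ h ↦ h.1
  obtain ⟨v, hv, hvF⟩ := exists_forall_ne_zero (L := L) (hfin.toFinset.image φ) (by
    intro ψ hψ
    obtain ⟨σ, hσ, rfl⟩ := Finset.mem_image.1 hψ
    exact hφL σ (hfin.mem_toFinset.1 hσ))
  refine ⟨v, hv, fun σ hσ hvσ ↦ ?_⟩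
  by_contra hne
  exact hvF (φ σ) (Finset.mem_image_of_mem _ (hfin.mem_toFinset.2 ⟨hσ, hne⟩))
    (hφ σ ⟨hσ, hne⟩ v hvσ)

lemma eq_zero_of_face {σ τ : PointedCone ℝ (RealSpace N)} {u : DualLattice N}
    (hτ : ∀ x, x ∈ τ ↔ x ∈ σ ∧ pairing u x = 0)
    (h : Submodule.span ℝ (τ : Set (RealSpace N)) = ⊤) : u = 0 := by
  apply pairing_injective
  rw [pairing_zero]
  exact LinearMap.ext_on h fun x hx ↦ ((hτ x).1 hx).2

/-- Both `v + x + x'` and `x + x'` lie in σ ∩ σ', so `v` is in the span of this common face. By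
genericity the face is full-dimensional, so it is all of σ and all of σ'. -/
lemma inCell_unique {v : N} (hv : Δ.IsGeneric v) {τ σ σ' : Δ.cones}
    (h : InCell v τ.1 σ.1) (h' : InCell v τ.1 σ'.1) : σ = σ' := by
  obtain ⟨hle, x, hx, hvx⟩ := h
  obtain ⟨hle', x', hx', hvx'⟩ := h'
  have hmem : latticeVec v + x + x' ∈ σ.1 ⊓ σ'.1 :=
    ⟨add_mem hvx (hle hx'), by rw [add_right_comm]; exact add_mem hvx' (hle' hx)⟩
  have hxx' : x + x' ∈ σ.1 ⊓ σ'.1 := ⟨add_mem (hle hx) (hle hx'), add_mem (hle' hx) (hle' hx')⟩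
  have hspan := hv.span_eq_top _ (Δ.inf_mem σ.2 σ'.2) (by
    rw [← add_sub_cancel_right (latticeVec v) (x + x'), ← add_assoc]
    exact sub_mem (Submodule.subset_span hmem) (Submodule.subset_span hxx'))
  obtain ⟨⟨u, hu, hface⟩, u', hu', hface'⟩ := Δ.inter_face _ σ.2 _ σ'.2
  have h1 := eq_zero_of_face hface hspan
  have h2 := eq_zero_of_face hface' hspan
  subst h1 h2
  exact le_antisymm (fun y hy ↦ ((hface y).2 ⟨hy, by simp⟩).2)
    (fun y hy ↦ ((hface' y).2 ⟨hy, by simp⟩).1)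

/-- The vertices `m_σ ∈ M` of a strictly convex support function on the fan. -/
structure IsVertexFamily (Δ : Fan N) (m : Δ.cones → DualLattice N) : Prop where
  le : ∀ σ σ', Δ.IsMaximalCone σ → Δ.IsMaximalCone σ' → ∀ x ∈ σ.1,
    pairing (m σ) x ≤ pairing (m σ') x
  injOn : ∀ σ σ', Δ.IsMaximalCone σ → Δ.IsMaximalCone σ' → m σ = m σ' → σ = σ'

/-- The vector `x` lies in both maximal cones, so `m σ` and `m σ'` agree on it, and minimality of `m
σ` at `v + x ∈ σ` yields `m σ v ≤ m σ' v`. In case of equality `v` is in the span of the face of σ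
where the two forms agree; by genericity this face spans, so the forms coincide. -/
lemma IsVertexFamily.eq_or_lt {m : Δ.cones → DualLattice N} (hm : IsVertexFamily Δ m) {v : N}
    (hv : Δ.IsGeneric v) {τ τ' σ σ' : Δ.cones} (hσ : Δ.IsMaximalCone σ)
    (hσ' : Δ.IsMaximalCone σ') (hττ' : τ ≤ τ') (h : InCell v τ.1 σ.1) (h' : InCell v τ'.1 σ'.1) :
    σ = σ' ∨ m σ v < m σ' v := by
  obtain ⟨hle, x, hx, hvx⟩ := h
  have hxσ' : x ∈ σ'.1 := h'.1 (hττ' hx)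
  have h0 : pairing (m σ) x = pairing (m σ') x :=
    le_antisymm (hm.le _ _ hσ hσ' _ (hle hx)) (hm.le _ _ hσ' hσ _ hxσ')
  have h1 := hm.le _ _ hσ hσ' _ hvx
  rw [map_add, map_add, h0, pairing_latticeVec, pairing_latticeVec, add_le_add_iff_right] at h1
  have h2 : m σ v ≤ m σ' v := by exact_mod_cast h1
  refine h2.eq_or_lt.imp_left fun heq ↦ hm.injOn _ _ hσ hσ' ?_
  let ρ : PointedCone ℝ (RealSpace N) :=
    σ.1 ⊓ (LinearMap.ker (pairing (m σ' - m σ))).restrictScalars _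
  have hρ : ∀ x, x ∈ ρ ↔ x ∈ σ.1 ∧ pairing (m σ' - m σ) x = 0 := fun x ↦ Iff.rfl
  have hface : IsFace ρ σ.1 := ⟨m σ' - m σ, fun y hy ↦ by
    simpa using hm.le _ _ hσ hσ' y hy, hρ⟩
  have hspan := hv.span_eq_top _ (Δ.face_mem _ σ.2 _ hface) (by
    rw [← add_sub_cancel_right (latticeVec v) x]
    refine sub_mem (Submodule.subset_span ((hρ _).2 ⟨hvx, ?_⟩))
      (Submodule.subset_span ((hρ _).2 ⟨hle hx, ?_⟩)) <;> simp [h0, heq])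
  exact (sub_eq_zero.1 (eq_zero_of_face hρ hspan)).symm

variable [Module.Free ℤ N] [Module.Finite ℤ N]

/-- Take `x` in the relative interior of τ. By convexity all `v + n • x` are in the support, so
infinitely many lie in one cone. That cone contains the limit direction `x`, hence has τ as a face,
and may be enlarged to a maximal one. -/
lemma exists_inCell (h : Δ.HasConvexFullDimensionalSupport) {v : N} (hv : Δ.IsGeneric v)
    (τ : Δ.cones) : ∃ σ : Δ.cones, Δ.IsMaximalCone σ ∧ InCell v τ.1 σ.1 := by
  obtain ⟨x, hx, hinter⟩ := (Δ.rational _ τ.2).exists_interior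
  have hmem : ∀ n : ℕ, ∃ σ : Δ.cones, latticeVec (v + n • x) ∈ σ.1 := by
    intro n
    have : latticeVec (v + n • x) ∈ supportCone h.convex := by
      rw [latticeVec_add, latticeVec_nsmul]
      exact add_mem hv.mem_support
        (cone_smul_mem (Set.mem_biUnion τ.2 hx : latticeVec x ∈ Δ.support) (by positivity))
    obtain ⟨σ, hσ, hz⟩ := Set.mem_iUnion₂.1 this
    exact ⟨⟨σ, hσ⟩, hz⟩
  choose s hs using hmem
  have := Δ.finite.to_subtype
  obtain ⟨σ, hσ⟩ := Finite.exists_infinite_fiber s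
  rw [Set.infinite_coe_iff] at hσ
  have hxσ : latticeVec x ∈ σ.1 := by
    refine (Δ.rational _ σ.2).latticeVec_mem fun u hu ↦ ?_
    by_contra! hneg
    obtain ⟨n, hn, hlt⟩ := hσ.exists_gt (u v).natAbs
    have h1 := hu _ (by have := hs n; rwa [show s n = σ from hn] at this)
    rw [pairing_latticeVec] at h1
    have h2 : 0 ≤ u (v + n • x) := by exact_mod_cast h1
    rw [map_add, map_nsmul, nsmul_eq_mul] at h2
    have h3 : ((u v).natAbs : ℤ) < n := by exact_mod_cast hlt
    have h4 : u v ≤ ((u v).natAbs : ℤ) := Int.le_natAbs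
    nlinarith
  have hle : τ.1 ≤ σ.1 := by
    obtain ⟨u, hu, hface⟩ := (Δ.inter_face _ σ.2 _ τ.2).2
    have h0 : u x = 0 := by
      have := ((hface (latticeVec x)).1 ⟨hxσ, hx⟩).2
      rw [pairing_latticeVec] at this
      exact_mod_cast this
    intro y hy
    exact ((hface y).2 ⟨hy, hinter u hu h0 y hy⟩).1
  obtain ⟨ρ, hρ, hle'⟩ := Δ.exists_le_maximal σ
  obtain ⟨n, hn⟩ := hσ.nonempty
  refine ⟨ρ, hρ, hle.trans hle', (n : ℝ) • latticeVec x, cone_smul_mem hx (by positivity), ?_⟩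
  rw [← latticeVec_nsmul, ← latticeVec_add]
  have := hs n
  rw [show s n = σ from hn] at this
  exact hle' this

/-- By maximality σ lies in its own cell, so a generic `v` belongs to σ + ℝσ, the span of σ. -/
lemma IsMaximalCone.span_eq_top (h : Δ.HasConvexFullDimensionalSupport) {σ : Δ.cones}
    (hσ : Δ.IsMaximalCone σ) : Submodule.span ℝ (σ.1 : Set (RealSpace N)) = ⊤ := by
  obtain ⟨v, hv⟩ := exists_isGeneric h
  obtain ⟨ρ, -, hle, x, hx, hvx⟩ := exists_inCell h hv σ
  have : ρ = σ := le_antisymm (hσ hle) hle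
  subst this
  refine hv.span_eq_top _ ρ.2 ?_
  rw [← add_sub_cancel_right (latticeVec v) x]
  exact sub_mem (Submodule.subset_span hvx) (Submodule.subset_span hx)

lemma IsMaximalCone.inCell_self (h : Δ.HasConvexFullDimensionalSupport) {σ : Δ.cones}
    (hσ : Δ.IsMaximalCone σ) {v : N} (hv : Δ.IsGeneric v) : InCell v σ.1 σ.1 := by
  obtain ⟨ρ, -, hle, hx⟩ := exists_inCell h hv σ
  have : ρ = σ := le_antisymm (hσ hle) hle
  subst this
  exact ⟨le_rfl, hx⟩

end Fan

end Toric

/-! ### Charts, orbits and the torus action. -/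

noncomputable section

namespace Toric

namespace Fan

variable {N : Type u} [AddCommGroup N] (Δ : Fan N) (k : Type u) [Field k]

/-- The character `χ^u`, as a function on `U_σ`. -/
abbrev chi {σ : PointedCone ℝ (RealSpace N)} (u : dualMonoid σ) : ChartRing k σ :=
  AddMonoidAlgebra.single u 1

/-- The inclusion of `U_τ` in `U_σ`, for `τ ⊆ σ`. -/
def chartIncl {τ σ : Δ.cones} (h : τ ≤ σ) :
    Spec (.of (ChartRing k τ.1)) ⟶ Spec (.of (ChartRing k σ.1)) :=
  Spec.map (CommRingCat.ofHom (chartMap k h).toRingHom)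

lemma chartIncl_chartι {τ σ : Δ.cones} (h : τ ≤ σ) :
    Δ.chartIncl k h ≫ Δ.chartι k σ = Δ.chartι k τ :=
  colimit.w (Δ.diagram k) (homOfLE h)

lemma chartι_chartIncl_apply {τ σ : Δ.cones} (h : τ ≤ σ) (y : Spec (.of (ChartRing k τ.1))) :
    Δ.chartι k σ (Δ.chartIncl k h y) = Δ.chartι k τ y := by
  rw [← Δ.chartIncl_chartι k h, Scheme.Hom.comp_apply]

lemma exists_mem_chart (p : Δ.variety k) : ∃ σ, p ∈ Δ.chart k σ := by
  obtain ⟨σ, y, hy⟩ := Scheme.IsLocallyDirected.ι_jointly_surjective (Δ.diagram k) p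
  exact ⟨σ, y, hy⟩

lemma chart_mono {τ σ : Δ.cones} (h : τ ≤ σ) : Δ.chart k τ ≤ Δ.chart k σ := by
  rintro _ ⟨y, rfl⟩
  exact ⟨Δ.chartIncl k h y, Δ.chartι_chartIncl_apply k h y⟩

lemma chart_inf (σ τ : Δ.cones) :
    Δ.chart k σ ⊓ Δ.chart k τ = Δ.chart k ⟨σ.1 ⊓ τ.1, Δ.inf_mem σ.2 τ.2⟩ := by
  apply le_antisymm
  · rintro p ⟨⟨y, rfl⟩, z, hz⟩
    obtain ⟨ρ, fi, fj, x, rfl, -⟩ := (Scheme.IsLocallyDirected.ι_eq_ι_iff (Δ.diagram k)).1 hz.symm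
    exact Δ.chart_mono k (τ := ρ) (le_inf (c := ρ.1) (leOfHom fi) (leOfHom fj))
      ⟨x, (Δ.chartι_chartIncl_apply k (leOfHom fi) x).symm⟩
  · exact le_inf (Δ.chart_mono k (show (⟨σ.1 ⊓ τ.1, Δ.inf_mem σ.2 τ.2⟩ : Δ.cones) ≤ σ from
      (inf_le_left : σ.1 ⊓ τ.1 ≤ σ.1))) (Δ.chart_mono k
      (show (⟨σ.1 ⊓ τ.1, Δ.inf_mem σ.2 τ.2⟩ : Δ.cones) ≤ τ from
      (inf_le_right : σ.1 ⊓ τ.1 ≤ τ.1)))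

/-- The cone of the orbit of a point: the smallest cone whose chart contains the point. -/
lemma exists_orbitCone (p : Δ.variety k) :
    ∃ τ, p ∈ Δ.chart k τ ∧ ∀ σ, p ∈ Δ.chart k σ → τ ≤ σ := by
  have := Δ.finite.to_subtype
  obtain ⟨σ, hσ⟩ := Δ.exists_mem_chart k p
  obtain ⟨τ, -, hτ⟩ := (Set.toFinite {σ : Δ.cones | p ∈ Δ.chart k σ}).exists_le_minimal hσ
  refine ⟨τ, hτ.1, fun ρ hρ ↦ ?_⟩
  have h1 : p ∈ Δ.chart k ⟨τ.1 ⊓ ρ.1, Δ.inf_mem τ.2 ρ.2⟩ := by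
    rw [← chart_inf]; exact ⟨hτ.1, hρ⟩
  exact (hτ.2 h1 (inf_le_left : τ.1 ⊓ ρ.1 ≤ τ.1)).trans (inf_le_right : τ.1 ⊓ ρ.1 ≤ ρ.1)

lemma chartι_injective (σ : Δ.cones) : Function.Injective (Δ.chartι k σ) :=
  (Δ.chartι k σ).isOpenEmbedding.injective

/-- Inside `U_σ`, the chart of the face cut out by `u` is the principal open subset where `χ^u` does
not vanish. -/
lemma chartι_mem_chart_iff {τ σ : Δ.cones} (h : τ ≤ σ) {u : DualLattice N}
    (hu : u ∈ dualMonoid σ.1) (hτ : ∀ x, x ∈ τ.1 ↔ x ∈ σ.1 ∧ pairing u x = 0)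
    (y : Spec (.of (ChartRing k σ.1))) :
    Δ.chartι k σ y ∈ Δ.chart k τ ↔ chi k (⟨u, hu⟩ : dualMonoid σ.1) ∉ y.asIdeal := by
  have hr := Δ.range_diagram_map k (homOfLE h) hu hτ
  have : chi k (⟨u, hu⟩ : dualMonoid σ.1) ∉ y.asIdeal ↔
      y ∈ Set.range (Δ.chartIncl k h) := by
    rw [show Set.range (Δ.chartIncl k h) = _ from hr]; rfl
  rw [this]
  constructor
  · rintro ⟨z, hz⟩
    refine ⟨z, Δ.chartι_injective k σ ?_⟩
    rw [← hz, chartι_chartIncl_apply]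
  · rintro ⟨z, rfl⟩
    exact ⟨z, (Δ.chartι_chartIncl_apply k h z).symm⟩

/-- A character that is trivial on τ has an inverse among the functions on `U_τ`. -/
lemma chi_notMem_of_mem_chart {τ σ : Δ.cones} (h : τ ≤ σ) (u : dualMonoid σ.1)
    (hτ : ∀ x ∈ τ.1, pairing u.1 x = 0) (y : Spec (.of (ChartRing k σ.1)))
    (hy : Δ.chartι k σ y ∈ Δ.chart k τ) : chi k u ∉ y.asIdeal := by
  obtain ⟨z, hz⟩ := hy
  have hyz : Δ.chartIncl k h z = y := by
    apply Δ.chartι_injective k σ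
    rw [← hz, chartι_chartIncl_apply]
  subst hyz
  change chartMap k h (chi k u) ∉ z.asIdeal
  rw [chartMap_single]
  have hneg : -u.1 ∈ dualMonoid τ.1 := fun x hx ↦ by simp [hτ x hx]
  refine fun hmem ↦ z.2.ne_top (Ideal.eq_top_of_isUnit_mem _ hmem
    (IsUnit.of_mul_eq_one (chi k ⟨-u.1, hneg⟩) ?_))
  rw [AddMonoidAlgebra.single_mul_single, AddMonoidAlgebra.one_def, mul_one]
  congr 1
  ext1
  simp

section Torus

lemma chartAction_comp (s t : TorusPoint N k) (σ : PointedCone ℝ (RealSpace N)) :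
    (chartAction k s σ).comp (chartAction k t σ) = chartAction k (s * t) σ := by
  ext u
  simp [chartAction, mul_comm]

lemma chartAction_one (σ : PointedCone ℝ (RealSpace N)) :
    chartAction k 1 σ = AlgHom.id k _ := by
  ext u
  simp [chartAction]

lemma torusAction_comp_of_mul_eq_one {s t : TorusPoint N k} (h : s * t = 1) :
    Δ.torusAction k s ≫ Δ.torusAction k t = 𝟙 _ := by
  refine colimit.hom_ext fun σ ↦ ?_
  change Δ.chartι k σ ≫ _ = Δ.chartι k σ ≫ _
  rw [← Category.assoc, chartι_torusAction, Category.assoc, chartι_torusAction, ← Category.assoc,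
    ← Spec.map_comp, ← CommRingCat.ofHom_comp]
  have : (chartAction k s σ.1).toRingHom.comp (chartAction k t σ.1).toRingHom =
      RingHom.id _ := by
    have := chartAction_comp k s t σ.1
    rw [h, chartAction_one] at this
    exact congrArg AlgHom.toRingHom this
  rw [this, CommRingCat.ofHom_id, Spec.map_id, Category.id_comp, Category.comp_id]

lemma torusAction_mem_chart (t : TorusPoint N k) {σ : Δ.cones} {p : Δ.variety k}
    (hp : p ∈ Δ.chart k σ) : Δ.torusAction k t p ∈ Δ.chart k σ := by
  obtain ⟨y, rfl⟩ := hp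
  rw [← Scheme.Hom.comp_apply, chartι_torusAction, Scheme.Hom.comp_apply]
  exact ⟨_, rfl⟩

lemma isTorusInvariant_chart (σ : Δ.cones) : Δ.IsTorusInvariant (Δ.chart k σ) := by
  intro t
  refine le_antisymm (fun p hp ↦ ?_) fun p hp ↦ Δ.torusAction_mem_chart k t hp
  have h1 := Δ.torusAction_mem_chart k t⁻¹ (p := Δ.torusAction k t p) hp
  have h2 := Δ.torusAction_comp_of_mul_eq_one k (s := t) (t := t⁻¹) (by ext; simp)
  rwa [← Scheme.Hom.comp_apply, h2] at h1

lemma IsTorusInvariant.iSup {ι : Sort*} {U : ι → (Δ.variety k).Opens}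
    (h : ∀ i, Δ.IsTorusInvariant (U i)) : Δ.IsTorusInvariant (⨆ i, U i) := by
  intro t
  rw [Scheme.Hom.preimage_iSup]
  exact iSup_congr fun i ↦ h i t

end Torus

end Fan

end Toric

end

/-! ### Laurent polynomials: factoriality, primitive vectors, lowest terms. -/

noncomputable section

namespace Toric

section Laurent

variable (k : Type*) [Field k]

/-- The Laurent polynomial ring is a unique factorization domain. -/
lemma uniqueFactorizationMonoid_finsupp (ι : Type*) [Finite ι] :
    UniqueFactorizationMonoid (AddMonoidAlgebra k (ι →₀ ℤ)) := by
  have := Fintype.ofFinite ι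
  let c : (ι →₀ ℕ) →+ (ι →₀ ℤ) := Finsupp.mapRange.addMonoidHom (Nat.castAddMonoidHom ℤ)
  have hc : ∀ a i, c a i = a i := fun a i ↦ by simp [c]
  have hcinj : Function.Injective c := fun a b h ↦ by
    ext i
    have := DFunLike.congr_fun h i
    rw [hc, hc] at this
    exact_mod_cast this
  let φ := AddMonoidAlgebra.mapDomainRingHom k c
  let := φ.toAlgebra
  -- The exponent of the product of all variables: inverting this one monomial turns polynomials
  -- into Laurent polynomials.
  let e : ι →₀ ℕ := Finsupp.equivFunOnFinite.symm fun _ ↦ 1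
  have hφ : ∀ x, algebraMap (AddMonoidAlgebra k (ι →₀ ℕ)) (AddMonoidAlgebra k (ι →₀ ℤ)) x = φ x :=
    fun _ ↦ rfl
  have hφs : ∀ a (r : k), φ (.single a r) = .single (c a) r := fun a r ↦ by simp [φ]
  have hpow : ∀ q : ℕ, (AddMonoidAlgebra.single e (1 : k)) ^ q =
      AddMonoidAlgebra.single (q • e) 1 := fun q ↦ by
    rw [AddMonoidAlgebra.single_pow, one_pow]
  have : IsLocalization.Away (AddMonoidAlgebra.single e (1 : k))
      (AddMonoidAlgebra k (ι →₀ ℤ)) := by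
    refine IsLocalization.Away.mk _ ?_ ?_ ?_
    · rw [hφ, hφs]
      refine IsUnit.of_mul_eq_one (AddMonoidAlgebra.single (-c e) 1) ?_
      rw [AddMonoidAlgebra.single_mul_single, AddMonoidAlgebra.one_def, mul_one, add_neg_cancel]
    · intro f
      suffices H : ∃ p : ℕ, ∀ q, p ≤ q → ∃ a, f * φ (.single e (1 : k)) ^ q = φ a by
        obtain ⟨p, hp⟩ := H
        obtain ⟨a, ha⟩ := hp p le_rfl
        exact ⟨p, a, ha⟩
      induction f using AddMonoidAlgebra.induction_linear with
      | zero => exact ⟨0, fun q _ ↦ ⟨0, by simp⟩⟩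
      | add f g hf hg =>
        obtain ⟨p, hp⟩ := hf
        obtain ⟨p', hp'⟩ := hg
        refine ⟨max p p', fun q hq ↦ ?_⟩
        obtain ⟨a, ha⟩ := hp q (le_trans (le_max_left _ _) hq)
        obtain ⟨b, hb⟩ := hp' q (le_trans (le_max_right _ _) hq)
        exact ⟨a + b, by rw [add_mul, ha, hb, map_add]⟩
      | single w r =>
        refine ⟨∑ i, (w i).natAbs, fun q hq ↦
          ⟨.single (Finsupp.equivFunOnFinite.symm fun i ↦ (w i + q).toNat) r, ?_⟩⟩
        rw [← map_pow, hpow, hφs, hφs, AddMonoidAlgebra.single_mul_single, mul_one]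
        congr 1
        ext i
        have h1 : (w i).natAbs ≤ q := le_trans (Finset.single_le_sum (f := fun i ↦ (w i).natAbs)
          (fun _ _ ↦ Nat.zero_le _) (Finset.mem_univ i)) hq
        rw [Finsupp.add_apply, hc, hc]
        simp only [e, Finsupp.smul_apply, Finsupp.equivFunOnFinite_symm_apply_apply, smul_eq_mul,
          mul_one]
        omega
    · intro a b hab
      exact ⟨0, by rw [AddMonoidAlgebra.mapDomain_injective hcinj hab]⟩
  have : UniqueFactorizationMonoid (AddMonoidAlgebra k (ι →₀ ℕ)) :=
    inferInstanceAs (UniqueFactorizationMonoid (MvPolynomial ι k))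
  exact UniqueFactorizationMonoid.of_isLocalization
    (Submonoid.powers (AddMonoidAlgebra.single e (1 : k))) _

variable (M : Type*) [AddCommGroup M] [Module.Free ℤ M]

instance uniqueSums_of_free : UniqueSums M :=
  UniqueSums.of_injective_addHom (Module.Free.chooseBasis ℤ M).repr.toAddEquiv.toAddHom
    (Module.Free.chooseBasis ℤ M).repr.injective inferInstance

instance [Module.Finite ℤ M] : UniqueFactorizationMonoid (AddMonoidAlgebra k M) :=
  have := uniqueFactorizationMonoid_finsupp k (Module.Free.ChooseBasisIndex ℤ M)
  (AddMonoidAlgebra.mapDomainRingEquiv k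
    (Module.Free.chooseBasis ℤ M).repr.toAddEquiv).symm.toMulEquiv.uniqueFactorizationMonoid this

instance : IsDomain (AddMonoidAlgebra k M) := NoZeroDivisors.to_isDomain _

end Laurent

/-- Every nonzero vector of fractions over a unique factorization domain is proportional to
a primitive one. -/
lemma exists_primitive {T : Type*} [CommRing T] [IsDomain T] [UniqueFactorizationMonoid T]
    (K : Type*) [Field K] [Algebra T K] [IsFractionRing T K] {n : ℕ} (r : Fin n → K)
    (hr : ∃ j, r j ≠ 0) : ∃ (f : Fin n → T) (d : K), d ≠ 0 ∧
      (∀ l, r l = d * algebraMap T K (f l)) ∧ ∀ j b, (∀ l, f j ∣ b * f l) → f j ∣ b := by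
  classical
  obtain ⟨D, hD⟩ := IsLocalization.exist_integer_multiples_of_finite (nonZeroDivisors T) r
  choose z hz using hD
  have : Nonempty (NormalizedGCDMonoid T) := inferInstance
  let := this.some
  have hD0 : algebraMap T K D ≠ 0 := by
    simp
  have hz' : ∀ l, algebraMap T K (z l) = algebraMap T K D * r l := fun l ↦ by
    rw [hz l, Algebra.smul_def]
  obtain ⟨j₀, hj₀⟩ := hr
  obtain ⟨g, hg, hg1⟩ := Finset.extract_gcd z (s := Finset.univ) ⟨j₀, Finset.mem_univ _⟩
  have h0 : Finset.univ.gcd z ≠ 0 := fun h ↦ by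
    have h1 := hz' j₀
    rw [hg j₀ (Finset.mem_univ _), h, zero_mul, map_zero] at h1
    exact (mul_ne_zero hD0 hj₀) h1.symm
  refine ⟨g, algebraMap T K (Finset.univ.gcd z) / algebraMap T K D,
    div_ne_zero (by simpa using h0) hD0, fun l ↦ ?_, fun j b h ↦ ?_⟩
  · rw [div_mul_eq_mul_div, ← map_mul, ← hg l (Finset.mem_univ _), hz', mul_div_cancel_left₀ _ hD0]
  -- The gcd of the `b * g l` is `b` up to a unit, because the `g l` have gcd 1.
  · have := Finset.dvd_gcd (s := Finset.univ) (f := fun l ↦ b * g l) fun l _ ↦ h l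
    rwa [(Finset.gcd_mul_left' _ _ _).dvd_iff_dvd_right, hg1, mul_one] at this

section Vertex

variable {k : Type*} [Field k]

/-- Products of lowest terms, with respect to an additive function on the exponents, do not
cancel. -/
lemma exists_lowest_mem_support_mul {A : Type*} [AddCommMonoid A] [UniqueSums A] (D : A →+ ℝ)
    {f g : AddMonoidAlgebra k A} (hf : f ≠ 0) (hg : g ≠ 0) :
    ∃ a ∈ f.coeff.support, ∃ b ∈ g.coeff.support, (∀ a' ∈ f.coeff.support, D a ≤ D a') ∧
      (∀ b' ∈ g.coeff.support, D b ≤ D b') ∧ a + b ∈ (f * g).coeff.support := by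
  classical
  have hf' : f.coeff.support.Nonempty := by simpa using hf
  have hg' : g.coeff.support.Nonempty := by simpa using hg
  obtain ⟨a₁, ha₁, hmin₁⟩ := f.coeff.support.exists_min_image D hf'
  obtain ⟨b₁, hb₁, hmin₂⟩ := g.coeff.support.exists_min_image D hg'
  -- Choose a pair with a unique sum within the two lowest levels of `D`. Any pair in the full
  -- supports with the same sum must also lie in these levels, so uniqueness persists.
  obtain ⟨a, ha, b, hb, hab⟩ := UniqueSums.uniqueAdd_of_nonempty
    (A := f.coeff.support.filter (D · = D a₁)) (B := g.coeff.support.filter (D · = D b₁))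
    ⟨a₁, by simpa using ha₁⟩ ⟨b₁, by simpa using hb₁⟩
  rw [Finset.mem_filter] at ha hb
  refine ⟨a, ha.1, b, hb.1, fun a' h ↦ ha.2 ▸ hmin₁ a' h, fun b' h ↦ hb.2 ▸ hmin₂ b' h, ?_⟩
  have huniq : UniqueAdd f.coeff.support g.coeff.support a b := by
    intro a' b' ha' hb' h
    have h1 := congrArg D h
    rw [map_add, map_add, ha.2, hb.2] at h1
    have h2 := hmin₁ a' ha'
    have h3 := hmin₂ b' hb'
    exact hab (Finset.mem_filter.2 ⟨ha', by linarith⟩) (Finset.mem_filter.2 ⟨hb', by linarith⟩) h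
  rw [Finsupp.mem_support_iff, AddMonoidAlgebra.coeff_mul_add_of_uniqueAdd huniq]
  exact mul_ne_zero (Finsupp.mem_support_iff.1 ha.1) (Finsupp.mem_support_iff.1 hb.1)

variable {M : Type*} [AddCommGroup M]

/-- The inclusion of the algebra of a submonoid. -/
def submonoidIncl (k : Type*) [Field k] (S : AddSubmonoid M) :
    AddMonoidAlgebra k S →ₐ[k] AddMonoidAlgebra k M :=
  AddMonoidAlgebra.mapDomainAlgHom k k S.subtype

lemma submonoidIncl_injective (S : AddSubmonoid M) : Function.Injective (submonoidIncl k S) :=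
  AddMonoidAlgebra.mapDomain_injective Subtype.val_injective

lemma coeff_submonoidIncl (S : AddSubmonoid M) (f : AddMonoidAlgebra k S) (s : S) :
    (submonoidIncl k S f).coeff s = f.coeff s :=
  Finsupp.mapDomain_apply Subtype.val_injective _ _

lemma mem_of_mem_support_submonoidIncl {S : AddSubmonoid M} {f : AddMonoidAlgebra k S} {m : M}
    (h : m ∈ (submonoidIncl k S f).coeff.support) : m ∈ S := by
  classical
  obtain ⟨s, -, rfl⟩ := Finset.mem_image.1 (Finsupp.mapDomain_support h)
  exact s.2

lemma exists_of_mem_support_mul {f g : AddMonoidAlgebra k M} {m : M}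
    (h : m ∈ (f * g).coeff.support) :
    ∃ a ∈ f.coeff.support, ∃ b ∈ g.coeff.support, a + b = m := by
  classical
  exact Finset.mem_add.1 (AddMonoidAlgebra.support_coeff_mul_subset f g h)

/-- The lowest coefficient of a product, when one factor is supported in a pointed monoid `S` and
the other one in `m + S`. -/
lemma coeff_submonoidIncl_mul {S : AddSubmonoid M} (hS : ∀ a ∈ S, ∀ b ∈ S, a + b = 0 → a = 0)
    (b : AddMonoidAlgebra k S) {f : AddMonoidAlgebra k M} {m : M}
    (hf : ∀ w ∈ f.coeff.support, w - m ∈ S) :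
    (submonoidIncl k S b * f).coeff m = b.coeff 0 * f.coeff m := by
  have := AddMonoidAlgebra.coeff_mul_add_of_uniqueAdd (f := submonoidIncl k S b) (g := f)
    (a0 := 0) (b0 := m) (fun a w ha hw h ↦ by
      have h1 := mem_of_mem_support_submonoidIncl ha
      have h0 : a = 0 := hS a h1 _ (hf w hw) (by rw [← add_sub_assoc, h, zero_add, sub_self])
      subst h0
      exact ⟨rfl, by simpa using h⟩)
  rw [zero_add] at this
  rw [this]
  congr 1
  exact coeff_submonoidIncl S b 0

/-- Let `(f_l)` be a primitive vector of Laurent polynomials which is proportional to a vector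
of elements of `k[S]`, one of which has a nonzero constant term. Then there is an exponent `m`
such that all the `f_l` are supported in `m + S`, and the `m`-th coefficients of the `f_l` are
proportional to the constant terms. -/
lemma exists_vertex [UniqueSums M] {n : ℕ} {f : Fin n → AddMonoidAlgebra k M}
    (hprim : ∀ j b, (∀ l, f j ∣ b * f l) → f j ∣ b)
    {S : AddSubmonoid M} (hS : ∀ a ∈ S, ∀ b ∈ S, a + b = 0 → a = 0)
    {ι : Type*} (x : ι → M →+ ℝ) (hx : ∀ m, m ∈ S ↔ ∀ i, 0 ≤ x i m)
    (j : Fin n) {a : Fin n → AddMonoidAlgebra k S} {b : AddMonoidAlgebra k S} (hb : b.coeff 0 ≠ 0)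
    (h : ∀ l, submonoidIncl k S b * f l = submonoidIncl k S (a l) * f j) :
    ∃ m : M, (∀ l, ∀ w ∈ (f l).coeff.support, w - m ∈ S) ∧ (f j).coeff m ≠ 0 ∧
      ∀ l, b.coeff 0 * (f l).coeff m = (a l).coeff 0 * (f j).coeff m := by
  classical
  -- The relations say that `f j` divides every `b * f l`, so by primitivity it divides `b`. The
  -- constant term of `b` then arises from an exponent `m` of `f j` and an exponent `s` of the
  -- cofactor with `m + s = 0`.
  obtain ⟨g, hg⟩ := hprim j (submonoidIncl k S b) fun l ↦ ⟨_, (h l).trans (mul_comm _ _)⟩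
  have hb0 : (0 : M) ∈ (submonoidIncl k S b).coeff.support :=
    Finsupp.mem_support_iff.2 (by rw [← ZeroMemClass.coe_zero S, coeff_submonoidIncl]; exact hb)
  have hbne : submonoidIncl k S b ≠ 0 := fun h0 ↦ by simp [h0] at hb0
  obtain ⟨m, hm, s, hs, hms⟩ := exists_of_mem_support_mul (hg ▸ hb0)
  have hfj : f j ≠ 0 := fun h0 ↦ by simp [h0] at hm
  have hgne : g ≠ 0 := fun h0 ↦ by simp [h0] at hs
  -- The lowest exponents of `f j` and `g` add up to an exponent of `b`, where `x i` is at least 0 =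
  -- `x i (m + s)`. So `x i` attains its minimum on the support of `f j` at `m`.
  have hj : ∀ w ∈ (f j).coeff.support, ∀ i, x i m ≤ x i w := by
    intro w hw i
    obtain ⟨w₀, hw₀, s₀, hs₀, h1, h2, h3⟩ := exists_lowest_mem_support_mul (x i) hfj hgne
    rw [← hg] at h3
    have h4 := (hx _).1 (mem_of_mem_support_submonoidIncl h3) i
    rw [map_add] at h4
    have h5 := congrArg (x i) hms
    rw [map_add, map_zero] at h5
    have := h1 w hw
    have := h2 s hs
    linarith
  -- Compare lowest terms in `b * f l = a l * f j`: the minimum of `x i` on `b` is at most 0,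
  -- because of the constant term, and on the right-hand side `x i` is at least `x i m`.
  have hall : ∀ l, ∀ w ∈ (f l).coeff.support, w - m ∈ S := by
    intro l w hw
    refine (hx _).2 fun i ↦ ?_
    have hfl : f l ≠ 0 := fun h0 ↦ by simp [h0] at hw
    obtain ⟨b₀, hb₀, w₀, hw₀, h1, h2, h3⟩ := exists_lowest_mem_support_mul (x i) hbne hfl
    rw [h l] at h3
    obtain ⟨s', hs', w', hw', h4⟩ := exists_of_mem_support_mul h3
    have h5 := (hx _).1 (mem_of_mem_support_submonoidIncl hs') i
    have h6 := hj w' hw' i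
    have h7 := congrArg (x i) h4
    have h8 := h1 0 hb0
    have h9 := h2 w hw
    rw [map_add, map_add] at h7
    rw [map_zero] at h8
    rw [map_sub]
    linarith
  refine ⟨m, hall, Finsupp.mem_support_iff.1 hm, fun l ↦ ?_⟩
  rw [← coeff_submonoidIncl_mul hS b (hall l), h l, coeff_submonoidIncl_mul hS _ (hall j)]

end Vertex

end Toric

end

/-! ### Coordinates on the standard charts of projective space. -/

noncomputable section

namespace Toric

open MvPolynomial HomogeneousLocalization

section ProjectiveSpace

attribute [local instance] MvPolynomial.gradedAlgebra

variable {n : ℕ} {k : Type u} [Field k]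

/-- The coordinate ring of the `j`-th standard chart of `ℙⁿ`. -/
abbrev ProjAway (k : Type u) [Field k] {n : ℕ} (j : Fin (n + 1)) : Type u :=
  Away (homogeneousSubmodule (Fin (n + 1)) k) (X j : MvPolynomial (Fin (n + 1)) k)

lemma X_mem_homogeneousSubmodule (j : Fin (n + 1)) :
    (X j : MvPolynomial (Fin (n + 1)) k) ∈ homogeneousSubmodule (Fin (n + 1)) k 1 :=
  isHomogeneous_X k j

lemma X_mem_homogeneousSubmodule_smul (j : Fin (n + 1)) :
    (X j : MvPolynomial (Fin (n + 1)) k) ∈ homogeneousSubmodule (Fin (n + 1)) k (1 • 1) :=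
  isHomogeneous_X k j

/-- The coordinate function `X_l / X_j` on the `j`-th standard chart of `ℙⁿ`. -/
def projCoord (k : Type u) [Field k] {n : ℕ} (j l : Fin (n + 1)) : ProjAway k j :=
  Away.mk _ (X_mem_homogeneousSubmodule j) 1 (X l)
    (X_mem_homogeneousSubmodule_smul l)

/-- The constants in the coordinate ring of the `j`-th standard chart of `ℙⁿ`. -/
def projConst (k : Type u) [Field k] {n : ℕ} (j : Fin (n + 1)) : k →+* ProjAway k j :=
  (fromZeroRingHom (homogeneousSubmodule (Fin (n + 1)) k) _).comp
    (algebraMap k (homogeneousSubmodule (Fin (n + 1)) k 0))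

/-- The inclusion of the `j`-th standard chart of `ℙⁿ`. -/
def projChart (k : Type u) [Field k] {n : ℕ} (j : Fin (n + 1)) :
    Spec (.of (ProjAway k j)) ⟶ projectiveSpace n k :=
  Proj.awayι _ (X j) (X_mem_homogeneousSubmodule j) one_pos

instance (j : Fin (n + 1)) : IsOpenImmersion (projChart k j) :=
  inferInstanceAs (IsOpenImmersion (Proj.awayι _ _ _ _))

lemma projChart_structure (j : Fin (n + 1)) :
    projChart k j ≫ projectiveSpaceStructure n k =
      Spec.map (CommRingCat.ofHom (projConst k j)) := by
  rw [projChart, projectiveSpaceStructure]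
  erw [Proj.awayι_toSpecZero_assoc]
  rw [← Spec.map_comp]
  rfl

lemma opensRange_projChart (j : Fin (n + 1)) : (projChart k j).opensRange =
    Proj.basicOpen (homogeneousSubmodule (Fin (n + 1)) k) (X j) :=
  Proj.opensRange_awayι _ _ _ _

lemma exists_mem_range_projChart (p : projectiveSpace n k) :
    ∃ j, p ∈ (projChart k j).opensRange := by
  by_contra! h
  have h' : ∀ j, (X j : MvPolynomial (Fin (n + 1)) k) ∈ p.asHomogeneousIdeal := fun j ↦ by
    by_contra hj
    refine h j ?_
    rw [opensRange_projChart]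
    exact hj
  refine p.not_irrelevant_le ((HomogeneousIdeal.irrelevant_le _).2 fun i hi f hf ↦ ?_)
  have hspan : f ∈ Ideal.span (X '' (Set.univ : Set (Fin (n + 1)))) := by
    refine mem_ideal_span_X_image.2 fun m hm ↦ ?_
    by_contra! hc
    have hm0 : m = 0 := Finsupp.ext fun l ↦ hc l trivial
    have : f.IsHomogeneous i := hf
    exact (mem_support_iff.1 hm) (this.coeff_eq_zero (by simpa [hm0] using hi.ne))
  refine (Ideal.span_le.2 ?_ : _ ≤ p.asHomogeneousIdeal.toIdeal) hspan
  rintro _ ⟨j, -, rfl⟩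
  exact h' j

/-- The only open neighbourhood of the closed point of a local scheme is the whole scheme. -/
lemma exists_lift_projChart {R : Type u} [CommRing R] [IsLocalRing R]
    (g : Spec (.of R) ⟶ projectiveSpace n k) (j : Fin (n + 1))
    (hj : g (IsLocalRing.closedPoint R) ∈ (projChart k j).opensRange) :
    ∃ φ : ProjAway k j →+* R, Spec.map (CommRingCat.ofHom φ) ≫ projChart k j = g := by
  have htop : g ⁻¹ᵁ (projChart k j).opensRange = ⊤ := IsLocalRing.closed_point_mem_iff.1 hj
  have hrange : Set.range g ⊆ Set.range (projChart k j) := by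
    rintro _ ⟨x, rfl⟩
    have : x ∈ g ⁻¹ᵁ (projChart k j).opensRange := by rw [htop]; trivial
    exact this
  refine ⟨(Spec.preimage (IsOpenImmersion.lift (projChart k j) g hrange)).hom, ?_⟩
  rw [CommRingCat.ofHom_hom, Spec.map_preimage, IsOpenImmersion.lift_fac]

/-- The transition relations between the coordinates on the standard charts of `ℙⁿ`. -/
lemma projCoord_mul {R : Type u} [CommRing R] {j j' : Fin (n + 1)} {φ : ProjAway k j →+* R}
    {φ' : ProjAway k j' →+* R} (h : Spec.map (CommRingCat.ofHom φ) ≫ projChart k j =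
      Spec.map (CommRingCat.ofHom φ') ≫ projChart k j') (l : Fin (n + 1)) :
    φ (projCoord k j l) * φ' (projCoord k j' j) = φ' (projCoord k j' l) := by
  have h' : Spec.map (CommRingCat.ofHom φ) ≫
      Proj.awayι _ (X j) (X_mem_homogeneousSubmodule (k := k) j) one_pos =
      Spec.map (CommRingCat.ofHom φ') ≫
      Proj.awayι _ (X j') (X_mem_homogeneousSubmodule (k := k) j') one_pos := h
  -- The two maps factor through the overlap of the charts, an affine scheme on whose coordinate
  -- ring the relation can be checked.
  let s := pullback.lift _ _ h'
  let iso := Proj.pullbackAwayιIso (homogeneousSubmodule (Fin (n + 1)) k)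
    (X_mem_homogeneousSubmodule (k := k) j) one_pos (X_mem_homogeneousSubmodule j') one_pos rfl
  let ψ := (Spec.preimage (s ≫ iso.hom)).hom
  have h1 : φ = ψ.comp (awayMap _ (X_mem_homogeneousSubmodule (k := k) j') rfl) := by
    have : Spec.map (CommRingCat.ofHom φ) = Spec.map (CommRingCat.ofHom ψ) ≫
        Spec.map (CommRingCat.ofHom (awayMap _ (X_mem_homogeneousSubmodule (k := k) j') rfl)) := by
      rw [CommRingCat.ofHom_hom, Spec.map_preimage, Category.assoc]
      rw [Proj.pullbackAwayιIso_hom_SpecMap_awayMap_left]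
      exact (pullback.lift_fst _ _ h').symm
    rw [← Spec.map_comp] at this
    exact congrArg CommRingCat.Hom.hom (Spec.map_injective this)
  have h2 : φ' = ψ.comp (awayMap _ (X_mem_homogeneousSubmodule (k := k) j) (mul_comm _ _)) := by
    have : Spec.map (CommRingCat.ofHom φ') = Spec.map (CommRingCat.ofHom ψ) ≫
        Spec.map (CommRingCat.ofHom
          (awayMap _ (X_mem_homogeneousSubmodule (k := k) j) (mul_comm _ _))) := by
      rw [CommRingCat.ofHom_hom, Spec.map_preimage, Category.assoc]
      rw [Proj.pullbackAwayιIso_hom_SpecMap_awayMap_right]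
      exact (pullback.lift_snd _ _ h').symm
    rw [← Spec.map_comp] at this
    exact congrArg CommRingCat.Hom.hom (Spec.map_injective this)
  rw [h1, h2]
  simp only [RingHom.comp_apply, ← map_mul]
  congr 1
  ext
  simp only [projCoord, awayMap_mk, val_mul, Away.val_mk, Localization.mk_mul]
  rw [Localization.mk_eq_mk_iff, Localization.r_iff_exists]
  refine ⟨1, ?_⟩
  simp
  ring

lemma eval₂_mul_of_isHomogeneous {σ R S : Type*} [Fintype σ] [CommSemiring R] [CommSemiring S]
    (f : R →+* S) (g : σ → S) (c : S) {G : MvPolynomial σ R} {d : ℕ} (hG : G.IsHomogeneous d) :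
    eval₂ f (fun i ↦ g i * c) G = eval₂ f g G * c ^ d := by
  rw [eval₂_eq', eval₂_eq', Finset.sum_mul]
  refine Finset.sum_congr rfl fun e he ↦ ?_
  have : ∑ i, e i = d := by
    rw [← Finsupp.degree_eq_sum]
    by_contra hne
    exact (mem_support_iff.1 he) (hG.coeff_eq_zero hne)
  simp_rw [mul_pow, Finset.prod_mul_distrib, Finset.prod_pow_eq_pow_sum, this, mul_assoc]

/-- Dehomogenization. It shows that constants and coordinates generate the ring of the chart. -/
lemma Away_mk_eq_eval₂ (j : Fin (n + 1)) (d : ℕ) (G : MvPolynomial (Fin (n + 1)) k)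
    (hG : G ∈ homogeneousSubmodule (Fin (n + 1)) k (d • 1)) :
    (Away.mk _ (X_mem_homogeneousSubmodule j) d G hG : ProjAway k j) =
      eval₂ (projConst k j) (projCoord k j) G := by
  have hG' : G.IsHomogeneous d := by simpa using hG
  apply val_injective
  let ι := algebraMap (ProjAway k j) (Localization.Away (X j : MvPolynomial (Fin (n + 1)) k))
  change _ = ι _
  let a := algebraMap (MvPolynomial (Fin (n + 1)) k)
    (Localization.Away (X j : MvPolynomial (Fin (n + 1)) k))
  have h1 : ι.comp (projConst k j) = a.comp C := rfl
  let c : Localization.Away (X j : MvPolynomial (Fin (n + 1)) k) :=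
    Localization.mk 1 ⟨X j, Submonoid.mem_powers _⟩
  have h2 : ∀ l, ι (projCoord k j l) = a (X l) * c := fun l ↦ by
    simp only [ι, HomogeneousLocalization.algebraMap_apply, projCoord, Away.val_mk, a, c,
      ← Localization.mk_one_eq_algebraMap,
      Localization.mk_mul, mul_one, one_mul, pow_one]
  rw [hom_eval₂, h1, show (fun l ↦ ι (projCoord k j l)) = fun l ↦ a (X l) * c from funext h2,
    eval₂_mul_of_isHomogeneous _ _ _ hG']
  have h3 : eval₂ (a.comp C) (fun l ↦ a (X l)) G = a G := by
    have := hom_eval₂ G C a X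
    rw [eval₂_eta] at this
    exact this.symm
  rw [h3, Away.val_mk]
  simp only [a, c, ← Localization.mk_one_eq_algebraMap, Localization.mk_pow, Localization.mk_mul,
    one_pow, mul_one, one_mul]
  rfl

/-- Two morphisms from a chart of `ℙⁿ` agree if they agree on constants and on coordinates. -/
lemma ProjAway_hom_ext {R : Type*} [CommRing R] {j : Fin (n + 1)} {φ ψ : ProjAway k j →+* R}
    (h : φ.comp (projConst k j) = ψ.comp (projConst k j))
    (h' : ∀ l, φ (projCoord k j l) = ψ (projCoord k j l)) : φ = ψ := by
  ext x
  obtain ⟨d, G, hG, rfl⟩ := Away.mk_surjective _ (X_mem_homogeneousSubmodule j) x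
  rw [Away_mk_eq_eval₂, hom_eval₂, hom_eval₂, h]
  congr 1
  ext l
  exact h' l

lemma mem_range_projChart_of_ne_zero {F : Type u} [Field F] {j : Fin (n + 1)}
    (φ : ProjAway k j →+* F) {l : Fin (n + 1)} (hl : φ (projCoord k j l) ≠ 0) (p : Spec (.of F)) :
    (Spec.map (CommRingCat.ofHom φ) ≫ projChart k j) p ∈ (projChart k l).opensRange := by
  rw [opensRange_projChart, Scheme.Hom.comp_apply]
  change Spec.map (CommRingCat.ofHom φ) p ∈
    (Proj.awayι _ (X j) (X_mem_homogeneousSubmodule j) one_pos) ⁻¹ᵁ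
    Proj.basicOpen _ (X l : MvPolynomial (Fin (n + 1)) k)
  rw [Proj.awayι_preimage_basicOpen _ _ _ (X_mem_homogeneousSubmodule l) one_pos]
  change φ _ ∉ p.asIdeal
  intro hmem
  refine hl ?_
  have hbot : p.asIdeal = ⊥ := (Ideal.eq_bot_or_top _).resolve_right p.2.ne_top
  rw [hbot, Ideal.mem_bot] at hmem
  convert hmem using 2
  ext
  simp [projCoord]

end ProjectiveSpace

end Toric

end

/-! ### A strictly convex support function from a projective immersion. -/

noncomputable section

namespace Toric

section ConstCoeff

variable (k : Type*) [Field k] {M : Type*} [AddCommGroup M]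

open Classical in
/-- The augmentation `k[S] → k` of the algebra of a pointed monoid `S`, which kills all
the nontrivial characters. -/
def constCoeff {S : AddSubmonoid M} (hS : ∀ a ∈ S, ∀ b ∈ S, a + b = 0 → a = 0) :
    AddMonoidAlgebra k S →ₐ[k] k :=
  AddMonoidAlgebra.lift k k S
    { toFun := fun s ↦ if s.toAdd = 0 then 1 else 0
      map_one' := by simp
      map_mul' := fun a b ↦ by
        by_cases ha : a.toAdd = 0
        · simp [ha]
        · have : a.toAdd + b.toAdd ≠ 0 := fun h ↦ ha <| Subtype.ext <|
            hS _ a.toAdd.2 _ b.toAdd.2 (by exact_mod_cast congrArg Subtype.val h)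
          simp [ha, this] }

lemma constCoeff_apply {S : AddSubmonoid M} (hS : ∀ a ∈ S, ∀ b ∈ S, a + b = 0 → a = 0)
    (f : AddMonoidAlgebra k S) : constCoeff k hS f = f.coeff 0 := by
  classical
  induction f using AddMonoidAlgebra.induction_linear with
  | zero => simp
  | add f g hf hg => simp [hf, hg]
  | single s a =>
    simp [constCoeff, Finsupp.single_apply]

end ConstCoeff

namespace Fan

variable {N : Type u} [AddCommGroup N] {Δ : Fan N} {k : Type u} [Field k]

lemma pointed_of_span_eq_top {σ : PointedCone ℝ (RealSpace N)}
    (h : Submodule.span ℝ (σ : Set (RealSpace N)) = ⊤) :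
    ∀ a ∈ dualMonoid σ, ∀ b ∈ dualMonoid σ, a + b = 0 → a = 0 := by
  intro a ha b hb hab
  apply pairing_injective
  rw [pairing_zero]
  refine LinearMap.ext_on h fun x hx ↦ ?_
  have h1 := ha x hx
  have h2 := hb x hx
  rw [← neg_eq_of_add_eq_zero_right hab, pairing_neg, LinearMap.neg_apply] at h2
  simp only [LinearMap.zero_apply]
  linarith

/-- The distinguished point of the chart of a full-dimensional cone. -/
def distinguishedPoint (k : Type u) [Field k] {σ : PointedCone ℝ (RealSpace N)}
    (hS : ∀ a ∈ dualMonoid σ, ∀ b ∈ dualMonoid σ, a + b = 0 → a = 0) :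
    Spec (.of k) ⟶ Spec (.of (ChartRing k σ)) :=
  Spec.map (CommRingCat.ofHom (constCoeff k hS).toRingHom)

/-- Within `U_σ` the chart of σ ∩ σ' is the locus where some `χ^u` does not vanish. All nontrivial
characters vanish at the distinguished point, so `u = 0` and σ ⊆ σ'; maximality concludes. -/
lemma eq_of_distinguishedPoint_mem {σ σ' : Δ.cones} (hσ : Δ.IsMaximalCone σ)
    (hS : ∀ a ∈ dualMonoid σ.1, ∀ b ∈ dualMonoid σ.1, a + b = 0 → a = 0) (p : Spec (.of k))
    (h : Δ.chartι k σ (distinguishedPoint k hS p) ∈ Δ.chart k σ') : σ = σ' := by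
  let τ : Δ.cones := ⟨σ.1 ⊓ σ'.1, Δ.inf_mem σ.2 σ'.2⟩
  have hτσ : τ ≤ σ := (inf_le_left : σ.1 ⊓ σ'.1 ≤ σ.1)
  have hτ : Δ.chartι k σ (distinguishedPoint k hS p) ∈ Δ.chart k τ := by
    rw [← chart_inf]
    exact ⟨⟨_, rfl⟩, h⟩
  obtain ⟨u, hu, hface⟩ := Δ.isFace_of_le τ.2 σ.2 hτσ
  rw [Δ.chartι_mem_chart_iff k hτσ hu hface] at hτ
  have h0 : u = 0 := by
    by_contra hne
    refine hτ ?_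
    change constCoeff k hS _ ∈ p.asIdeal
    have : constCoeff k hS (chi k ⟨u, hu⟩) = 0 := by
      rw [constCoeff_apply]
      exact Finsupp.single_eq_of_ne (fun h ↦ hne (congrArg Subtype.val h).symm)
    rw [this]
    exact zero_mem _
  subst h0
  have hle : σ ≤ σ' := fun y hy ↦ ((hface y).2 ⟨hy, by simp⟩).2
  exact le_antisymm hle (hσ hle)

variable [Module.Free ℤ N] [Module.Finite ℤ N]

/-- The inclusion of the generic point of the torus in the toric variety. -/
def genericι (Δ : Fan N) (k : Type u) [Field k] :
    Spec (.of (FractionRing (AddMonoidAlgebra k (DualLattice N)))) ⟶ Δ.variety k :=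
  Spec.map (CommRingCat.ofHom ((algebraMap (AddMonoidAlgebra k (DualLattice N)) _).comp
    (submonoidIncl k (dualMonoid ⊥)).toRingHom)) ≫ Δ.chartι k ⟨⊥, Δ.bot_mem⟩

lemma SpecMap_chartι_eq_genericι (σ : Δ.cones) :
    Spec.map (CommRingCat.ofHom ((algebraMap (AddMonoidAlgebra k (DualLattice N))
      (FractionRing (AddMonoidAlgebra k (DualLattice N)))).comp
      (submonoidIncl k (dualMonoid σ.1)).toRingHom)) ≫ Δ.chartι k σ = Δ.genericι k := by
  have hle : (⟨⊥, Δ.bot_mem⟩ : Δ.cones) ≤ σ := (bot_le : ⊥ ≤ σ.1)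
  rw [genericι, ← Δ.chartIncl_chartι k hle, chartIncl, ← Category.assoc, ← Spec.map_comp,
    ← CommRingCat.ofHom_comp, RingHom.comp_assoc]
  congr 4
  have : submonoidIncl k (dualMonoid σ.1) =
      (submonoidIncl k (dualMonoid ⊥)).comp (chartMap k hle) := by
    ext s
    simp [submonoidIncl, chartMap]
  exact congrArg AlgHom.toRingHom this

attribute [local instance] MvPolynomial.gradedAlgebra

/-- The local description at the distinguished point of a maximal cone of a morphism to `ℙⁿ`. -/
lemma exists_localData {n : ℕ} {i : Δ.variety k ⟶ projectiveSpace n k}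
    (hi : i ≫ projectiveSpaceStructure n k = Δ.structureMorphism k) (σ : Δ.cones)
    (hS : ∀ a ∈ dualMonoid σ.1, ∀ b ∈ dualMonoid σ.1, a + b = 0 → a = 0) :
    ∃ (j : Fin (n + 1)) (ψ : ProjAway k j →+* FractionRing (AddMonoidAlgebra k (DualLattice N)))
      (φ : ProjAway k j →+* k) (a : Fin (n + 1) → ChartRing k σ.1) (b : ChartRing k σ.1),
      b.coeff 0 ≠ 0 ∧
      Spec.map (CommRingCat.ofHom ψ) ≫ projChart k j = Δ.genericι k ≫ i ∧
      (∀ l, ψ (projCoord k j l) * algebraMap _ _ (submonoidIncl k _ b) =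
        algebraMap _ _ (submonoidIncl k _ (a l))) ∧
      Spec.map (CommRingCat.ofHom φ) ≫ projChart k j =
        distinguishedPoint k hS ≫ Δ.chartι k σ ≫ i ∧
      φ.comp (projConst k j) = RingHom.id k ∧
      ∀ l, φ (projCoord k j l) * b.coeff 0 = (a l).coeff 0 := by
  let A := ChartRing k σ.1
  let T := AddMonoidAlgebra k (DualLattice N)
  let K := FractionRing T
  let ε : A →+* k := (constCoeff k hS).toRingHom
  have hε : ∀ x, ε x = x.coeff 0 := constCoeff_apply k hS
  let P := RingHom.ker ε
  have hPp : P.IsPrime := RingHom.ker_isPrime ε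
  -- The local ring of the distinguished point maps both to `k`, by evaluation, and to the function
  -- field of the torus. Coordinates written over it with a common denominator `b` therefore
  -- describe the image of the distinguished point and that of the generic point at once.
  let R := Localization.AtPrime P
  let εR : R →+* k := IsLocalization.lift (M := P.primeCompl) (g := ε) fun s ↦
    isUnit_iff_ne_zero.2 s.2
  have hεR : εR.comp (algebraMap A R) = ε := IsLocalization.lift_comp _
  let κ : A →+* K := (algebraMap T K).comp (submonoidIncl k _).toRingHom
  have hκ : Function.Injective κ := (IsFractionRing.injective T K).comp (submonoidIncl_injective _)
  let κR : R →+* K := IsLocalization.lift (M := P.primeCompl) (g := κ) fun s ↦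
    isUnit_iff_ne_zero.2 fun h ↦ s.2 (by
      rw [(injective_iff_map_eq_zero κ).1 hκ _ h]; exact zero_mem _)
  have hκR : κR.comp (algebraMap A R) = κ := IsLocalization.lift_comp _
  let g : Spec (.of R) ⟶ projectiveSpace n k :=
    Spec.map (CommRingCat.ofHom (algebraMap A R)) ≫ Δ.chartι k σ ≫ i
  obtain ⟨j, hj⟩ := exists_mem_range_projChart (g (IsLocalRing.closedPoint R))
  obtain ⟨φ, hφ⟩ := exists_lift_projChart g j hj
  obtain ⟨b, hb⟩ := IsLocalization.exist_integer_multiples_of_finite P.primeCompl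
    (fun l ↦ φ (projCoord k j l))
  choose a ha using hb
  have ha' : ∀ l, φ (projCoord k j l) * algebraMap A R b = algebraMap A R (a l) := fun l ↦ by
    rw [ha l, Algebra.smul_def, mul_comm]
  refine ⟨j, κR.comp φ, εR.comp φ, a, b, ?_, ?_, fun l ↦ ?_, ?_, ?_, fun l ↦ ?_⟩
  · rw [← hε]
    exact b.2
  · rw [CommRingCat.ofHom_comp, Spec.map_comp, Category.assoc, hφ, ← Category.assoc, ← Spec.map_comp,
      ← CommRingCat.ofHom_comp, hκR, ← Category.assoc, SpecMap_chartι_eq_genericι]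
  · have := congrArg κR (ha' l)
    rw [map_mul, ← RingHom.comp_apply κR (algebraMap A R), ← RingHom.comp_apply κR (algebraMap A R),
      hκR] at this
    exact this
  · rw [CommRingCat.ofHom_comp, Spec.map_comp, Category.assoc, hφ, ← Category.assoc, ← Spec.map_comp,
      ← CommRingCat.ofHom_comp, hεR]
    rfl
  · have h1 : Spec.map (CommRingCat.ofHom (φ.comp (projConst k j))) =
        Spec.map (CommRingCat.ofHom ((algebraMap A R).comp (algebraMap k A))) := by
      rw [CommRingCat.ofHom_comp, Spec.map_comp, ← projChart_structure, ← Category.assoc, hφ,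
        CommRingCat.ofHom_comp, Spec.map_comp, ← Δ.chartι_structureMorphism k σ, ← hi]
      simp only [g, Category.assoc]
    have h2 : φ.comp (projConst k j) = (algebraMap A R).comp (algebraMap k A) :=
      congrArg CommRingCat.Hom.hom (Spec.map_injective h1)
    rw [RingHom.comp_assoc, h2, ← RingHom.comp_assoc, hεR]
    exact RingHom.ext (constCoeff k hS).commutes
  · have := congrArg εR (ha' l)
    rw [map_mul, ← RingHom.comp_apply εR (algebraMap A R), ← RingHom.comp_apply εR (algebraMap A R),
      hεR, hε, hε] at this
    exact this

/-- A quasi-projective toric variety whose fan has convex full-dimensional support carries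
a strictly convex support function. -/
theorem exists_isVertexFamily (hqp : IsQuasiProjective (Δ.structureMorphism k))
    (hsupp : Δ.HasConvexFullDimensionalSupport) : ∃ m, IsVertexFamily Δ m := by
  classical
  obtain ⟨n, i, hi, hik⟩ := hqp
  have hS : ∀ σ : Δ.cones, Δ.IsMaximalCone σ →
      ∀ a ∈ dualMonoid σ.1, ∀ b ∈ dualMonoid σ.1, a + b = 0 → a = 0 := fun σ hσ ↦
    pointed_of_span_eq_top (hσ.span_eq_top hsupp)
  have data := fun (σ : Δ.cones) (hσ : Δ.IsMaximalCone σ) ↦ exists_localData hik σ (hS σ hσ)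
  choose j ψ φ a b hb hψ hψa hφ hφk hφa using data
  obtain ⟨σ₀, hσ₀, -⟩ := Δ.exists_le_maximal ⟨⊥, Δ.bot_mem⟩
  have hone : projCoord k (j σ₀ hσ₀) (j σ₀ hσ₀) = 1 := by
    ext
    simp [projCoord]
  -- Homogeneous coordinates of the image of the generic point, normalized to be primitive. One
  -- vector `f` serves all maximal cones; `σ₀` is used only to write it down.
  obtain ⟨f, d, hd, hr, hprim⟩ := exists_primitive (T := AddMonoidAlgebra k (DualLattice N))
    (FractionRing (AddMonoidAlgebra k (DualLattice N)))
    (fun l ↦ ψ σ₀ hσ₀ (projCoord k _ l)) ⟨j σ₀ hσ₀, by simp [hone]⟩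
  have hf : ∀ σ hσ l, submonoidIncl k _ (b σ hσ) * f l =
      submonoidIncl k _ (a σ hσ l) * f (j σ hσ) := by
    intro σ hσ l
    apply IsFractionRing.injective (AddMonoidAlgebra k (DualLattice N))
      (FractionRing (AddMonoidAlgebra k (DualLattice N)))
    have h1 := projCoord_mul ((hψ σ hσ).trans (hψ σ₀ hσ₀).symm) l
    rw [hr, hr] at h1
    have h2 := hψa σ hσ l
    rw [map_mul, map_mul, ← h2]
    apply mul_left_cancel₀ hd
    linear_combination (algebraMap _ _ (submonoidIncl k _ (b σ hσ))) * (-h1)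
  -- The points of σ themselves serve as the linear forms cutting out its dual semigroup.
  have hvert := fun σ hσ ↦ exists_vertex hprim (hS σ hσ)
    (fun (x : σ.1) ↦ AddMonoidHom.mk' (fun m : DualLattice N ↦ pairing m x.1) (by simp))
    (fun m ↦ ⟨fun hm x ↦ hm _ x.2, fun hm x hx ↦ hm ⟨x, hx⟩⟩) (j σ hσ) (hb σ hσ) (hf σ hσ)
  choose m hmS hmj hm using hvert
  -- The value 0 on non-maximal cones is arbitrary; only maximal cones enter `IsVertexFamily`.
  refine ⟨fun σ ↦ if hσ : Δ.IsMaximalCone σ then m σ hσ else 0, fun σ σ' hσ hσ' x hx ↦ ?_,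
    fun σ σ' hσ hσ' h ↦ ?_⟩
  · simp only [dif_pos hσ, dif_pos hσ']
    -- `m σ'` occurs as an exponent of one of the `f l`, and all their exponents lie in `m σ + σ^∨`.
    have := hmS σ hσ _ _ (Finsupp.mem_support_iff.2 (hmj σ' hσ')) x hx
    simpa using this
  · simp only [dif_pos hσ, dif_pos hσ'] at h
    -- Up to a common factor, the coordinates of the image of the distinguished point of σ are the
    -- coefficients of the `f l` at `m σ`.
    have hcoord : ∀ σ hσ l, φ σ hσ (projCoord k _ l) * (f (j σ hσ)).coeff (m σ hσ) =
        (f l).coeff (m σ hσ) := by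
      intro σ hσ l
      apply mul_left_cancel₀ (hb σ hσ)
      rw [hm σ hσ l, ← hφa σ hσ l]
      ring
    -- the second point lies in the standard chart of `ℙⁿ` chosen for the first one
    have hne : φ σ' hσ' (projCoord k _ (j σ hσ)) ≠ 0 := fun h0 ↦ by
      have := hcoord σ' hσ' (j σ hσ)
      rw [h0, zero_mul, ← h] at this
      exact hmj σ hσ this.symm
    have hmem := mem_range_projChart_of_ne_zero (φ σ' hσ') hne (IsLocalRing.closedPoint k)
    obtain ⟨χ, hχ⟩ := exists_lift_projChart _ _ hmem
    have hχφ : χ = φ σ hσ := by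
      refine ProjAway_hom_ext ?_ fun l ↦ ?_
      · rw [hφk, ← hφk σ' hσ']
        have h1 := congrArg (· ≫ projectiveSpaceStructure n k) hχ
        simp only [Category.assoc, projChart_structure, ← Spec.map_comp,
          ← CommRingCat.ofHom_comp] at h1
        exact congrArg CommRingCat.Hom.hom (Spec.map_injective h1)
      · have h1 := projCoord_mul hχ l
        have h2 := hcoord σ' hσ' l
        have h3 := hcoord σ' hσ' (j σ hσ)
        have h4 := hcoord σ hσ l
        rw [← h] at h2 h3
        apply mul_right_cancel₀ (hmj σ hσ)
        rw [h4, ← h2, ← h1, ← h3]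
        ring
    -- The two distinguished points have the same image in `ℙⁿ`, hence are equal.
    rw [hχφ, hφ, hφ] at hχ
    have hpt := congrArg (fun (q : Spec (.of k) ⟶ projectiveSpace n k) ↦
      q (IsLocalRing.closedPoint k)) hχ
    have hinj := i.isEmbedding.injective hpt
    exact eq_of_distinguishedPoint_mem hσ (hS σ hσ) (IsLocalRing.closedPoint k)
      ⟨_, hinj.symm⟩

end Fan

end Toric

end

/-! ### The cells as locally closed sets and the filtration. -/

noncomputable section

namespace Toric

namespace Fan

variable {N : Type u} [AddCommGroup N] {Δ : Fan N} {k : Type u} [Field k]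

/-- The part of the chart of `σ` where all characters which are negative on `v` vanish. -/
def cellSet (k : Type u) [Field k] (v : N) (σ : PointedCone ℝ (RealSpace N)) :
    Set (Spec (.of (ChartRing k σ))) :=
  {y | ∀ u : dualMonoid σ, u.1 v < 0 → chi k u ∈ y.asIdeal}

lemma isClosed_cellSet (v : N) (σ : PointedCone ℝ (RealSpace N)) : IsClosed (cellSet k v σ) := by
  have : cellSet k v σ = PrimeSpectrum.zeroLocus (chi k '' {u : dualMonoid σ | u.1 v < 0}) := by
    ext y
    exact ⟨fun h ↦ by rintro _ ⟨u, hu, rfl⟩; exact h u hu, fun h u hu ↦ h ⟨u, hu, rfl⟩⟩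
  rw [this]
  exact PrimeSpectrum.isClosed_zeroLocus _

lemma exists_isClosed_inter_chart (v : N) (σ : Δ.cones) :
    ∃ Z : Set (Δ.variety k), IsClosed Z ∧
      Δ.chartι k σ '' cellSet k v σ.1 = Z ∩ Δ.chart k σ := by
  refine ⟨(Δ.chartι k σ '' (cellSet k v σ.1)ᶜ)ᶜ, ?_, ?_⟩
  · exact ((Δ.chartι k σ).isOpenEmbedding.isOpenMap _
      (isClosed_cellSet v σ.1).isOpen_compl).isClosed_compl
  · ext p
    constructor
    · rintro ⟨y, hy, rfl⟩
      refine ⟨?_, y, rfl⟩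
      rintro ⟨z, hz, h⟩
      rw [Δ.chartι_injective k σ h] at hz
      exact hz hy
    · rintro ⟨hp, y, rfl⟩
      refine ⟨y, ?_, rfl⟩
      by_contra hy
      exact hp ⟨y, hy, rfl⟩

variable [Module.Free ℤ N] [Module.Finite ℤ N]

/-- At a point of the orbit of τ, the characters of `σ^∨` that do not vanish are exactly those
trivial on τ. So the point is in the cell iff τ ⊆ σ and no such character is negative on `v`, which
by separation means `v ∈ σ + ℝτ`. -/
lemma mem_image_cellSet_iff {v : N} {p : Δ.variety k} {τ : Δ.cones} (hp : p ∈ Δ.chart k τ)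
    (hτ : ∀ ρ, p ∈ Δ.chart k ρ → τ ≤ ρ) (σ : Δ.cones) :
    p ∈ Δ.chartι k σ '' cellSet k v σ.1 ↔ InCell v τ.1 σ.1 := by
  constructor
  · rintro ⟨y, hy, rfl⟩
    have hle : τ ≤ σ := hτ σ ⟨y, rfl⟩
    refine ⟨hle, ?_⟩
    by_contra! hc
    obtain ⟨u, hu, hu0, huv⟩ :=
      (Δ.rational _ σ.2).exists_separating (Δ.rational _ τ.2) hle hc
    exact Δ.chi_notMem_of_mem_chart k hle ⟨u, hu⟩ hu0 y hp (hy ⟨u, hu⟩ huv)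
  · rintro ⟨hle, x, hx, hvx⟩
    obtain ⟨y, rfl⟩ := Δ.chart_mono k (show τ ≤ σ from hle) hp
    refine ⟨y, fun u huv ↦ ?_, rfl⟩
    by_contra hy
    let ρ : PointedCone ℝ (RealSpace N) :=
      σ.1 ⊓ (LinearMap.ker (pairing u.1)).restrictScalars _
    have hρ : ∀ x, x ∈ ρ ↔ x ∈ σ.1 ∧ pairing u.1 x = 0 := fun x ↦ Iff.rfl
    let ρ' : Δ.cones := ⟨ρ, Δ.face_mem _ σ.2 _ ⟨u.1, u.2, hρ⟩⟩
    have h1 := hτ ρ' ((Δ.chartι_mem_chart_iff k (τ := ρ')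
      (inf_le_left : ρ ≤ σ.1) u.2 hρ y).2 hy) hx
    have h2 := u.2 _ hvx
    rw [map_add, pairing_latticeVec, ((hρ x).1 h1).2, add_zero] at h2
    have : 0 ≤ u.1 v := by exact_mod_cast h2
    linarith

/-- The filtration of the toric variety defined by a generic lattice vector and a strictly convex
support function. -/
theorem exists_filtration (hsupp : Δ.HasConvexFullDimensionalSupport) {v : N}
    (hv : Δ.IsGeneric v) {m : Δ.cones → DualLattice N} (hm : IsVertexFamily Δ m) :
    ∃ (r : ℕ) (U : Fin (r + 1) → (Δ.variety k).Opens) (s : Fin r → Δ.cones),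
      U 0 = ⊥ ∧ U (Fin.last r) = ⊤ ∧ Monotone U ∧ (∀ i, Δ.IsTorusInvariant (U i)) ∧
      ∀ i, Δ.IsMaximalCone (s i) ∧ Δ.chart k (s i) ≤ U i.succ ∧
        (U i.succ : Set (Δ.variety k)) \ U i.castSucc =
          Δ.chartι k (s i) '' cellSet k v (s i).1 := by
  classical
  have := Δ.finite.to_subtype
  let Δmax := {σ : Δ.cones // Δ.IsMaximalCone σ}
  let e := Finite.equivFin Δmax
  let r := Nat.card Δmax
  let h : Fin r → ℤ := fun i ↦ m (e.symm i).1 v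
  -- Maximal cones are sorted by the value of the support function's form at `v`. Ties may be broken
  -- arbitrarily, since `eq_or_lt` is strict between distinct cells with comparable orbit cones.
  let s : Fin r ≃ Δmax := (Tuple.sort h).trans e.symm
  have hs : ∀ i j, i ≤ j → m (s i).1 v ≤ m (s j).1 v := fun i j hij ↦ Tuple.monotone_sort h hij
  have hcell : ∀ τ : Δ.cones, ∃ σ : Δmax, InCell v τ.1 σ.1.1 := fun τ ↦ by
    obtain ⟨σ, hσ, hτ⟩ := exists_inCell hsupp hv τ
    exact ⟨⟨σ, hσ⟩, hτ⟩
  choose c hc using hcell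
  let idx : Δ.cones → Fin r := fun τ ↦ s.symm (c τ)
  have hsidx : ∀ τ, s (idx τ) = c τ := fun τ ↦ s.apply_symm_apply _
  have hidx : ∀ τ τ', τ ≤ τ' → idx τ ≤ idx τ' := by
    intro τ τ' hle
    rcases hm.eq_or_lt hv (c τ).2 (c τ').2 hle (hc τ) (hc τ') with heq | hlt
    · exact (congrArg s.symm (Subtype.ext heq)).le
    · by_contra! hgt
      have := hs _ _ hgt.le
      rw [hsidx, hsidx] at this
      exact absurd hlt this.not_gt
  have hidx_iff : ∀ τ i, idx τ = i ↔ InCell v τ.1 (s i).1.1 := by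
    intro τ i
    constructor
    · rintro rfl
      rw [hsidx]
      exact hc τ
    · intro hi
      have : c τ = s i := Subtype.ext (inCell_unique hv (hc τ) hi)
      simp [idx, this]
  -- Since the index is monotone in the cone, the chart of τ contains only orbits of index at most
  -- that of τ. Hence this union of charts consists of exactly the orbits of index below `i`.
  let U : Fin (r + 1) → (Δ.variety k).Opens := fun i ↦
    ⨆ τ : {τ : Δ.cones // (idx τ).val < i.val}, Δ.chart k τ.1
  have hU : ∀ i p τ, p ∈ Δ.chart k τ → (∀ ρ, p ∈ Δ.chart k ρ → τ ≤ ρ) →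
      (p ∈ U i ↔ (idx τ).val < i.val) := by
    intro i p τ hp hτ
    simp only [U, TopologicalSpace.Opens.mem_iSup]
    exact ⟨fun ⟨ρ, hρ⟩ ↦ lt_of_le_of_lt (hidx _ _ (hτ _ hρ)) ρ.2, fun hlt ↦ ⟨⟨τ, hlt⟩, hp⟩⟩
  refine ⟨r, U, fun i ↦ (s i).1, ?_, ?_, ?_, ?_, fun i ↦ ⟨(s i).2, ?_, ?_⟩⟩
  · refine le_bot_iff.1 (iSup_le fun τ ↦ absurd τ.2 (by simp))
  · refine eq_top_iff.2 fun p _ ↦ ?_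
    obtain ⟨τ, hp, hτ⟩ := Δ.exists_orbitCone k p
    exact (hU _ p τ hp hτ).2 (idx τ).2
  · intro i j hij
    exact iSup_le fun τ ↦ le_iSup_of_le ⟨τ.1, lt_of_lt_of_le τ.2 hij⟩ le_rfl
  · exact fun i ↦ IsTorusInvariant.iSup Δ k fun τ ↦ Δ.isTorusInvariant_chart k τ.1
  · refine le_iSup_of_le (f := fun τ : {τ : Δ.cones // (idx τ).val < i.succ.val} ↦
      Δ.chart k τ.1) ⟨(s i).1, ?_⟩ le_rfl
    rw [(hidx_iff _ i).2 ((s i).2.inCell_self hsupp hv)]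
    simp
  · ext p
    obtain ⟨τ, hp, hτ⟩ := Δ.exists_orbitCone k p
    rw [mem_image_cellSet_iff hp hτ, ← hidx_iff, Set.mem_sdiff, SetLike.mem_coe, SetLike.mem_coe,
      hU _ p τ hp hτ, hU _ p τ hp hτ, Fin.ext_iff, Fin.val_succ, Fin.val_castSucc]
    omega

end Fan

end Toric

end

/-! ### The reduced scheme structure on a stratum. -/

noncomputable section

namespace Toric

section Schemes

variable {k : Type u} [Field k]

lemma IsoOver.trans {X Y Z : Scheme.{u}} {f : X ⟶ Spec (.of k)} {g : Y ⟶ Spec (.of k)}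
    {h : Z ⟶ Spec (.of k)} (e : IsoOver f g) (e' : IsoOver g h) : IsoOver f h := by
  obtain ⟨e, rfl⟩ := e
  obtain ⟨e', rfl⟩ := e'
  exact ⟨e ≪≫ e', by simp⟩

lemma isoOver_of_algEquiv {A B : Type u} [CommRing A] [CommRing B] [Algebra k A] [Algebra k B]
    (e : A ≃ₐ[k] B) : IsoOver (Spec.map (CommRingCat.ofHom (algebraMap k A)))
      (Spec.map (CommRingCat.ofHom (algebraMap k B))) := by
  refine ⟨Scheme.Spec.mapIso (e.symm.toRingEquiv.toCommRingCatIso).op, ?_⟩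
  change Spec.map _ ≫ Spec.map _ = _
  rw [← Spec.map_comp]
  congr 1
  ext x
  exact e.symm.commutes x

/-- A preimmersion with closed range is a closed immersion. When its source is reduced, its kernel
is the whole vanishing ideal of the range. -/
lemma exists_iso_subscheme_vanishingIdeal {W Y : Scheme.{u}} [IsReduced W] (g : W ⟶ Y)
    [IsPreimmersion g] (Z : TopologicalSpace.Closeds Y) (hg : Set.range g = Z) :
    ∃ e : (Scheme.IdealSheafData.vanishingIdeal Z).subscheme ≅ W,
      e.hom ≫ g = (Scheme.IdealSheafData.vanishingIdeal Z).subschemeι := by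
  have := IsClosedImmersion.of_isPreimmersion g (hg ▸ Z.isClosed)
  have hker : g.ker = Scheme.IdealSheafData.vanishingIdeal Z := by
    rw [← Scheme.IdealSheafData.map_bot, ← Scheme.nilradical_eq_bot,
      ← Scheme.IdealSheafData.vanishingIdeal_top, Scheme.IdealSheafData.map_vanishingIdeal]
    congr 1
    ext1
    simpa [hg] using Z.isClosed.closure_eq
  rw [← hker]
  exact ⟨(asIso g.toImage).symm, by
    rw [Iso.symm_hom, asIso_inv, IsIso.inv_comp_eq]
    exact g.toImage_imageι.symm⟩

end Schemes

namespace Fan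

variable {N : Type u} [AddCommGroup N] {Δ : Fan N} {k : Type u} [Field k]

/-- If `V ∖ U` is the closed subset of the chart of `σ` defined by the kernel of a surjection
from the coordinate ring to a reduced ring `B`, then it is isomorphic to `Spec B`. -/
lemma isoOver_diffSchemeι {V U : (Δ.variety k).Opens} {σ : Δ.cones} (hV : Δ.chart k σ ≤ V)
    {C : Set (Spec (.of (ChartRing k σ.1)))}
    (hC : (V : Set (Δ.variety k)) \ U = Δ.chartι k σ '' C)
    {B : Type u} [CommRing B] [Algebra k B] [_root_.IsReduced B] (π : ChartRing k σ.1 →ₐ[k] B)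
    (hπ : Function.Surjective π)
    (hπC : ∀ y : Spec (.of (ChartRing k σ.1)), y ∈ C ↔ RingHom.ker π ≤ y.asIdeal) :
    IsoOver (diffSchemeι V U ≫ Δ.structureMorphism k)
      (Spec.map (CommRingCat.ofHom (algebraMap k B))) := by
  let i : Spec (.of B) ⟶ Spec (.of (ChartRing k σ.1)) :=
    Spec.map (CommRingCat.ofHom π.toRingHom)
  have hi : IsClosedImmersion i := IsClosedImmersion.spec_of_surjective _ hπ
  have hrange : Set.range i = C := by
    ext y
    rw [hπC]
    have := range_comap_of_surjective B π.toRingHom hπ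
    change y ∈ Set.range (PrimeSpectrum.comap π.toRingHom) ↔ _
    rw [this]
    rfl
  let j : Spec (.of (ChartRing k σ.1)) ⟶ V.toScheme :=
    IsOpenImmersion.lift V.ι (Δ.chartι k σ) (by
      rw [Scheme.Opens.range_ι]
      exact hV)
  have hj : j ≫ V.ι = Δ.chartι k σ := IsOpenImmersion.lift_fac _ _ _
  have : IsOpenImmersion (j ≫ V.ι) := hj ▸ inferInstance
  have : IsOpenImmersion j := IsOpenImmersion.of_comp j V.ι
  -- Although `j` is only an open immersion, the range is closed in all of `V`, because `V ∖ U` is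
  -- contained in the chart.
  have hr : Set.range (i ≫ j) = (closedDiff V U : Set V.toScheme) := by
    apply (Set.image_injective.2 V.ι.isOpenEmbedding.injective)
    rw [← Set.range_comp]
    have e1 : (V.ι ∘ (i ≫ j) : Spec (.of B) → Δ.variety k) = Δ.chartι k σ ∘ i := by
      rw [← hj]
      ext; simp
    rw [e1, Set.range_comp, hrange, ← hC]
    ext p
    constructor
    · rintro ⟨hp, hp'⟩
      exact ⟨⟨p, hp⟩, hp', rfl⟩
    · rintro ⟨q, hq, rfl⟩
      exact ⟨q.2, hq⟩
  obtain ⟨e, he⟩ := exists_iso_subscheme_vanishingIdeal (i ≫ j) (closedDiff V U) hr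
  refine ⟨e, ?_⟩
  have h1 : Spec.map (CommRingCat.ofHom (algebraMap k B)) =
      (i ≫ j) ≫ V.ι ≫ Δ.structureMorphism k := by
    rw [Category.assoc, ← Category.assoc j, hj, chartι_structureMorphism, ← Spec.map_comp]
    congr 1
    ext x
    exact (π.commutes x).symm
  have h2 : e.hom ≫ (i ≫ j) ≫ V.ι ≫ Δ.structureMorphism k =
      ((Scheme.IdealSheafData.vanishingIdeal (closedDiff V U)).subschemeι ≫ V.ι) ≫
        Δ.structureMorphism k := by
    rw [← he]
    simp only [Category.assoc]
  rw [h1]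
  exact h2

end Fan

end Toric

end

/-! ### The coordinate ring of a cell, for a cone with a frame. -/

noncomputable section

namespace Toric

/-- The subalgebra of the polynomial ring spanned by the monomials with exponent in a given
lattice. -/
def latticeSubalgebra (k : Type*) [Field k] {d : ℕ} (L : AddSubgroup (Fin d → ℤ)) :
    Subalgebra k (MvPolynomial (Fin d) k) where
  carrier := {f | ∀ a ∈ f.support, (fun j ↦ (a j : ℤ)) ∈ L}
  algebraMap_mem' r a ha := by
    classical
    rw [MvPolynomial.algebraMap_eq, MvPolynomial.C_apply] at ha
    have := MvPolynomial.support_monomial_subset ha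
    rw [Finset.mem_singleton] at this
    subst this
    exact L.zero_mem
  add_mem' {f g} hf hg a ha := by
    classical
    rcases Finset.mem_union.1 (MvPolynomial.support_add ha) with h | h
    exacts [hf a h, hg a h]
  mul_mem' {f g} hf hg a ha := by
    classical
    obtain ⟨b, hb, c, hc, rfl⟩ := Finset.mem_add.1 (MvPolynomial.support_mul _ _ ha)
    convert L.add_mem (hf b hb) (hg c hc) using 1
    ext j
    simp

lemma mem_latticeSubalgebra {k : Type*} [Field k] {d : ℕ} {L : AddSubgroup (Fin d → ℤ)}
    {f : MvPolynomial (Fin d) k} :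
    f ∈ latticeSubalgebra k L ↔ ∀ a ∈ f.support, (fun j ↦ (a j : ℤ)) ∈ L := Iff.rfl

section Frame

variable {N : Type u} [AddCommGroup N]

/-- A family of lattice vectors which are the inner facet normals of the dual of a
full-dimensional simplicial cone, with a dual family up to the scalar `c`. -/
structure IsFrame {ι : Type*} [DecidableEq ι] (σ : PointedCone ℝ (RealSpace N)) (w : ι → N)
    (c : ℕ) (d : ι → DualLattice N) : Prop where
  mem_iff : ∀ u, u ∈ dualMonoid σ ↔ ∀ i, 0 ≤ u (w i)
  eq_zero : ∀ u : DualLattice N, (∀ i, u (w i) = 0) → u = 0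
  pos : 0 < c
  dual : ∀ i j, d i (w j) = if i = j then (c : ℤ) else 0

namespace IsFrame

variable {ι : Type*} {σ : PointedCone ℝ (RealSpace N)} {w : ι → N}
  {c : ℕ} {d : ι → DualLattice N}

lemma dual_mem [DecidableEq ι] (h : IsFrame σ w c d) (i : ι) : d i ∈ dualMonoid σ := by
  rw [h.mem_iff]
  intro j
  rw [h.dual]
  split_ifs <;> positivity

lemma smul_eq_sum [DecidableEq ι] [Fintype ι] (h : IsFrame σ w c d) (u : DualLattice N) :
    (c : ℤ) • u = ∑ i, u (w i) • d i := by
  rw [← sub_eq_zero]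
  refine h.eq_zero _ fun j ↦ ?_
  simp [h.dual, mul_comm]

/-- The face of the dual monoid on which the negative coordinates of `v` vanish. -/
def posFace (w : ι → N) (d : ι → DualLattice N) (v : N) : AddSubgroup (DualLattice N) where
  carrier := {u | ∀ i, d i v < 0 → u (w i) = 0}
  zero_mem' _ _ := rfl
  add_mem' ha hb i hi := by simp [ha i hi, hb i hi]
  neg_mem' ha i hi := by simp [ha i hi]

/-- For `u` in the face, `c • u` is a nonnegative combination of those `d i` with `d i v ≥ 0`, so it
cannot be negative on `v`. -/
lemma notMem_posFace [DecidableEq ι] [Fintype ι] (h : IsFrame σ w c d) {v : N}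
    {u : DualLattice N} (hu : u ∈ dualMonoid σ) (huv : u v < 0) : u ∉ posFace w d v := by
  intro hp
  have h1 := LinearMap.congr_fun (h.smul_eq_sum u) v
  have h2 : 0 ≤ (∑ i, u (w i) • d i) v := by
    rw [LinearMap.sum_apply]
    refine Finset.sum_nonneg fun i _ ↦ ?_
    rcases lt_or_ge (d i v) 0 with hi | hi
    · simp [hp i hi]
    · exact mul_nonneg ((h.mem_iff u).1 hu i) hi
  rw [← h1] at h2
  have h3 : (0 : ℤ) < c := by exact_mod_cast h.pos
  have h4 : ((c : ℤ) • u) v = c * u v := rfl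
  rw [h4] at h2
  nlinarith

variable (k : Type u) [Field k] {n : ℕ} (p : Fin n → ι)

/-- The lattice of the exponents of the characters in the face `posFace`. -/
def exponentLattice (w : ι → N) (d : ι → DualLattice N) (v : N) (p : Fin n → ι) :
    AddSubgroup (Fin n → ℤ) :=
  (posFace w d v).map
    { toFun := fun u j ↦ u (w (p j)), map_zero' := rfl, map_add' := fun _ _ ↦ rfl }

lemma mem_exponentLattice {v : N} {b : Fin n → ℤ} :
    b ∈ exponentLattice w d v p ↔ ∃ u ∈ posFace w d v, ∀ j, u (w (p j)) = b j := by
  simp [exponentLattice, AddSubgroup.mem_map, funext_iff]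

/-- The element `∑ b j • d (p j)` of the face has exponents `c • b`. This makes the lattice of
finite index, and everything when `c = 1`. -/
lemma smul_mem_exponentLattice [DecidableEq ι] (h : IsFrame σ w c d) {v : N}
    (hinj : Function.Injective p) (hp : ∀ j, 0 ≤ d (p j) v) (b : Fin n → ℤ) : c • b ∈ exponentLattice w d v p := by
  rw [mem_exponentLattice]
  refine ⟨∑ j, b j • d (p j), fun i hi ↦ ?_, fun j ↦ ?_⟩
  · rw [LinearMap.sum_apply]
    refine Finset.sum_eq_zero fun j _ ↦ ?_
    rw [LinearMap.smul_apply, h.dual, if_neg, smul_zero]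
    rintro rfl
    exact absurd (hp j) (not_le.2 hi)
  · rw [LinearMap.sum_apply, Finset.sum_eq_single j]
    · simp [h.dual, mul_comm]
    · intro l _ hl
      rw [LinearMap.smul_apply, h.dual, if_neg (hinj.ne hl), smul_zero]
    · simp

/-- The exponents of a character with respect to part of a frame. -/
def exponent (w : ι → N) (p : Fin n → ι) (u : DualLattice N) : Fin n →₀ ℕ :=
  Finsupp.equivFunOnFinite.symm fun j ↦ (u (w (p j))).toNat

lemma coe_exponent [DecidableEq ι] (h : IsFrame σ w c d) {u : DualLattice N}
    (hu : u ∈ dualMonoid σ) (j : Fin n) : (exponent w p u j : ℤ) = u (w (p j)) := by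
  simpa [exponent] using (h.mem_iff u).1 hu _

lemma exponent_injOn [DecidableEq ι] (h : IsFrame σ w c d) {v : N}
    (hp : ∀ i, 0 ≤ d i v → i ∈ Set.range p)
    {u u' : DualLattice N} (hu : u ∈ dualMonoid σ) (hu' : u' ∈ dualMonoid σ)
    (huv : u ∈ posFace w d v) (huv' : u' ∈ posFace w d v)
    (he : exponent w p u = exponent w p u') : u = u' := by
  rw [← sub_eq_zero]
  refine h.eq_zero _ fun i ↦ ?_
  rcases lt_or_ge (d i v) 0 with hi | hi
  · exact (posFace w d v).sub_mem huv huv' i hi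
  · obtain ⟨j, rfl⟩ := hp i hi
    rw [LinearMap.sub_apply, ← coe_exponent p h hu, ← coe_exponent p h hu', he, sub_self]

open Classical in
/-- The homomorphism from the coordinate ring of a chart to the polynomial ring which is zero
on the characters outside `posFace`. -/
def cellHom [DecidableEq ι] (h : IsFrame σ w c d) (v : N) (p : Fin n → ι) :
    ChartRing k σ →ₐ[k] MvPolynomial (Fin n) k :=
  AddMonoidAlgebra.lift k _ (dualMonoid σ)
    { toFun := fun u ↦ if u.toAdd.1 ∈ posFace w d v then
        MvPolynomial.monomial (exponent w p u.toAdd.1) 1 else 0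
      map_one' := by
        rw [if_pos (by exact (posFace w d v).zero_mem)]
        change _ = MvPolynomial.monomial 0 1
        congr 2
        ext j
        simp [exponent]
      map_mul' := fun a b ↦ by
        have hab : (a * b).toAdd.1 = a.toAdd.1 + b.toAdd.1 := rfl
        -- Nonnegative values with sum zero are zero, so `posFace` cuts out a face of the dual
        -- semigroup. This is what makes killing the other characters multiplicative.
        have hiff : (a * b).toAdd.1 ∈ posFace w d v ↔
            a.toAdd.1 ∈ posFace w d v ∧ b.toAdd.1 ∈ posFace w d v := by
          rw [hab]
          refine ⟨fun H ↦ ?_, fun H ↦ add_mem H.1 H.2⟩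
          have key : ∀ i, d i v < 0 → a.toAdd.1 (w i) = 0 ∧ b.toAdd.1 (w i) = 0 := by
            intro i hi
            have h1 := (h.mem_iff _).1 a.toAdd.2 i
            have h2 := (h.mem_iff _).1 b.toAdd.2 i
            have h3 : a.toAdd.1 (w i) + b.toAdd.1 (w i) = 0 := H i hi
            constructor <;> linarith
          exact ⟨fun i hi ↦ (key i hi).1, fun i hi ↦ (key i hi).2⟩
        by_cases ha : a.toAdd.1 ∈ posFace w d v
        · by_cases hb : b.toAdd.1 ∈ posFace w d v
          · rw [if_pos (hiff.2 ⟨ha, hb⟩), if_pos ha, if_pos hb, MvPolynomial.monomial_mul, one_mul]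
            congr 2
            ext j
            have h1 := coe_exponent p h (add_mem a.toAdd.2 b.toAdd.2) j
            have h2 := coe_exponent p h a.toAdd.2 j
            have h3 := coe_exponent p h b.toAdd.2 j
            rw [LinearMap.add_apply, ← h2, ← h3] at h1
            rw [hab]
            exact_mod_cast h1
          · rw [if_neg (mt hiff.1 fun H ↦ hb H.2), if_neg hb, mul_zero]
        · rw [if_neg (mt hiff.1 fun H ↦ ha H.1), if_neg ha, zero_mul] }

lemma cellHom_single_of_mem [DecidableEq ι] (h : IsFrame σ w c d) {v : N} {u : dualMonoid σ}
    (hu : u.1 ∈ posFace w d v) (r : k) :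
    cellHom k h v p (.single u r) = MvPolynomial.monomial (exponent w p u.1) r := by
  rw [cellHom, AddMonoidAlgebra.lift_single]
  classical
  change r • (if u.1 ∈ posFace w d v then _ else _) = _
  rw [if_pos hu, MvPolynomial.smul_monomial, smul_eq_mul, mul_one]
  rfl

lemma cellHom_single_of_notMem [DecidableEq ι] (h : IsFrame σ w c d) {v : N} {u : dualMonoid σ}
    (hu : u.1 ∉ posFace w d v) (r : k) : cellHom k h v p (.single u r) = 0 := by
  rw [cellHom, AddMonoidAlgebra.lift_single]
  classical
  change r • (if u.1 ∈ posFace w d v then _ else _) = _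
  rw [if_neg hu, smul_zero]

/-- Exponents separate the characters of the face, so their coefficients can be read off from the
image. Hence the kernel of `cellHom` is spanned by the characters outside the face. -/
lemma coeff_cellHom [DecidableEq ι] (h : IsFrame σ w c d) {v : N}
    (hp : ∀ i, 0 ≤ d i v → i ∈ Set.range p)
    {u : dualMonoid σ} (hu : u.1 ∈ posFace w d v) (f : ChartRing k σ) :
    (cellHom k h v p f).coeff (exponent w p u.1) = f.coeff u := by
  classical
  induction f using AddMonoidAlgebra.induction_linear with
  | zero => simp
  | add f g hf hg => simp [hf, hg]
  | single u' r =>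
    by_cases hu' : u'.1 ∈ posFace w d v
    · rw [cellHom_single_of_mem k p h hu', MvPolynomial.coeff_monomial,
        AddMonoidAlgebra.coeff_single, Finsupp.single_apply]
      by_cases e : u' = u
      · subst e; simp
      · rw [if_neg e, if_neg]
        exact fun he ↦ e (Subtype.ext (exponent_injOn p h hp u'.2 u.2 hu' hu he))
    · rw [cellHom_single_of_notMem k p h hu', AddMonoidAlgebra.coeff_single, Finsupp.single_apply,
        if_neg (by rintro rfl; exact hu' hu), MvPolynomial.coeff_zero]

/-- Some `i` has `d i v < 0` and `u (w i) ≥ 1`. Then `c • u - d i` is nonnegative on the frame, so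
`χ^(d i)`, which vanishes on the cell, divides the `c`-th power of `χ^u`. -/
lemma chi_mem_of_notMem_posFace [DecidableEq ι] (h : IsFrame σ w c d) {v : N}
    {y : Spec (.of (ChartRing k σ))} (hy : y ∈ Fan.cellSet k v σ) {u : dualMonoid σ} (hu : u.1 ∉ posFace w d v) :
    Fan.chi k u ∈ y.asIdeal := by
  obtain ⟨i, hi, hui⟩ : ∃ i, d i v < 0 ∧ u.1 (w i) ≠ 0 := by
    by_contra! hc
    exact hu hc
  have hdi := hy ⟨d i, h.dual_mem i⟩ hi
  have hmem : (c : ℤ) • u.1 - d i ∈ dualMonoid σ := by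
    rw [h.mem_iff]
    intro j
    have h0 := (h.mem_iff _).1 u.2
    have h1 : ((c : ℤ) • u.1 - d i) (w j) = c * u.1 (w j) - d i (w j) := rfl
    rw [h1, h.dual]
    split_ifs with hij
    · subst hij
      have : 1 ≤ u.1 (w i) := by
        have := h0 i
        omega
      have hc : (0 : ℤ) ≤ c := by positivity
      nlinarith
    · simpa using mul_nonneg (by positivity) (h0 j)
  have hpow : Fan.chi k u ^ c =
      Fan.chi k (⟨_, hmem⟩ : dualMonoid σ) * Fan.chi k ⟨d i, h.dual_mem i⟩ := by
    rw [Fan.chi, Fan.chi, Fan.chi, AddMonoidAlgebra.single_pow,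
      AddMonoidAlgebra.single_mul_single, one_pow, one_mul]
    congr 1
    ext1
    simp
  exact y.isPrime.mem_of_pow_mem c (hpow ▸ Ideal.mul_mem_left _ _ hdi)

lemma mem_cellSet_iff [DecidableEq ι] [Fintype ι] (h : IsFrame σ w c d) {v : N}
    (hp : ∀ i, 0 ≤ d i v → i ∈ Set.range p)
    (y : Spec (.of (ChartRing k σ))) :
    y ∈ Fan.cellSet k v σ ↔ RingHom.ker (cellHom k h v p) ≤ y.asIdeal := by
  constructor
  · intro hy f hf
    have hf' : ∀ u ∈ f.coeff.support, AddMonoidAlgebra.single u (f.coeff u) ∈ y.asIdeal := by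
      intro u hu
      have hu' : u.1 ∉ posFace w d v := by
        intro H
        have := coeff_cellHom k p h hp H f
        rw [show cellHom k h v p f = 0 from hf, MvPolynomial.coeff_zero] at this
        exact Finsupp.mem_support_iff.1 hu this.symm
      have h1 : AddMonoidAlgebra.single u (f.coeff u) =
          algebraMap k (ChartRing k σ) (f.coeff u) * Fan.chi k u := by
        rw [← Algebra.smul_def, Fan.chi, AddMonoidAlgebra.smul_single, smul_eq_mul, mul_one]
      rw [h1]
      exact Ideal.mul_mem_left _ _ (chi_mem_of_notMem_posFace k h hy hu')
    have := Ideal.sum_mem _ hf'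
    convert this
    apply AddMonoidAlgebra.coeff_injective
    conv_lhs => rw [← Finsupp.sum_single f.coeff]
    simp [Finsupp.sum]
  · intro hle u huv
    exact hle (cellHom_single_of_notMem k p h (h.notMem_posFace u.2 huv) 1)

lemma range_cellHom [DecidableEq ι] (h : IsFrame σ w c d) {v : N}
    (hp : ∀ i, 0 ≤ d i v → i ∈ Set.range p) :
    (cellHom k h v p).range = latticeSubalgebra k (exponentLattice w d v p) := by
  classical
  apply le_antisymm
  · rintro _ ⟨f, rfl⟩
    induction f using AddMonoidAlgebra.induction_linear with
    | zero => simp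
    | add f g hf hg => rw [map_add]; exact add_mem hf hg
    | single u r =>
      by_cases hu : u.1 ∈ posFace w d v
      · intro a ha
        change a ∈ (cellHom k h v p (.single u r)).support at ha
        rw [cellHom_single_of_mem k p h hu] at ha
        have := MvPolynomial.support_monomial_subset ha
        rw [Finset.mem_singleton] at this
        subst this
        rw [mem_exponentLattice]
        exact ⟨u.1, hu, fun j ↦ (coe_exponent p h u.2 j).symm⟩
      · change cellHom k h v p (.single u r) ∈ _
        rw [cellHom_single_of_notMem k p h hu]
        exact zero_mem _
  · intro f hf
    rw [← f.support_sum_monomial_coeff]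
    refine Subalgebra.sum_mem _ fun a ha ↦ ?_
    obtain ⟨u, hu, hua⟩ := (mem_exponentLattice p).1 (hf a ha)
    have hmem : u ∈ dualMonoid σ := by
      rw [h.mem_iff]
      intro i
      rcases lt_or_ge (d i v) 0 with hi | hi
      · exact (hu i hi).ge
      · obtain ⟨j, rfl⟩ := hp i hi
        rw [hua]
        positivity
    refine ⟨.single ⟨u, hmem⟩ (f.coeff a), ?_⟩
    change cellHom k h v p (.single ⟨u, hmem⟩ (f.coeff a)) = _
    rw [cellHom_single_of_mem k p h hu]
    congr 2
    ext j
    have h1 := coe_exponent p h hmem j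
    rw [hua] at h1
    exact_mod_cast h1

end IsFrame

end Frame

namespace Fan

variable {N : Type u} [AddCommGroup N] {Δ : Fan N} {k : Type u} [Field k]

/-- For a cone with a frame, the cell is the spectrum of a ring of polynomials with exponents in
a lattice of index dividing a power of `c`. -/
lemma exists_isoOver_latticeSubalgebra {V U : (Δ.variety k).Opens} {σ : Δ.cones} {v : N}
    (hV : Δ.chart k σ ≤ V)
    (hC : (V : Set (Δ.variety k)) \ U = Δ.chartι k σ '' cellSet k v σ.1)
    {ι : Type*} [DecidableEq ι] [Fintype ι] {w : ι → N} {c : ℕ} {d : ι → DualLattice N}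
    (h : IsFrame σ.1 w c d) :
    ∃ (n : ℕ) (L : AddSubgroup (Fin n → ℤ)), (∀ b : Fin n → ℤ, c • b ∈ L) ∧
      IsoOver (diffSchemeι V U ≫ Δ.structureMorphism k)
        (Spec.map (CommRingCat.ofHom (algebraMap k (latticeSubalgebra k L)))) := by
  classical
  let e := Fintype.equivFin {i // 0 ≤ d i v}
  let p : Fin (Fintype.card {i // 0 ≤ d i v}) → ι := fun j ↦ (e.symm j).1
  have hp : ∀ i, 0 ≤ d i v → i ∈ Set.range p := fun i hi ↦ ⟨e ⟨i, hi⟩, by simp [p]⟩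
  have hpinj : Function.Injective p := Subtype.val_injective.comp e.symm.injective
  refine ⟨_, IsFrame.exponentLattice w d v p,
    IsFrame.smul_mem_exponentLattice p h hpinj fun j ↦ (e.symm j).2, ?_⟩
  rw [← IsFrame.range_cellHom k p h hp]
  refine isoOver_diffSchemeι hV hC (IsFrame.cellHom k h v p).rangeRestrict
    (AlgHom.rangeRestrict_surjective _) fun y ↦ ?_
  rw [IsFrame.mem_cellSet_iff k p h hp, AlgHom.ker_rangeRestrict]

end Fan

end Toric

end

/-! ### Lattice subalgebras as rings of invariants. -/

noncomputable section

namespace Toric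

section Quotient

variable (k : Type u) [Field k] {n : ℕ} (L : AddSubgroup (Fin n → ℤ))

/-- The class of an exponent modulo a lattice. -/
def exponentClass : (Fin n →₀ ℕ) →+ (Fin n → ℤ) ⧸ L where
  toFun a := QuotientAddGroup.mk fun j ↦ (a j : ℤ)
  map_zero' := by
    rw [QuotientAddGroup.eq_zero_iff]
    exact L.zero_mem
  map_add' a b := by
    rw [← QuotientAddGroup.mk_add]
    congr 1

lemma exponentClass_eq_zero_iff {a : Fin n →₀ ℕ} :
    exponentClass L a = 0 ↔ (fun j ↦ (a j : ℤ)) ∈ L :=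
  QuotientAddGroup.eq_zero_iff _

lemma finite_quotient {c : ℕ} (hc : 0 < c) (hL : ∀ b : Fin n → ℤ, c • b ∈ L) :
    Finite ((Fin n → ℤ) ⧸ L) := by
  have : AddGroup.FG ((Fin n → ℤ) ⧸ L) := inferInstance
  refine AddCommGroup.finite_of_fg_isAddTorsion _ fun x ↦ ?_
  obtain ⟨b, rfl⟩ := QuotientAddGroup.mk_surjective x
  exact isOfFinAddOrder_iff_nsmul_eq_zero.2
    ⟨c, hc, by rw [← QuotientAddGroup.mk_nsmul, QuotientAddGroup.eq_zero_iff]; exact hL b⟩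

/-- The coaction on the polynomial ring of the group algebra of the quotient by a lattice. -/
def latticeCoaction : MvPolynomial (Fin n) k →ₐ[k]
    MvPolynomial (Fin n) k ⊗[k] AddMonoidAlgebra k ((Fin n → ℤ) ⧸ L) :=
  AddMonoidAlgebra.lift k _ (Fin n →₀ ℕ)
    { toFun := fun a ↦ MvPolynomial.monomial a.toAdd 1 ⊗ₜ .single (exponentClass L a.toAdd) 1
      map_one' := by
        simp [AddMonoidAlgebra.one_def, Algebra.TensorProduct.one_def]
      map_mul' := fun a b ↦ by
        simp [MvPolynomial.monomial_mul, AddMonoidAlgebra.single_mul_single] }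

lemma latticeCoaction_monomial (a : Fin n →₀ ℕ) (r : k) :
    latticeCoaction k L (MvPolynomial.monomial a r) =
      MvPolynomial.monomial a r ⊗ₜ .single (exponentClass L a) 1 := by
  have : latticeCoaction k L (MvPolynomial.monomial a r) =
      r • (MvPolynomial.monomial a 1 ⊗ₜ .single (exponentClass L a) 1) :=
    AddMonoidAlgebra.lift_single _ _ _
  rw [this, TensorProduct.smul_tmul', MvPolynomial.smul_monomial, smul_eq_mul, mul_one]

lemma isCoaction_latticeCoaction : IsCoaction (latticeCoaction k L) where
  coassoc := by
    refine MvPolynomial.algHom_ext fun j ↦ ?_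
    simp [MvPolynomial.X, latticeCoaction_monomial]
  counit := by
    refine MvPolynomial.algHom_ext fun j ↦ ?_
    simp [MvPolynomial.X, latticeCoaction_monomial]

/-- The component of a tensor in a given degree. -/
def tensorComponent (q : (Fin n → ℤ) ⧸ L) :
    MvPolynomial (Fin n) k ⊗[k] AddMonoidAlgebra k ((Fin n → ℤ) ⧸ L) →ₗ[k]
      MvPolynomial (Fin n) k :=
  TensorProduct.lift
    { toFun := fun f ↦
        { toFun := fun h ↦ h.coeff q • f
          map_add' := fun _ _ ↦ by simp [add_smul]
          map_smul' := fun _ _ ↦ by simp [mul_smul] }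
      map_add' := fun _ _ ↦ LinearMap.ext fun _ ↦ smul_add _ _ _
      map_smul' := fun r f ↦ LinearMap.ext fun _ ↦ smul_comm _ _ _ }

lemma tensorComponent_tmul (q : (Fin n → ℤ) ⧸ L) (f : MvPolynomial (Fin n) k)
    (h : AddMonoidAlgebra k ((Fin n → ℤ) ⧸ L)) :
    tensorComponent k L q (f ⊗ₜ h) = h.coeff q • f := rfl

lemma coeff_tensorComponent_latticeCoaction (f : MvPolynomial (Fin n) k) (a : Fin n →₀ ℕ) :
    (tensorComponent k L (exponentClass L a) (latticeCoaction k L f)).coeff a = f.coeff a := by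
  classical
  induction f using MvPolynomial.induction_on' with
  | monomial b r =>
    rw [latticeCoaction_monomial, tensorComponent_tmul, AddMonoidAlgebra.coeff_single,
      MvPolynomial.coeff_smul, MvPolynomial.coeff_monomial]
    split_ifs with h
    · subst h; simp
    · simp
  | add f g hf hg => simp [hf, hg]

/-- The coaction encodes the grading of polynomials by `ℤⁿ/L`, and the invariants are the part of
degree 0. The maps `tensorComponent` show that an invariant has no monomial of another degree. -/
lemma equalizer_latticeCoaction :
    AlgHom.equalizer (latticeCoaction k L) Algebra.TensorProduct.includeLeft =
      latticeSubalgebra k L := by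
  ext f
  rw [AlgHom.mem_equalizer, mem_latticeSubalgebra]
  constructor
  · intro h a ha
    rw [← exponentClass_eq_zero_iff]
    by_contra h0
    have h1 := coeff_tensorComponent_latticeCoaction k L f a
    rw [h, Algebra.TensorProduct.includeLeft_apply, tensorComponent_tmul,
      AddMonoidAlgebra.one_def, AddMonoidAlgebra.coeff_single, Finsupp.single_eq_of_ne h0,
      zero_smul, MvPolynomial.coeff_zero] at h1
    exact MvPolynomial.mem_support_iff.1 ha h1.symm
  · intro h
    rw [← f.support_sum_monomial_coeff, map_sum, map_sum]
    refine Finset.sum_congr rfl fun a ha ↦ ?_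
    rw [latticeCoaction_monomial, (exponentClass_eq_zero_iff L).2 (h a ha)]
    rfl

lemma isFiniteGroupSchemeQuotientOfAffineSpace [Finite ((Fin n → ℤ) ⧸ L)] {X : Scheme.{u}}
    {f : X ⟶ Spec (.of k)}
    (h : IsoOver f (Spec.map (CommRingCat.ofHom (algebraMap k (latticeSubalgebra k L))))) :
    IsFiniteGroupSchemeQuotientOfAffineSpace f := by
  refine ⟨n, AddMonoidAlgebra k ((Fin n → ℤ) ⧸ L), inferInstance, inferInstance, ?_,
    latticeCoaction k L, isCoaction_latticeCoaction k L, ?_⟩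
  · exact Module.Finite.equiv (AddMonoidAlgebra.coeffLinearEquiv k).symm
  · rw [equalizer_latticeCoaction]
    exact h

/-- The action of a character of the quotient by a lattice on the polynomial ring. -/
def characterAction (χ : Multiplicative ((Fin n → ℤ) ⧸ L) →* kˣ) :
    MvPolynomial (Fin n) k →ₐ[k] MvPolynomial (Fin n) k :=
  AddMonoidAlgebra.lift k _ (Fin n →₀ ℕ)
    { toFun := fun a ↦ MvPolynomial.monomial a.toAdd (χ (.ofAdd (exponentClass L a.toAdd)) : k)
      map_one' := by simp
      map_mul' := fun a b ↦ by simp [MvPolynomial.monomial_mul] }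

lemma coeff_characterAction (χ : Multiplicative ((Fin n → ℤ) ⧸ L) →* kˣ)
    (f : MvPolynomial (Fin n) k) (a : Fin n →₀ ℕ) :
    (characterAction k L χ f).coeff a = χ (.ofAdd (exponentClass L a)) * f.coeff a := by
  classical
  induction f using MvPolynomial.induction_on' with
  | monomial b r =>
    have : characterAction k L χ (MvPolynomial.monomial b r) =
        r • MvPolynomial.monomial b (χ (.ofAdd (exponentClass L b)) : k) :=
      AddMonoidAlgebra.lift_single _ _ _
    rw [this, MvPolynomial.coeff_smul, MvPolynomial.coeff_monomial, MvPolynomial.coeff_monomial]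
    split_ifs with h
    · subst h; simp [mul_comm]
    · simp
  | add f g hf hg => simp [hf, hg, mul_add]

lemma isFiniteQuotientOfAffineSpace [IsAlgClosed k] [CharZero k] [Finite ((Fin n → ℤ) ⧸ L)]
    {X : Scheme.{u}} {f : X ⟶ Spec (.of k)}
    (h : IsoOver f (Spec.map (CommRingCat.ofHom (algebraMap k (latticeSubalgebra k L))))) :
    IsFiniteQuotientOfAffineSpace f := by
  let Q := Multiplicative ((Fin n → ℤ) ⧸ L)
  have : Finite Q := ‹Finite ((Fin n → ℤ) ⧸ L)›
  have : NeZero (Monoid.exponent Q) := ⟨Monoid.exponent_ne_zero_of_finite⟩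
  have : NeZero (Monoid.exponent Q : k) := ⟨Nat.cast_ne_zero.2 (NeZero.ne _)⟩
  -- The group that naturally acts is the character group of `Q`. It is replaced by the isomorphic
  -- group `Q`, which lies in `Type` as the definition of a finite quotient demands.
  obtain ⟨e⟩ := CommGroup.monoidHom_mulEquiv_of_hasEnoughRootsOfUnity Q k
  let act : MulSemiringAction Q (MvPolynomial (Fin n) k) :=
    { smul := fun g f ↦ characterAction k L (e.symm g) f
      one_smul := fun f ↦ MvPolynomial.ext _ _ fun a ↦ by
        change (characterAction k L (e.symm 1) f).coeff a = _
        simp [coeff_characterAction]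
      mul_smul := fun g g' f ↦ MvPolynomial.ext _ _ fun a ↦ by
        change (characterAction k L (e.symm (g * g')) f).coeff a =
          (characterAction k L (e.symm g) (characterAction k L (e.symm g') f)).coeff a
        simp [coeff_characterAction, mul_assoc]
      smul_zero := fun g ↦ map_zero (characterAction k L (e.symm g))
      smul_add := fun g ↦ map_add (characterAction k L (e.symm g))
      smul_one := fun g ↦ map_one (characterAction k L (e.symm g))
      smul_mul := fun g ↦ map_mul (characterAction k L (e.symm g)) }
  have hsmul : ∀ (g : Q) (f : MvPolynomial (Fin n) k),
    g • f = characterAction k L (e.symm g) f := fun _ _ ↦ rfl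
  have hcomm : SMulCommClass Q k (MvPolynomial (Fin n) k) := ⟨fun g r f ↦ by
    rw [hsmul, hsmul, map_smul]⟩
  refine ⟨n, Q, inferInstance, inferInstance, act, hcomm, ?_⟩
  have heq : FixedPoints.subalgebra k (MvPolynomial (Fin n) k) Q = latticeSubalgebra k L := by
    ext f
    rw [mem_latticeSubalgebra]
    change (∀ g : Q, g • f = f) ↔ _
    constructor
    · intro hf a ha
      rw [← exponentClass_eq_zero_iff]
      by_contra h0
      -- With enough roots of unity, characters separate the elements of `Q`, so a monomial of
      -- nonzero degree is moved by some character.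
      obtain ⟨χ, hχ⟩ := CommGroup.exists_apply_ne_one_of_hasEnoughRootsOfUnity Q k
        (a := .ofAdd (exponentClass L a)) (mt ofAdd_eq_one.1 h0)
      have h1 := congrArg (MvPolynomial.coeff a) (hf (e χ))
      rw [hsmul, coeff_characterAction, e.symm_apply_apply] at h1
      have h2 := mul_right_cancel₀ (MvPolynomial.mem_support_iff.1 ha) (h1.trans (one_mul _).symm)
      exact hχ (Units.ext h2)
    · intro hf g
      refine MvPolynomial.ext _ _ fun a ↦ ?_
      rw [hsmul, coeff_characterAction]
      by_cases ha : a ∈ f.support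
      · rw [(exponentClass_eq_zero_iff L).2 (hf a ha)]
        simp
      · rw [MvPolynomial.notMem_support_iff.1 ha, mul_zero]
  rw [heq]
  exact h

lemma isAffineSpace_of_top {X : Scheme.{u}} {f : X ⟶ Spec (.of k)}
    (h : IsoOver f (Spec.map (CommRingCat.ofHom
      (algebraMap k (latticeSubalgebra k (⊤ : AddSubgroup (Fin n → ℤ))))))) :
    IsAffineSpace f := by
  refine ⟨n, h.trans ?_⟩
  have htop : latticeSubalgebra k (⊤ : AddSubgroup (Fin n → ℤ)) = ⊤ :=
    eq_top_iff.2 fun f _ a _ ↦ AddSubgroup.mem_top _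
  rw [htop]
  refine (isoOver_of_algEquiv (Subalgebra.topEquiv.trans
    (MvPolynomial.renameEquiv k Equiv.ulift.{u}.symm))).trans ?_
  exact ⟨(AffineSpace.SpecIso _ (.of k)).symm, AffineSpace.SpecIso_inv_over ..⟩

end Quotient

end Toric

end

/-! ### Frames of full-dimensional simplicial cones. -/

noncomputable section

namespace Toric

section SimplicialFrame

variable {N : Type u} [AddCommGroup N]

/-- A generator of a simplicial cone is a multiple of a generating lattice vector. -/
lemma exists_latticeVec_eq_smul {ι : Type*} [DecidableEq ι] (b : Module.Basis ι ℝ (RealSpace N))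
    {S : Set N} (hS : PointedCone.hull ℝ (Set.range b) = PointedCone.hull ℝ (latticeVec '' S))
    (i : ι) : ∃ w ∈ S, ∃ t : ℝ, 0 < t ∧ latticeVec w = t • b i := by
  have hnonneg : ∀ x ∈ PointedCone.hull ℝ (Set.range b), ∀ j, 0 ≤ b.repr x j := by
    intro x hx j
    induction hx using Submodule.span_induction with
    | mem x hx =>
      obtain ⟨l, rfl⟩ := hx
      rw [b.repr_self, Finsupp.single_apply]
      split_ifs <;> norm_num
    | zero => simp
    | add x y _ _ hx hy => simpa using add_nonneg hx hy
    | smul a x _ hx =>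
      rw [show a • x = (a : ℝ) • x from rfl, map_smul]
      exact mul_nonneg a.2 hx
  by_contra! hcon
  -- If no element of `S` were a positive multiple of `b i`, every vector of the cone with positive
  -- `i`-th coordinate would have another positive coordinate. The vector `b i` itself does not.
  have key : ∀ x ∈ PointedCone.hull ℝ (latticeVec '' S),
      0 < b.repr x i → ∃ j ≠ i, 0 < b.repr x j := by
    intro x hx
    induction hx using Submodule.span_induction with
    | mem x hx =>
      obtain ⟨w, hw, rfl⟩ := hx
      intro hpos
      by_contra! hj
      refine hcon w hw _ hpos (b.repr.injective ?_)
      ext l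
      rcases eq_or_ne l i with rfl | hl
      · simp
      · have h1 := hnonneg (latticeVec w)
          (by rw [hS]; exact Submodule.subset_span ⟨w, hw, rfl⟩) l
        have h2 := hj l hl
        simpa [hl] using le_antisymm h2 h1
    | zero => simp
    | add x y hx' hy' hx hy =>
      intro hpos
      rw [map_add, Finsupp.add_apply] at hpos
      have hx0 := hnonneg x (by rw [hS]; exact hx')
      have hy0 := hnonneg y (by rw [hS]; exact hy')
      rcases lt_or_ge 0 (b.repr x i) with h | h
      · obtain ⟨j, hj, hj'⟩ := hx h
        exact ⟨j, hj, by simpa using add_pos_of_pos_of_nonneg hj' (hy0 j)⟩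
      · obtain ⟨j, hj, hj'⟩ := hy (by linarith)
        exact ⟨j, hj, by simpa using add_pos_of_nonneg_of_pos (hx0 j) hj'⟩
    | smul a x _ hx =>
      intro hpos
      rw [show a • x = (a : ℝ) • x from rfl, map_smul] at hpos ⊢
      rw [Finsupp.smul_apply, smul_eq_mul] at hpos
      have ha : (0 : ℝ) < a := lt_of_le_of_ne a.2 fun h ↦ by simp [← h] at hpos
      obtain ⟨j, hj, hj'⟩ := hx (pos_of_mul_pos_right hpos a.2)
      exact ⟨j, hj, mul_pos ha hj'⟩
  obtain ⟨j, hj, hj'⟩ := key (b i) (hS ▸ Submodule.subset_span ⟨i, rfl⟩) (by simp)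
  simp [hj.symm] at hj'

variable [Module.Free ℤ N] [Module.Finite ℤ N]

/-- Evaluation at the `w i` embeds the dual lattice in `ℤ^ι` as a subgroup of full rank. Its index
`c` annihilates the quotient, so the `c`-fold standard basis vectors have preimages. -/
lemma exists_dual_family {ι : Type*} [DecidableEq ι] [Finite ι] (w : ι → N)
    (hw : ∀ u : DualLattice N, (∀ i, u (w i) = 0) → u = 0)
    (hι : Nat.card ι = Module.finrank ℤ N) :
    ∃ (c : ℕ) (d : ι → DualLattice N), 0 < c ∧
      ∀ i j, d i (w j) = if i = j then (c : ℤ) else 0 := by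
  have := Fintype.ofFinite ι
  let Φ : DualLattice N →ₗ[ℤ] (ι → ℤ) := LinearMap.pi fun i ↦ LinearMap.applyₗ (w i)
  have hΦ : Function.Injective Φ := by
    rw [← LinearMap.ker_eq_bot, LinearMap.ker_eq_bot']
    exact fun u hu ↦ hw u fun i ↦ congrFun hu i
  have hrank : Module.finrank ℤ (LinearMap.range Φ) = Module.finrank ℤ (ι → ℤ) := by
    rw [LinearMap.finrank_range_of_inj hΦ, Module.finrank_pi, ← Nat.card_eq_fintype_card, hι,
      Module.finrank_linearMap, Module.finrank_self, mul_one]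
  have : Finite ((ι → ℤ) ⧸ LinearMap.range Φ) :=
    Submodule.finiteQuotientOfFreeOfRankEq _ hrank
  let c := Nat.card ((ι → ℤ) ⧸ LinearMap.range Φ)
  have hmem : ∀ i, c • (Pi.single i 1 : ι → ℤ) ∈ LinearMap.range Φ := by
    intro i
    rw [← Submodule.Quotient.mk_eq_zero, Submodule.Quotient.mk_smul]
    exact card_nsmul_eq_zero'
  choose d hd using hmem
  refine ⟨c, d, Nat.card_pos, fun i j ↦ ?_⟩
  have h1 : d i (w j) = (c • (Pi.single i 1 : ι → ℤ)) j := by rw [← hd]; rfl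
  rw [h1]
  by_cases h : i = j
  · subst h; simp
  · simp [h, Ne.symm h]

/-- A full-dimensional simplicial cone has a frame. -/
lemma exists_isFrame_of_isSimplicial {σ : PointedCone ℝ (RealSpace N)}
    (hσ : IsRationalPolyhedral σ) (hs : PointedCone.IsSimplicial σ)
    (hspan : Submodule.span ℝ (σ : Set (RealSpace N)) = ⊤) :
    ∃ (ι : Type u) (_ : DecidableEq ι) (_ : Fintype ι) (w : ι → N) (c : ℕ)
      (d : ι → DualLattice N), IsFrame σ w c d := by
  classical
  obtain ⟨S, hS, rfl⟩ := hσ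
  obtain ⟨s, hfin, hli, hσ⟩ := hs
  have : Finite s := hfin
  have htop : ⊤ ≤ Submodule.span ℝ (Set.range ((↑) : s → RealSpace N)) := by
    rw [← hspan, Submodule.span_le, ← hσ, Subtype.range_coe]
    intro x hx
    induction hx using Submodule.span_induction with
    | mem x hx => exact Submodule.subset_span hx
    | zero => exact zero_mem _
    | add x y _ _ hx hy => exact add_mem hx hy
    | smul a x _ hx => exact Submodule.smul_mem _ (a : ℝ) hx
  let b : Module.Basis s ℝ (RealSpace N) := Module.Basis.mk hli htop
  have hb : ∀ i, b i = i := fun i ↦ Module.Basis.mk_apply _ _ _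
  have hbr : Set.range b = s := by
    have : (b : s → RealSpace N) = (↑) := funext hb
    rw [this, Subtype.range_coe]
  choose w hw t ht hwt using exists_latticeVec_eq_smul b (S := S) (by rw [hbr]; exact hσ)
  have hpair : ∀ (u : DualLattice N) i, (u (w i) : ℝ) = t i * pairing u (b i) := fun u i ↦ by
    rw [← pairing_latticeVec, hwt, map_smul, smul_eq_mul]
  have hzero : ∀ u : DualLattice N, (∀ i, u (w i) = 0) → u = 0 := by
    intro u hu
    apply pairing_injective
    rw [pairing_zero]
    refine b.ext fun i ↦ ?_
    have := hpair u i
    rw [hu i, Int.cast_zero] at this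
    rcases mul_eq_zero.1 this.symm with h | h
    · exact absurd h (ht i).ne'
    · simpa using h
  have hcard : Nat.card s = Module.finrank ℤ N := by
    rw [← Module.finrank_eq_nat_card_basis b, Module.finrank_baseChange]
  obtain ⟨c, d, hc, hd⟩ := exists_dual_family w hzero hcard
  refine ⟨s, inferInstance, Fintype.ofFinite s, w, c, d, fun u ↦ ⟨fun hu i ↦ ?_, fun hu ↦ ?_⟩,
    hzero, hc, hd⟩
  · exact mem_dualMonoid_hull.1 hu _ (hw i)
  · intro x hx
    change x ∈ PointedCone.hull ℝ (latticeVec '' S) at hx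
    rw [← hσ] at hx
    induction hx using Submodule.span_induction with
    | mem x hx =>
      have h1 := hpair u ⟨x, hx⟩
      rw [hb] at h1
      have h2 : (0 : ℝ) ≤ u (w ⟨x, hx⟩) := by exact_mod_cast hu ⟨x, hx⟩
      rw [h1] at h2
      exact nonneg_of_mul_nonneg_right h2 (ht _)
    | zero => simp
    | add x y _ _ hx hy => rw [map_add]; exact add_nonneg hx hy
    | smul a x _ hx =>
      rw [show a • x = (a : ℝ) • x from rfl, map_smul]
      exact mul_nonneg a.2 hx

end SimplicialFrame

end Toric

end

/-! ### Frames of cones with smooth charts. -/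

noncomputable section

namespace Toric

section FormallySmooth

open MvPolynomial

variable {k : Type*} [Field k]

/-- Substitutions which are the identity to first order do not change the lowest terms. -/
lemma aeval_monomial_sub_monomial_mem {H : Type*} {q : H → MvPolynomial H k}
    (hq : ∀ h, q h - X h ∈ idealOfVars H k ^ 2) (a : H →₀ ℕ) :
    aeval q (monomial a (1 : k)) - monomial a 1 ∈ idealOfVars H k ^ (a.degree + 1) := by
  have hmon : ∀ b : H →₀ ℕ, monomial b (1 : k) ∈ idealOfVars H k ^ b.degree := fun b ↦ by
    classical
    rw [mem_pow_idealOfVars_iff']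
    intro c hc
    rw [coeff_monomial, if_neg]
    rintro rfl
    exact lt_irrefl _ hc
  have hadd : ∀ a b : H →₀ ℕ,
      aeval q (monomial a (1 : k)) - monomial a 1 ∈ idealOfVars H k ^ (a.degree + 1) →
      aeval q (monomial b (1 : k)) - monomial b 1 ∈ idealOfVars H k ^ (b.degree + 1) →
      aeval q (monomial (a + b) (1 : k)) - monomial (a + b) 1 ∈
        idealOfVars H k ^ ((a + b).degree + 1) := by
    intro a b ha hb
    have h1 : monomial (a + b) (1 : k) = monomial a 1 * monomial b 1 := by
      rw [monomial_mul, one_mul]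
    have hb' : aeval q (monomial b (1 : k)) ∈ idealOfVars H k ^ b.degree := by
      have := add_mem (Ideal.pow_le_pow_right (Nat.le_succ _) hb) (hmon b)
      rwa [sub_add_cancel] at this
    have h2 := Ideal.mul_mem_mul ha hb'
    have h3 := Ideal.mul_mem_mul (hmon a) hb
    rw [← pow_add] at h2 h3
    rw [h1, map_mul, map_add]
    have h4 : aeval q (monomial a (1 : k)) * aeval q (monomial b (1 : k)) -
        monomial a 1 * monomial b 1 =
        (aeval q (monomial a (1 : k)) - monomial a 1) * aeval q (monomial b (1 : k)) +
          monomial a 1 * (aeval q (monomial b (1 : k)) - monomial b 1) := by ring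
    rw [h4]
    refine add_mem ?_ ?_
    · rwa [add_right_comm]
    · rwa [add_assoc]
  have hzero : aeval q (monomial (0 : H →₀ ℕ) (1 : k)) - monomial 0 1 ∈
      idealOfVars H k ^ ((0 : H →₀ ℕ).degree + 1) := by
    simp
  induction a using Finsupp.induction_linear with
  | zero => exact hzero
  | add a b ha hb => exact hadd a b ha hb
  | single h n =>
    induction n with
    | zero => simp
    | succ n ih =>
      rw [Finsupp.single_add]
      refine hadd _ _ ih ?_
      rw [← X, aeval_X, Finsupp.degree_single]
      exact hq h

/-- If the algebra of a reduced commutative monoid is formally smooth, then the irreducible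
elements of the monoid satisfy no relations. -/
lemma injective_of_formallySmooth {S : Type*} [AddCommMonoid S]
    [Algebra.FormallySmooth k (AddMonoidAlgebra k S)] (hS : ∀ a b : S, a + b = 0 → a = 0)
    {H : Set S} (h0 : 0 ∉ H) (hH : ∀ a b, a + b ∈ H → a = 0 ∨ b = 0) :
    Function.Injective fun a : H →₀ ℕ ↦ a.sum fun h n ↦ n • (h : S) := by
  classical
  suffices hle : ∀ a b : H →₀ ℕ, a.degree ≤ b.degree →
      (a.sum fun h n ↦ n • (h : S)) = (b.sum fun h n ↦ n • (h : S)) → a = b by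
    intro a b hab
    rcases le_total a.degree b.degree with h | h
    · exact hle a b h hab
    · exact (hle b a h hab.symm).symm
  intro a b hdeg hab
  let m := idealOfVars H k
  -- The order `r` has to exceed the degree of `a`, so that the term `X^a` survives modulo `m ^ r`,
  -- and has to be at least 2.
  let r := a.degree + 2
  -- Elements of `H` go to their variables and other nonzero elements to 0. This is multiplicative
  -- modulo `m ^ 2`, since a sum of two nonzero elements is nonzero and never in `H`.
  let tgt : S → MvPolynomial H k := fun s ↦
    if s = 0 then 1 else if h : s ∈ H then X ⟨s, h⟩ else 0
  have htgt0 : tgt 0 = 1 := if_pos rfl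
  have htgtH : ∀ h : H, tgt h = X h := fun h ↦ by
    have : (h : S) ≠ 0 := fun e ↦ h0 (e ▸ h.2)
    simp [tgt, this]
  have htgtm : ∀ s, s ≠ 0 → tgt s ∈ m := fun s hs ↦ by
    simp only [tgt, if_neg hs]
    split_ifs with h
    · exact Ideal.subset_span ⟨_, rfl⟩
    · exact zero_mem _
  let f : AddMonoidAlgebra k S →ₐ[k] MvPolynomial H k ⧸ m ^ 2 :=
    AddMonoidAlgebra.lift k _ S
      { toFun := fun s ↦ Ideal.Quotient.mk _ (tgt s.toAdd)
        map_one' := by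
          change Ideal.Quotient.mk (m ^ 2) (tgt 0) = 1
          rw [htgt0, map_one]
        map_mul' := fun s t ↦ by
          change Ideal.Quotient.mk (m ^ 2) (tgt (s.toAdd + t.toAdd)) = _
          rw [← map_mul]
          by_cases hs : s.toAdd = 0
          · rw [hs, htgt0, zero_add, one_mul]
          by_cases ht : t.toAdd = 0
          · rw [ht, htgt0, add_zero, mul_one]
          have h1 : tgt (s.toAdd + t.toAdd) = 0 := by
            have h2 : s.toAdd + t.toAdd ≠ 0 := fun e ↦ hs (hS _ _ e)
            have h3 : s.toAdd + t.toAdd ∉ H := fun e ↦ (hH _ _ e).elim hs ht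
            simp only [tgt, if_neg h2, dif_neg h3]
          rw [h1, map_zero, eq_comm, Ideal.Quotient.eq_zero_iff_mem, pow_two]
          exact Ideal.mul_mem_mul (htgtm _ hs) (htgtm _ ht) }
  have hf : ∀ h : H, f (.single (h : S) 1) = Ideal.Quotient.mk _ (X h) := fun h ↦ by
    rw [← htgtH h]
    simp only [f, AddMonoidAlgebra.lift_single, one_smul]
    rfl
  have hle : m ^ r ≤ m ^ 2 := Ideal.pow_le_pow_right (by omega)
  let g : (MvPolynomial H k ⧸ m ^ r) →ₐ[k] MvPolynomial H k ⧸ m ^ 2 := Ideal.Quotient.factorₐ k hle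
  have hg : Function.Surjective g := Ideal.Quotient.factor_surjective hle
  have hnil : IsNilpotent (RingHom.ker g) := by
    refine ⟨r, ?_⟩
    have h1 : RingHom.ker g ≤ (m ^ 2).map (Ideal.Quotient.mk (m ^ r)) := by
      intro x hx
      obtain ⟨p, rfl⟩ := Ideal.Quotient.mk_surjective x
      exact Ideal.mem_map_of_mem _ (Ideal.Quotient.eq_zero_iff_mem.1 hx)
    refine le_bot_iff.1 ((Ideal.pow_right_mono h1 r).trans ?_)
    rw [← Ideal.map_pow, ← pow_mul, Ideal.map_le_iff_le_comap]
    intro p hp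
    rw [Ideal.mem_comap, Ideal.mem_bot, Ideal.Quotient.eq_zero_iff_mem]
    exact Ideal.pow_le_pow_right (by omega) hp
  -- Lift the first-order homomorphism to order `r`. The images of the elements of `H` become `q h =
  -- X h` plus terms of order at least 2, so equal sums give `q^a ≡ q^b` modulo `m ^ r`, and
  -- comparing lowest terms yields `a = b`.
  let F := Algebra.FormallySmooth.liftOfSurjective f g hg hnil
  have hF : ∀ x, g (F x) = f x := Algebra.FormallySmooth.liftOfSurjective_apply f g hg hnil
  choose q hq using fun h : H ↦ Ideal.Quotient.mk_surjective (F (.single (h : S) 1))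
  have hq2 : ∀ h, q h - X h ∈ m ^ 2 := fun h ↦ by
    rw [← Ideal.Quotient.eq, ← hf, ← hF, ← hq]
    rfl
  have hFmon : ∀ c : H →₀ ℕ, Ideal.Quotient.mk (m ^ r) (aeval q (monomial c (1 : k))) =
      F (.single (c.sum fun h n ↦ n • (h : S)) 1) := by
    intro c
    rw [aeval_monomial, map_one, one_mul, Finsupp.prod, map_prod]
    have h1 : (AddMonoidAlgebra.single (c.sum fun h n ↦ n • (h : S)) (1 : k)) =
        ∏ h ∈ c.support, AddMonoidAlgebra.single (h : S) (1 : k) ^ c h := by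
      simp only [AddMonoidAlgebra.single_pow, one_pow]
      have := map_prod (AddMonoidAlgebra.of k S) (fun h ↦ Multiplicative.ofAdd (c h • (h : S)))
        c.support
      exact this
    rw [h1, map_prod]
    refine Finset.prod_congr rfl fun h _ ↦ ?_
    rw [map_pow, map_pow, hq]
  have hsub : aeval q (monomial a (1 : k)) - aeval q (monomial b (1 : k)) ∈ m ^ r := by
    rw [← Ideal.Quotient.eq, hFmon, hFmon, hab]
  have h1 := Ideal.pow_le_pow_right (show a.degree + 1 ≤ r by omega) hsub
  have h2 := aeval_monomial_sub_monomial_mem hq2 a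
  have h3 := Ideal.pow_le_pow_right (show a.degree + 1 ≤ b.degree + 1 by omega)
    (aeval_monomial_sub_monomial_mem hq2 b)
  have h4 := sub_mem (sub_mem h1 h2) (neg_mem h3)
  have h5 : monomial a (1 : k) - monomial b 1 ∈ m ^ (a.degree + 1) := by
    convert h4 using 1
    ring
  by_contra hne
  have h6 := (mem_pow_idealOfVars_iff' _ _).1 h5 a (Nat.lt_succ_self _)
  rw [coeff_sub, coeff_monomial, coeff_monomial, if_pos rfl, if_neg (Ne.symm hne), sub_zero] at h6
  exact one_ne_zero h6

end FormallySmooth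

section SmoothFrame

variable {N : Type u} [AddCommGroup N] [Module.Free ℤ N] [Module.Finite ℤ N]
  {σ : PointedCone ℝ (RealSpace N)}

/-- If the chart of a full-dimensional cone is smooth, then the cone is generated by a basis of
the lattice. -/
lemma exists_isFrame_of_formallySmooth (k : Type*) [Field k] (hσ : IsRationalPolyhedral σ)
    (hσ' : IsStronglyConvex σ) (hspan : Submodule.span ℝ (σ : Set (RealSpace N)) = ⊤)
    [Algebra.FormallySmooth k (AddMonoidAlgebra k (dualMonoid σ))] :
    ∃ (ι : Type u) (_ : DecidableEq ι) (_ : Fintype ι) (w : ι → N)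
      (d : ι → DualLattice N), IsFrame σ w 1 d := by
  classical
  obtain ⟨x, hx, hinter⟩ := hσ.exists_interior
  have hdeg : ∀ u ∈ dualMonoid σ, 0 ≤ u x := fun u hu ↦ by
    have := hu _ hx
    rw [pairing_latticeVec] at this
    exact_mod_cast this
  have hdeg0 : ∀ u ∈ dualMonoid σ, u x = 0 → u = 0 := fun u hu h ↦ by
    apply pairing_injective
    rw [pairing_zero]
    exact LinearMap.ext_on hspan fun y hy ↦ hinter u hu h y hy
  have hred : ∀ a b : dualMonoid σ, a + b = 0 → a = 0 := fun a b h ↦ by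
    have h1 : a.1 x + b.1 x = 0 := by
      rw [← LinearMap.add_apply, ← AddSubmonoid.coe_add, h]
      rfl
    exact Subtype.ext (hdeg0 _ a.2 (by linarith [hdeg _ a.2, hdeg _ b.2]))
  let H : Set (dualMonoid σ) := {h | h ≠ 0 ∧ ∀ a b, a + b = h → a = 0 ∨ b = 0}
  have hinj := injective_of_formallySmooth (k := k) hred (H := H) (fun h ↦ h.1 rfl)
    (fun a b h ↦ h.2 a b rfl)
  -- Evaluation at the interior point `x` is a degree, positive on nonzero elements of the
  -- semigroup. So every element decomposes into irreducible ones by induction.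
  have hgen : ∀ n : ℕ, ∀ u : dualMonoid σ, u.1 x ≤ n → u ∈ AddSubmonoid.closure H := by
    intro n
    induction n with
    | zero =>
      intro u hu
      have : u = 0 := Subtype.ext (hdeg0 _ u.2 (le_antisymm (by exact_mod_cast hu) (hdeg _ u.2)))
      rw [this]
      exact zero_mem _
    | succ n ih =>
      intro u hu
      by_cases h0 : u = 0
      · rw [h0]
        exact zero_mem _
      by_cases hH : u ∈ H
      · exact AddSubmonoid.subset_closure hH
      obtain ⟨a, b, hab, ha, hb⟩ : ∃ a b, a + b = u ∧ a ≠ 0 ∧ b ≠ 0 := by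
        by_contra! hc
        refine hH ⟨h0, fun a b hab ↦ ?_⟩
        by_contra! hab'
        exact hab'.2 (hc a b hab hab'.1)
      have hsum : a.1 x + b.1 x = u.1 x := by
        rw [← hab]
        rfl
      have hpos : ∀ c : dualMonoid σ, c ≠ 0 → 0 < c.1 x := fun c hc ↦
        lt_of_le_of_ne (hdeg _ c.2) fun h ↦ hc (Subtype.ext (hdeg0 _ c.2 h.symm))
      have h1 := hpos a ha
      have h2 := hpos b hb
      push_cast at hu
      rw [← hab]
      exact add_mem (ih a (by linarith)) (ih b (by linarith))
  let φ : H → DualLattice N := fun h ↦ h.1.1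
  have hcomb : ∀ u : dualMonoid σ, ∃ a : H →₀ ℕ, (a.sum fun h n ↦ n • h.1) = u := by
    intro u
    have hu := hgen (u.1 x).toNat u (Int.self_le_toNat _)
    induction hu using AddSubmonoid.closure_induction with
    | mem h hh => exact ⟨Finsupp.single ⟨h, hh⟩ 1, by simp⟩
    | zero => exact ⟨0, by simp⟩
    | add a b _ _ ha hb =>
      obtain ⟨a', rfl⟩ := ha
      obtain ⟨b', rfl⟩ := hb
      exact ⟨a' + b', Finsupp.sum_add_index' (by simp) (by simp [add_smul])⟩
  -- Split an integral relation into its positive and negative parts and use that sums of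
  -- irreducible elements determine their multiplicities.
  have hli : LinearIndependent ℤ φ := by
    rw [linearIndependent_iff]
    intro g hg
    let a : H →₀ ℕ := g.mapRange Int.toNat rfl
    let a' : H →₀ ℕ := g.mapRange (fun z ↦ (-z).toNat) rfl
    have hsum : ∀ c : H →₀ ℕ, (c.sum fun h n ↦ n • h.1).1 =
        Finsupp.linearCombination ℤ φ (c.mapRange (Nat.cast : ℕ → ℤ) rfl) := by
      intro c
      rw [Finsupp.linearCombination_apply, Finsupp.sum_mapRange_index (by simp)]
      simp only [natCast_zsmul]
      exact map_finsuppSum (dualMonoid σ).subtype c _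
    have heq : (a.mapRange (Nat.cast : ℕ → ℤ) rfl) - a'.mapRange (Nat.cast : ℕ → ℤ) rfl = g := by
      ext h
      simp only [a, a', Finsupp.sub_apply, Finsupp.mapRange_apply]
      omega
    have haa' : a = a' := hinj (Subtype.ext (by
      rw [hsum, hsum, ← sub_eq_zero, ← map_sub, heq, hg]))
    rw [← heq, haa', sub_self]
  have hsp : ⊤ ≤ Submodule.span ℤ (Set.range φ) := by
    have hS : ∀ u ∈ dualMonoid σ, u ∈ Submodule.span ℤ (Set.range φ) := by
      intro u hu
      obtain ⟨a, ha⟩ := hcomb ⟨u, hu⟩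
      have : u = a.sum fun h n ↦ n • φ h := by
        have := congrArg (dualMonoid σ).subtype ha
        rw [map_finsuppSum] at this
        exact this.symm
      rw [this]
      exact Submodule.sum_mem _ fun h _ ↦
        Submodule.smul_of_tower_mem _ _ (Submodule.subset_span ⟨h, rfl⟩)
    intro u _
    -- Adding a large multiple of a strictly positive `u₀` moves any `u` into the dual semigroup,
    -- which therefore generates `M` as a group.
    obtain ⟨u₀, hu₀, hpos⟩ := exists_forall_pos hσ hσ'
    obtain ⟨p, hp⟩ := exists_add_nsmul_mem (τ := ⊥) hσ hu₀ (fun y ↦ by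
      rw [Submodule.mem_bot]
      exact ⟨by rintro rfl; simp, fun h ↦ hpos y h.1 h.2⟩) (w := u) (by
        intro y hy
        rw [(Submodule.mem_bot _).1 hy, map_zero])
    have h1 := sub_mem (hS _ (hp p le_rfl)) (hS _ (nsmul_mem hu₀ p))
    rwa [add_sub_cancel_right] at h1
  let b : Module.Basis H ℤ (DualLattice N) := Module.Basis.mk hli hsp
  have hb : ∀ h, b h = φ h := fun h ↦ Module.Basis.mk_apply _ _ _
  have : Finite H := Module.Finite.finite_basis b
  -- The basis of `N` dual to the irreducible elements.
  let w : H → N := fun h ↦ (Module.evalEquiv ℤ N).symm (b.coord h)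
  have hw : ∀ (u : DualLattice N) h, u (w h) = b.repr u h := by
    intro u h
    have : Module.evalEquiv ℤ N (w h) u = b.coord h u := by
      rw [LinearEquiv.apply_symm_apply]
    exact this
  refine ⟨H, inferInstance, Fintype.ofFinite H, w, φ, fun u ↦ ⟨fun hu i ↦ ?_, fun hu ↦ ?_⟩,
    fun u hu ↦ ?_, one_pos, fun i j ↦ ?_⟩
  · obtain ⟨a, ha⟩ := hcomb ⟨u, hu⟩
    have : u = a.sum fun h n ↦ n • b h := by
      have := congrArg (dualMonoid σ).subtype ha
      rw [map_finsuppSum] at this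
      simp only [hb]
      exact this.symm
    rw [hw, this, map_finsuppSum, Finsupp.sum, Finsupp.finsetSum_apply]
    refine Finset.sum_nonneg fun h _ ↦ ?_
    rw [map_nsmul, b.repr_self, Finsupp.smul_apply, Finsupp.single_apply]
    split_ifs <;> simp
  · have := Fintype.ofFinite H
    rw [← b.sum_repr u]
    refine sum_mem fun h _ ↦ ?_
    have h1 := hu h
    rw [hw] at h1
    obtain ⟨n, hn⟩ := Int.eq_ofNat_of_zero_le h1
    rw [hn, hb, natCast_zsmul]
    exact nsmul_mem h.1.2 n
  · apply b.repr.injective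
    ext h
    rw [← hw, hu h]
    simp
  · rw [hw, ← hb, b.repr_self, Finsupp.single_apply]
    simp

end SmoothFrame

end Toric

end

/-! ### Smoothness of charts and the main theorem. -/

noncomputable section

namespace Toric

namespace Fan

variable {N : Type u} [AddCommGroup N] (Δ : Fan N) (k : Type u) [Field k]

lemma formallySmooth_chartRing [Smooth (Δ.structureMorphism k)] (σ : Δ.cones) :
    Algebra.FormallySmooth k (ChartRing k σ.1) := by
  have h : Smooth (Spec.map (CommRingCat.ofHom (algebraMap k (ChartRing k σ.1)))) := by
    rw [← Δ.chartι_structureMorphism k σ]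
    infer_instance
  rw [HasRingHomProperty.Spec_iff (P := @Smooth)] at h
  exact RingHom.formallySmooth_algebraMap.1 h.formallySmooth

end Fan

end Toric

end

/-- The filtration of a quasi-projective toric variety with convex full-dimensional support, whose
strata are affine spaces in the smooth case and finite quotients of affine spaces in the simplicial
case. -/
theorem mainTheorem9 {k N : Type u} [Field k] [IsAlgClosed k]
    [AddCommGroup N] [Module.Free ℤ N] [Module.Finite ℤ N] (Δ : Toric.Fan N)
    (hqp : Toric.IsQuasiProjective (Δ.structureMorphism k))
    (hsupp : Δ.HasConvexFullDimensionalSupport) :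
    ∃ (r : ℕ) (U : Fin (r + 1) → (Δ.variety k).Opens),
      U 0 = ⊥ ∧ U (Fin.last r) = ⊤ ∧ Monotone U ∧ (∀ i, Δ.IsTorusInvariant (U i)) ∧
      (∀ i : Fin r, ∃ σ : Δ.cones, Δ.IsMaximalCone σ ∧
        ∃ Z : Set (Δ.variety k), IsClosed Z ∧
          (U i.succ : Set (Δ.variety k)) \ U i.castSucc = Z ∩ Δ.chart k σ) ∧
      (Smooth (Δ.structureMorphism k) → ∀ i : Fin r,
        Toric.IsAffineSpace
          (Toric.diffSchemeι (U i.succ) (U i.castSucc) ≫ Δ.structureMorphism k)) ∧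
      (Δ.IsSimplicial → ∀ i : Fin r,
        (CharZero k → Toric.IsFiniteQuotientOfAffineSpace
          (Toric.diffSchemeι (U i.succ) (U i.castSucc) ≫ Δ.structureMorphism k)) ∧
        Toric.IsFiniteGroupSchemeQuotientOfAffineSpace
          (Toric.diffSchemeι (U i.succ) (U i.castSucc) ≫ Δ.structureMorphism k)) := by
  obtain ⟨v, hv⟩ := Toric.Fan.exists_isGeneric hsupp
  obtain ⟨m, hm⟩ := Toric.Fan.exists_isVertexFamily hqp hsupp
  obtain ⟨r, U, s, h0, hlast, hmono, hinv, hs⟩ :=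
    Toric.Fan.exists_filtration (k := k) hsupp hv hm
  refine ⟨r, U, h0, hlast, hmono, hinv, fun i ↦ ?_, fun hsm i ↦ ?_, fun hsimp i ↦ ?_⟩
  · obtain ⟨hmax, -, hdiff⟩ := hs i
    rw [hdiff]
    exact ⟨s i, hmax, Toric.Fan.exists_isClosed_inter_chart v (s i)⟩
  · obtain ⟨hmax, hle, hdiff⟩ := hs i
    have := Δ.formallySmooth_chartRing k (s i)
    obtain ⟨ι, _, _, w, d, hframe⟩ := Toric.exists_isFrame_of_formallySmooth k
      (Δ.rational _ (s i).2) (Δ.stronglyConvex _ (s i).2) (hmax.span_eq_top hsupp)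
    obtain ⟨n, L, hL, hiso⟩ := Toric.Fan.exists_isoOver_latticeSubalgebra hle hdiff hframe
    -- In the smooth case the frame has `c = 1`, so `L` contains every exponent vector.
    obtain rfl : L = ⊤ := eq_top_iff.2 fun b _ ↦ one_nsmul b ▸ hL b
    exact Toric.isAffineSpace_of_top k hiso
  · obtain ⟨hmax, hle, hdiff⟩ := hs i
    obtain ⟨ι, _, _, w, c, d, hframe⟩ := Toric.exists_isFrame_of_isSimplicial
      (Δ.rational _ (s i).2) (hsimp _ (s i).2) (hmax.span_eq_top hsupp)
    obtain ⟨n, L, hL, hiso⟩ := Toric.Fan.exists_isoOver_latticeSubalgebra hle hdiff hframe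
    have := Toric.finite_quotient L hframe.pos hL
    exact ⟨fun _ ↦ Toric.isFiniteQuotientOfAffineSpace k L hiso,
      Toric.isFiniteGroupSchemeQuotientOfAffineSpace k L hiso⟩
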